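/- Let $H=(V,E,w)$ be a directed host graph with $V=\{v_1,\dots,v_n\}$ and vertex weights $w:V\to\mathbb{Q}_{\ge 0}$, and let $\mathbf{s}=(s_1,\dots,s_k)\in V^k$ be a facility placement profile, where $s_j$ is the location of facility $f_j$. For a client $v_i\in V$ let $N(v_i)=\{v_i\}\cup\{z\mid (v_i,z)\in E\}$ and $N_{\mathbf{s}}(v_i)=\{f_j\mid s_j\in N(v_i)\}$. A feasible weight distribution of client $v_i$ is a vector $x\in\mathbb{R}_{\ge 0}^k$ with $x_j=0$ whenever $f_j\notin N_{\mathbf{s}}(v_i)$, and with $\sum_{j=1}^k x_j=w(v_i)$ if $N_{\mathbf{s}}(v_i)\neq\emptyset$. If each client $v_i$ chooses the feasible distribution $\sigma_i=(\sigma_{i,1},\dots,\sigma_{i,k})$, then facility $f_j$ has load $\ell_j(\sigma)=\sum_{i=1}^n\sigma_{i,j}$, and client $v_i$ has cost $L_i(\sigma)=\sum_{j=1}^k\sigma_{i,j}\,\ell_j(\sigma)$. A client equilibrium of the Min-2-FLG for $\mathbf{s}$ is a family $\sigma=(\sigma_i)_{i}$ of feasible distributions such that $L_i(\sigma)\le L_i(x,\sigma_{-i})$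 for every client $v_i$ and every feasible distribution $x$ of $v_i$. **Theorem.** For every host graph $H$ and every facility placement profile $\mathbf{s}$ there is exactly one client equilibrium of the Min-2-FLG. There is an algorithm that, given $H$ (as an adjacency matrix, with the weights as fractions of integers in binary) and $\mathbf{s}$, computes this equilibrium exactly (each $\sigma_{i,j}$ as a fraction of integers in binary), in time polynomial in the bit length of the input. Time is measured on a random access machine with integer arithmetic ($+,-,\cdot$, integer division) under the logarithmic cost criterion, where each operation is charged the bit lengths of the numbers and addresses involved. -/

import Mathlib

/-! ### A random access machine with logarithmic cost

Structured programs over integer variables and integer arrays. Evaluating any node of an expression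
is charged the bit length of the value at that node, so a run of total cost `t` makes at most `t`
steps and handles only numbers (and array indices) of at most `t` bits. -/

namespace RAM

/-- Cost of handling the integer `z`: its number of binary digits, plus one. -/
def bitCost (z : ℤ) : ℕ := z.natAbs.size + 1

/-- A memory state: the values of the variables, and the contents of the arrays
(`arr a p` is cell `p` of array `a`). -/
structure Store where
  var : ℕ → ℤ
  arr : ℕ → ℤ → ℤ

/-- Arithmetic expressions. -/
inductive Expr where
  | const (z : ℤ)
  | var (x : ℕ)
  | get (a : ℕ) (idx : Expr)
  | add (e f : Expr)
  | sub (e f : Expr)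
  | mul (e f : Expr)
  | div (e f : Expr)

/-- The value of an expression (`div` is integer division). -/
def Expr.eval (st : Store) : Expr → ℤ
  | .const z => z
  | .var x => st.var x
  | .get a idx => st.arr a (idx.eval st)
  | .add e f => e.eval st + f.eval st
  | .sub e f => e.eval st - f.eval st
  | .mul e f => e.eval st * f.eval st
  | .div e f => e.eval st / f.eval st

/-- The cost of evaluating an expression: each node is charged the bit cost of its value. -/
def Expr.cost (st : Store) : Expr → ℕ
  | .const z => bitCost z
  | .var x => bitCost (st.var x)
  | .get a idx => idx.cost st + bitCost (st.arr a (idx.eval st))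
  | .add e f => e.cost st + f.cost st + bitCost (e.eval st + f.eval st)
  | .sub e f => e.cost st + f.cost st + bitCost (e.eval st - f.eval st)
  | .mul e f => e.cost st + f.cost st + bitCost (e.eval st * f.eval st)
  | .div e f => e.cost st + f.cost st + bitCost (e.eval st / f.eval st)

/-- Programs. The tests of `cond` and `loop` ask whether the value of `e` is positive. -/
inductive Prog where
  | skip
  | assign (x : ℕ) (e : Expr)
  | store (a : ℕ) (idx e : Expr)
  | seq (P Q : Prog)
  | cond (e : Expr) (P Q : Prog)
  | loop (e : Expr) (P : Prog)

/-- `Exec P st st' t`: the program `P`, started in the state `st`, halts in the state `st'`,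
and the total cost of the run is `t`. -/
inductive Exec : Prog → Store → Store → ℕ → Prop where
  | skip (st : Store) : Exec .skip st st 1
  | assign (x : ℕ) (e : Expr) (st : Store) :
      Exec (.assign x e) st { st with var := Function.update st.var x (e.eval st) }
        (e.cost st + 1)
  | store (a : ℕ) (idx e : Expr) (st : Store) :
      Exec (.store a idx e) st
        { st with
          arr := Function.update st.arr a
            (Function.update (st.arr a) (idx.eval st) (e.eval st)) }
        (idx.cost st + e.cost st + 1)
  | seq {P Q : Prog} {st st₁ st₂ : Store} {t₁ t₂ : ℕ} :
      Exec P st st₁ t₁ → Exec Q st₁ st₂ t₂ → Exec (.seq P Q) st st₂ (t₁ + t₂)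
  | condTrue {e : Expr} {P Q : Prog} {st st₁ : Store} {t : ℕ} :
      0 < e.eval st → Exec P st st₁ t → Exec (.cond e P Q) st st₁ (e.cost st + 1 + t)
  | condFalse {e : Expr} {P Q : Prog} {st st₁ : Store} {t : ℕ} :
      ¬ 0 < e.eval st → Exec Q st st₁ t → Exec (.cond e P Q) st st₁ (e.cost st + 1 + t)
  | loopStop {e : Expr} {P : Prog} {st : Store} :
      ¬ 0 < e.eval st → Exec (.loop e P) st st (e.cost st + 1)
  | loopStep {e : Expr} {P : Prog} {st st₁ st₂ : Store} {t₁ t₂ : ℕ} :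
      0 < e.eval st → Exec P st st₁ t₁ → Exec (.loop e P) st₁ st₂ t₂ →
        Exec (.loop e P) st st₂ (e.cost st + 1 + t₁ + t₂)

/-- The initial state on an input that consists of finitely many lists of integers: the `a`-th list
is written into the array `a`, from cell `0` on; everything else is `0`. -/
def Store.init (input : List (List ℤ)) : Store where
  var := fun _ => 0
  arr := fun a p => if p < 0 then 0 else (input.getD a []).getD p.toNat 0

/-- The size of an input in bits. -/
def inputSize (input : List (List ℤ)) : ℕ :=
  (input.map fun l => (l.map bitCost).sum).sum

end RAM

/-! ### The client stage of the two-sided facility location game -/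

namespace TwoFLG

/-- A host graph with `n` vertices: a directed graph with nonnegative rational vertex weights. -/
structure HostGraph (n : ℕ) where
  graph : Digraph (Fin n)
  w : Fin n → ℚ≥0

variable {n k : ℕ}

/-- The shopping range of client `i`: her direct closed neighborhood. -/
def HostGraph.shoppingRange (H : HostGraph n) (i : Fin n) : Set (Fin n) :=
  {i} ∪ {z | H.graph.Adj i z}

/-- The set of facilities in the shopping range of client `i` under the placement profile `s`. -/
def HostGraph.facilitiesInRange (H : HostGraph n) (s : Fin k → Fin n) (i : Fin n) :
    Set (Fin k) :=
  {j | s j ∈ H.shoppingRange i}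

/-- Feasible weight distributions of client `i` under the profile `s`: nonnegative, supported on the
facilities in her range, and of total weight `w i` if there is such a facility. -/
structure HostGraph.FeasibleFor (H : HostGraph n) (s : Fin k → Fin n) (i : Fin n)
    (x : Fin k → ℝ) : Prop where
  nonneg : ∀ j, 0 ≤ x j
  eq_zero : ∀ j, j ∉ H.facilitiesInRange s i → x j = 0
  sum_eq : (H.facilitiesInRange s i).Nonempty → ∑ j, x j = (H.w i : ℝ)

/-- The load of facility `j`, where `σ i j` is the weight that client `i` gives to facility `j`. -/
def load (σ : Fin n → Fin k → ℝ) (j : Fin k) : ℝ := ∑ i, σ i j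

/-- The cost (total waiting time) of client `i`. -/
def clientCost (σ : Fin n → Fin k → ℝ) (i : Fin n) : ℝ := ∑ j, σ i j * load σ j

/-- Client equilibria of the Min-2-FLG for the placement profile `s`: feasible client weight
distributions in which no client can lower her cost by changing her own distribution. -/
structure HostGraph.IsClientEquilibrium (H : HostGraph n) (s : Fin k → Fin n)
    (σ : Fin n → Fin k → ℝ) : Prop where
  feasible : ∀ i, H.FeasibleFor s i (σ i)
  best_response : ∀ i, ∀ x : Fin k → ℝ, H.FeasibleFor s i x →
    clientCost σ i ≤ clientCost (Function.update σ i x) i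

open Classical in
/-- The encoding of an instance as five lists: `n` and `k`; the adjacency matrix, row by row; the
numerators of the weights; their denominators; the locations of the facilities. -/
noncomputable def HostGraph.encode (H : HostGraph n) (s : Fin k → Fin n) : List (List ℤ) :=
  [ [(n : ℤ), (k : ℤ)],
    List.ofFn fun p : Fin (n * n) => if H.graph.Adj p.divNat p.modNat then (1 : ℤ) else 0,
    List.ofFn fun i => ((H.w i).num : ℤ),
    List.ofFn fun i => ((H.w i).den : ℤ),
    List.ofFn fun j => ((s j : ℕ) : ℤ) ]

/-- The state `st` holds the client weight distribution `σ`, as fractions: `σ i j` is the quotient of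
cell `i * k + j` of array `5` by the (positive) cell `i * k + j` of array `6`. -/
def Outputs (st : RAM.Store) (σ : Fin n → Fin k → ℝ) : Prop :=
  ∀ (i : Fin n) (j : Fin k),
    0 < st.arr 6 ((i : ℤ) * k + j) ∧
      σ i j = (st.arr 5 ((i : ℤ) * k + j) : ℝ) / (st.arr 6 ((i : ℤ) * k + j) : ℝ)

end TwoFLG

/-! Existence and uniqueness. Let `pot σ` be half the sum of all squared loads and all squared
entries of `σ`. When one client deviates, her cost changes by exactly the change of `pot`
(`clientCost_update`), and `marg` is the gradient of `pot`. The feasible families form a product of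
compact convex sets, so the equilibria are the solutions of the variational inequality `Sol`
(`isClientEquilibrium_iff`), that is, the minimizers of `pot`. Compactness gives one (`exists_sol`);
since `pot` is a positive definite quadratic form, there is only one (`Sol.unique`).

Exact solution from an approximate one. After multiplication by a common denominator the weights are
integers. On the support of the solution `y` the marginal costs of a client agree; with the row sums
and the zero entries this is a nonsingular integral linear system with small coefficients. By
Cramer's rule the denominators in `y` are at most `D = (n k)! 2 ^ (n k)` (`Sol.exists_denominator`),
which has polynomially many bits. So it suffices to approximate `y` to within a small multiple of `1
/ D ^ 2` and to recover each entry with the Euclidean algorithm (`cross_mul_eq_of_small_remainder`).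

Approximation by scaling. An integral distribution for the weights `w i * Q` has slack `c` if no
used facility exceeds another one in range by more than `c` in marginal cost. Strong convexity then
bounds its ℓ¹ distance to `Q • y` by `c n k` and its excess potential by `c ^ 2 n k`
(`Slack.dist_le`, `Slack.pot_le`). Each phase doubles the distribution (slack 2 becomes 4), adds the
next binary digit of every weight at a cheapest facility (at most 2 more per client), and restores
slack 2 by moving single units. Each move lowers the potential by at least 1, so the excess bound
`(2 n + 4) ^ 2 n k` limits the number of sweeps (`wp_search`), and logarithmically many phases reach
the required scale.

Running time. `WP` records termination, cost and a common bound on the memory cells. The step count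
and the bit length of that bound are polynomial in the input size. -/

namespace RAM

/-! ### Values and costs of expressions over bounded memory -/

instance : Add Expr := ⟨Expr.add⟩
instance : Sub Expr := ⟨Expr.sub⟩
instance : Mul Expr := ⟨Expr.mul⟩
instance : Div Expr := ⟨Expr.div⟩
instance (m : ℕ) : OfNat Expr m := ⟨Expr.const m⟩

/-- A syntactic measure of an expression that controls its value and its cost. -/
def Expr.weight : Expr → ℕ
  | .const z => z.natAbs + 1
  | .var _ => 1
  | .get _ idx => idx.weight + 1
  | .add e f => e.weight + f.weight + 1
  | .sub e f => e.weight + f.weight + 1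
  | .mul e f => e.weight + f.weight + 1
  | .div e f => e.weight + f.weight + 1

section eval

variable (st : Store) (e f : Expr)

@[simp] lemma Expr.eval_var (x : ℕ) : (Expr.var x).eval st = st.var x := rfl
@[simp] lemma Expr.eval_get (a : ℕ) : (Expr.get a e).eval st = st.arr a (e.eval st) := rfl
@[simp] lemma Expr.eval_add : (e + f).eval st = e.eval st + f.eval st := rfl
@[simp] lemma Expr.eval_sub : (e - f).eval st = e.eval st - f.eval st := rfl
@[simp] lemma Expr.eval_mul : (e * f).eval st = e.eval st * f.eval st := rfl
@[simp] lemma Expr.eval_div : (e / f).eval st = e.eval st / f.eval st := rfl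
@[simp] lemma Expr.eval_zero : (0 : Expr).eval st = 0 := rfl
@[simp] lemma Expr.eval_one : (1 : Expr).eval st = 1 := rfl
@[simp] lemma Expr.eval_ofNat (m : ℕ) [m.AtLeastTwo] :
    (ofNat(m) : Expr).eval st = (OfNat.ofNat m : ℤ) := rfl

end eval

/-- All cells of the memory hold numbers of absolute value at most `M`. -/
structure Store.Bdd (st : Store) (M : ℕ) : Prop where
  two_le : 2 ≤ M
  var_le : ∀ x, |st.var x| ≤ M
  arr_le : ∀ a p, |st.arr a p| ≤ M

lemma Expr.one_le_weight (e : Expr) : 1 ≤ e.weight := by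
  cases e <;> simp [Expr.weight]

/-- Each operation at most adds the exponents, up to one extra factor `M ≥ 2` that absorbs the
factor 2 of a sum. Hence only the stored values have to be bounded in the analysis of a program, not
the intermediate ones. -/
lemma Expr.abs_eval_le {st : Store} {M : ℕ} (h : st.Bdd M) (e : Expr) :
    |e.eval st| ≤ (M : ℤ) ^ e.weight := by
  have hM : (2 : ℤ) ≤ M := by exact_mod_cast h.two_le
  have hM1 : (1 : ℤ) ≤ M := by linarith
  have one_le (a : ℕ) : (1 : ℤ) ≤ (M : ℤ) ^ a := one_le_pow₀ hM1
  have sum_le (a b : ℕ) : (M : ℤ) ^ a + (M : ℤ) ^ b ≤ (M : ℤ) ^ (a + b + 1) := by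
    have : (M : ℤ) ^ a + (M : ℤ) ^ b ≤ 2 * ((M : ℤ) ^ a * (M : ℤ) ^ b) := by
      nlinarith [one_le a, one_le b]
    calc _ ≤ 2 * ((M : ℤ) ^ a * (M : ℤ) ^ b) := this
      _ ≤ M * ((M : ℤ) ^ a * (M : ℤ) ^ b) := by gcongr
      _ = _ := by ring
  induction e with
  | const z =>
    have h1 : (z.natAbs : ℤ) < 2 ^ z.natAbs := by exact_mod_cast Nat.lt_two_pow_self
    calc |z| = (z.natAbs : ℤ) := Int.abs_eq_natAbs z
      _ ≤ 2 ^ z.natAbs := h1.le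
      _ ≤ (M : ℤ) ^ z.natAbs := by gcongr
      _ ≤ (M : ℤ) ^ (z.natAbs + 1) := pow_le_pow_right₀ hM1 (Nat.le_succ _)
  | var x => simpa [Expr.weight] using h.var_le x
  | get a idx ih =>
    exact (h.arr_le a _).trans (le_self_pow₀ hM1 (by simp [Expr.weight]))
  | add e f ihe ihf =>
    exact (abs_add_le _ _).trans ((add_le_add ihe ihf).trans (sum_le _ _))
  | sub e f ihe ihf =>
    exact (abs_sub _ _).trans ((add_le_add ihe ihf).trans (sum_le _ _))
  | mul e f ihe ihf =>
    calc |e.eval st * f.eval st| = |e.eval st| * |f.eval st| := abs_mul _ _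
      _ ≤ (M : ℤ) ^ e.weight * (M : ℤ) ^ f.weight := by gcongr
      _ = (M : ℤ) ^ (e.weight + f.weight) := by ring
      _ ≤ _ := pow_le_pow_right₀ hM1 (Nat.le_succ _)
  | div e f ihe ihf =>
    have h1 : |e.eval st / f.eval st| ≤ |e.eval st| := by
      rw [Int.abs_eq_natAbs, Int.abs_eq_natAbs]
      exact_mod_cast Int.natAbs_ediv_le_natAbs _ _
    refine h1.trans (ihe.trans (pow_le_pow_right₀ hM1 ?_))
    simp only [Expr.weight]; omega

lemma Expr.bitCost_eval_le {st : Store} {M : ℕ} (h : st.Bdd M) (e : Expr) :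
    bitCost (e.eval st) ≤ e.weight * (M.size + 2) := by
  have h1 : (e.eval st).natAbs ≤ M ^ e.weight := by
    have := e.abs_eval_le h
    rw [Int.abs_eq_natAbs] at this
    exact_mod_cast this
  have hw := e.one_le_weight
  have h2 : (e.eval st).natAbs < 2 ^ (M.size * e.weight) := by
    refine h1.trans_lt ?_
    rw [pow_mul]
    exact Nat.pow_lt_pow_left (Nat.lt_size_self M) (by omega)
  have h3 := Nat.size_le.2 h2
  unfold bitCost
  nlinarith

/-- Every node is charged at most `weight` units of `M.size + 2`, and there are at most `weight`
nodes; hence the square. -/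
lemma Expr.cost_le {st : Store} {M : ℕ} (h : st.Bdd M) (e : Expr) :
    e.cost st ≤ e.weight ^ 2 * (M.size + 2) := by
  have key (a b c e f g u : ℕ) (h1 : a ≤ e ^ 2 * u) (h2 : b ≤ f ^ 2 * u) (h3 : c ≤ g * u)
      (hg : g = e + f + 1) : a + b + c ≤ g ^ 2 * u := by
    subst hg; nlinarith [Nat.zero_le (e * f * u), Nat.zero_le (e * u), Nat.zero_le (f * u)]
  induction e with
  | const z =>
    have := (Expr.const z).bitCost_eval_le h
    have h1 := (Expr.const z).one_le_weight
    exact this.trans (Nat.mul_le_mul_right _ (Nat.le_self_pow (by simp) _))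
  | var x =>
    have := (Expr.var x).bitCost_eval_le h
    have h1 := (Expr.var x).one_le_weight
    exact this.trans (Nat.mul_le_mul_right _ (Nat.le_self_pow (by simp) _))
  | get a idx ih =>
    have := (Expr.get a idx).bitCost_eval_le h
    have := key _ 0 _ idx.weight 0 _ _ ih (Nat.zero_le _) this rfl
    simpa [Expr.cost] using this
  | add e f ihe ihf => exact key _ _ _ _ _ _ _ ihe ihf ((Expr.add e f).bitCost_eval_le h) rfl
  | sub e f ihe ihf => exact key _ _ _ _ _ _ _ ihe ihf ((Expr.sub e f).bitCost_eval_le h) rfl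
  | mul e f ihe ihf => exact key _ _ _ _ _ _ _ ihe ihf ((Expr.mul e f).bitCost_eval_le h) rfl
  | div e f ihe ihf => exact key _ _ _ _ _ _ _ ihe ihf ((Expr.div e f).bitCost_eval_le h) rfl

/-- Overwrite the variable `x`. -/
def Store.setVar (st : Store) (x : ℕ) (v : ℤ) : Store :=
  { st with var := Function.update st.var x v }

/-- Overwrite cell `p` of the array `a`. -/
def Store.setArr (st : Store) (a : ℕ) (p v : ℤ) : Store :=
  { st with arr := Function.update st.arr a (Function.update (st.arr a) p v) }

@[simp] lemma Store.setVar_var (st : Store) (x y : ℕ) (v : ℤ) :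
    (st.setVar x v).var y = if y = x then v else st.var y := by
  simp [Store.setVar, Function.update_apply]

@[simp] lemma Store.setVar_arr (st : Store) (x : ℕ) (v : ℤ) : (st.setVar x v).arr = st.arr := rfl

@[simp] lemma Store.setArr_var (st : Store) (a : ℕ) (p v : ℤ) :
    (st.setArr a p v).var = st.var := rfl

@[simp] lemma Store.setArr_arr (st : Store) (a b : ℕ) (p q v : ℤ) :
    (st.setArr a p v).arr b q = if b = a ∧ q = p then v else st.arr b q := by
  by_cases h : b = a
  · subst h; simp [Store.setArr, Function.update_apply]
  · simp [Store.setArr, h]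

/-- The program `P`, started in a state bounded by `M`, halts in a state that is bounded by `M` and
satisfies `post`, at a cost of at most `c` units of `M.size + 2`. -/
def WP (M : ℕ) (P : Prog) (c : ℕ) (post : Store → Prop) (st : Store) : Prop :=
  st.Bdd M → ∃ st' t, Exec P st st' t ∧ t ≤ c * (M.size + 2) ∧ st'.Bdd M ∧ post st'

/-! ### Rules for total correctness with cost -/

section WP

variable {M : ℕ} {P Q : Prog} {c c₁ c₂ : ℕ} {post post' : Store → Prop} {st : Store} {e : Expr}

lemma WP.mono (h : WP M P c post st) (hc : c ≤ c₁) (hp : ∀ st, post st → post' st) :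
    WP M P c₁ post' st := by
  intro hb
  obtain ⟨st', t, h1, h2, h3, h4⟩ := h hb
  exact ⟨st', t, h1, h2.trans (Nat.mul_le_mul_right _ hc), h3, hp _ h4⟩

lemma WP.imp (h : WP M P c post st) (hp : ∀ st, post st → post' st) : WP M P c post' st :=
  h.mono le_rfl hp

lemma WP.mono_cost (h : WP M P c post st) (hc : c ≤ c₁) : WP M P c₁ post st :=
  h.mono hc fun _ h => h

lemma WP.skip (h : post st) : WP M .skip 1 post st := fun hb =>
  ⟨st, 1, .skip st, by omega, hb, h⟩

lemma WP.assign {x : ℕ} (v : ℤ) (he : e.eval st = v) (hv : |v| ≤ M) (h : post (st.setVar x v)) :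
    WP M (.assign x e) (e.weight ^ 2 + 1) post st := by
  subst he
  intro hb
  refine ⟨_, _, .assign x e st, ?_, ⟨hb.two_le, fun y => ?_, hb.arr_le⟩, h⟩
  · have := e.cost_le hb
    nlinarith
  · change |(st.setVar x (e.eval st)).var y| ≤ M
    rw [Store.setVar_var]
    split_ifs
    exacts [hv, hb.var_le y]

lemma WP.store {a : ℕ} {idx : Expr} (p v : ℤ) (hi : idx.eval st = p) (he : e.eval st = v)
    (hv : |v| ≤ M) (h : post (st.setArr a p v)) :
    WP M (.store a idx e) (idx.weight ^ 2 + e.weight ^ 2 + 1) post st := by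
  subst hi he
  intro hb
  refine ⟨_, _, .store a idx e st, ?_, ⟨hb.two_le, hb.var_le, fun b p => ?_⟩, h⟩
  · have := e.cost_le hb
    have := idx.cost_le hb
    nlinarith
  · change |(st.setArr a (idx.eval st) (e.eval st)).arr b p| ≤ M
    rw [Store.setArr_arr]
    split_ifs
    exacts [hv, hb.arr_le b p]

lemma WP.seq (h : WP M P c₁ (WP M Q c₂ post) st) : WP M (.seq P Q) (c₁ + c₂) post st := by
  intro hb
  obtain ⟨st₁, t₁, h1, h2, h3, h4⟩ := h hb
  obtain ⟨st₂, t₂, k1, k2, k3, k4⟩ := h4 h3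
  exact ⟨st₂, _, .seq h1 k1, by rw [add_mul]; exact add_le_add h2 k2, k3, k4⟩

lemma WP.cond (h1 : 0 < e.eval st → WP M P c₁ post st) (h2 : ¬ 0 < e.eval st → WP M Q c₂ post st) :
    WP M (.cond e P Q) (e.weight ^ 2 + 1 + c₁ + c₂) post st := by
  intro hb
  have hc := e.cost_le hb
  by_cases he : 0 < e.eval st
  · obtain ⟨st', t, k1, k2, k3, k4⟩ := h1 he hb
    exact ⟨st', _, .condTrue he k1, by nlinarith [Nat.zero_le (c₂ * (M.size + 2))], k3, k4⟩
  · obtain ⟨st', t, k1, k2, k3, k4⟩ := h2 he hb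
    exact ⟨st', _, .condFalse he k1, by nlinarith [Nat.zero_le (c₁ * (M.size + 2))], k3, k4⟩

/-- Total correctness of loops: `Inv m` holds when at most `m` further rounds are made. -/
lemma WP.loop_aux {Inv : ℕ → Store → Prop} (m : ℕ) (h0 : Inv m st)
    (hs : ∀ m st, Inv m st → 0 < e.eval st →
      ∃ m', m' < m ∧ WP M P c (Inv m') st)
    (hp : ∀ m st, Inv m st → ¬ 0 < e.eval st → post st) :
    WP M (.loop e P) (m * (e.weight ^ 2 + 1 + c) + (e.weight ^ 2 + 1)) post st := by
  induction m using Nat.strong_induction_on generalizing st with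
  | _ m ih =>
    intro hb
    have hc := e.cost_le hb
    by_cases he : 0 < e.eval st
    · obtain ⟨m', hm, hw⟩ := hs m st h0 he
      obtain ⟨st₁, t₁, k1, k2, k3, k4⟩ := hw hb
      obtain ⟨st₂, t₂, l1, l2, l3, l4⟩ := ih m' hm k4 k3
      refine ⟨st₂, _, .loopStep he k1 l1, ?_, l3, l4⟩
      have h1 : (m' + 1) * (e.weight ^ 2 + 1 + c) ≤ m * (e.weight ^ 2 + 1 + c) :=
        Nat.mul_le_mul_right _ hm
      calc _ ≤ e.weight ^ 2 * (M.size + 2) + 1 + c * (M.size + 2) +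
            (m' * (e.weight ^ 2 + 1 + c) + (e.weight ^ 2 + 1)) * (M.size + 2) := by gcongr
        _ ≤ ((m' + 1) * (e.weight ^ 2 + 1 + c) + (e.weight ^ 2 + 1)) * (M.size + 2) := by
          nlinarith
        _ ≤ _ := by gcongr
    · refine ⟨st, _, .loopStop he, ?_, hb, hp m st h0 he⟩
      have := Nat.zero_le (m * (e.weight ^ 2 + 1 + c) * (M.size + 2))
      nlinarith

lemma WP.loop (Inv : ℕ → Store → Prop) (m C : ℕ) (hC : e.weight ^ 2 + 1 + c ≤ C) (h0 : Inv m st)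
    (hs : ∀ m st, Inv m st → 0 < e.eval st →
      ∃ m', m' < m ∧ WP M P c (Inv m') st)
    (hp : ∀ m st, Inv m st → ¬ 0 < e.eval st → post st) :
    WP M (.loop e P) ((m + 1) * C) post st :=
  (WP.loop_aux m h0 hs hp).mono_cost (by nlinarith)

end WP

/-- `for x = 0, …, e - 1 do P`. -/
def Prog.forLoop (x : ℕ) (e : Expr) (P : Prog) : Prog :=
  .seq (.assign x 0) (.loop (e - .var x) (.seq P (.assign x (.var x + 1))))

/-- The bound `e` is evaluated anew at each test, so the invariant has to fix its value. The
invariant for the next round is required after the counter has been advanced, since it may read the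
counter's cell. -/
lemma WP.forLoop {M : ℕ} {P : Prog} {c : ℕ} {post : Store → Prop} {st : Store} {e : Expr} {x : ℕ}
    (Inv : ℕ → Store → Prop) (m C : ℕ) (hC : (e.weight + 2) ^ 2 + c + 18 ≤ C) (hm : m ≤ M)
    (h0 : Inv 0 (st.setVar x 0))
    (he : ∀ i st, Inv i st → e.eval st = m)
    (hs : ∀ i st, i < m → Inv i st → st.var x = i →
      WP M P c (fun st' => st'.var x = i ∧ Inv (i + 1) (st'.setVar x (i + 1 : ℕ))) st)
    (hp : ∀ st, Inv m st → post st) :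
    WP M (.forLoop x e P) ((m + 1) * C) post st := by
  -- The summand 17 is the cost of advancing the counter: `.var x + 1` has weight 4.
  refine WP.mono_cost
    (c := 5 + (m * ((e.weight + 2) ^ 2 + 1 + (c + 17)) + ((e.weight + 2) ^ 2 + 1)))
    ?_ (by nlinarith)
  refine WP.seq (WP.mono_cost (WP.assign 0 rfl (by simp) ?_) (by decide))
  have hwt : (e - Expr.var x).weight = e.weight + 2 := rfl
  rw [← hwt]
  refine WP.loop_aux (Inv := fun r st => ∃ i, i + r = m ∧ st.var x = i ∧ Inv i st) m
    ⟨0, by simp, by simp, by simpa using h0⟩ ?_ ?_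
  · rintro r st ⟨i, hi, hx, hI⟩ hpos
    rw [Expr.eval_sub, he i st hI, Expr.eval_var, hx] at hpos
    have him : i < m := by exact_mod_cast sub_pos.1 hpos
    refine ⟨r - 1, by omega, WP.seq ((hs i st him hI hx).imp ?_)⟩
    rintro st' ⟨hx', hI'⟩
    refine WP.mono_cost (WP.assign (i + 1 : ℕ) (by simp [hx']) ?_ ⟨i + 1, by omega, ?_, hI'⟩)
      (le_refl 17)
    · rw [Nat.abs_cast]; exact_mod_cast him.trans_le hm
    · simp
  · rintro r st ⟨i, hi, hx, hI⟩ hpos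
    rw [Expr.eval_sub, he i st hI, Expr.eval_var, hx] at hpos
    have : i = m := by omega
    exact hp st (this ▸ hI)

end RAM

/-! ### The potential, its variational inequality and its unique minimizer -/

namespace TwoFLG

variable {n k : ℕ}

/-- The marginal cost of client `i` at facility `j`. -/
def marg (σ : Fin n → Fin k → ℝ) (i : Fin n) (j : Fin k) : ℝ := σ i j + load σ j

/-- An exact potential of the game. -/
noncomputable def pot (σ : Fin n → Fin k → ℝ) : ℝ :=
  (∑ j, load σ j ^ 2 + ∑ i, ∑ j, σ i j ^ 2) / 2

lemma load_sub (σ τ : Fin n → Fin k → ℝ) (j : Fin k) : load (τ - σ) j = load τ j - load σ j := by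
  simp [load]

lemma load_add (σ τ : Fin n → Fin k → ℝ) (j : Fin k) : load (τ + σ) j = load τ j + load σ j := by
  simp [load, Finset.sum_add_distrib]

lemma load_smul (c : ℝ) (σ : Fin n → Fin k → ℝ) (j : Fin k) : load (c • σ) j = c * load σ j := by
  simp [load, Finset.mul_sum]

lemma marg_smul (c : ℝ) (σ : Fin n → Fin k → ℝ) (i : Fin n) (j : Fin k) :
    marg (c • σ) i j = c * marg σ i j := by
  simp [marg, load_smul, mul_add]

lemma sum_load_mul (a : Fin k → ℝ) (σ : Fin n → Fin k → ℝ) :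
    ∑ i, ∑ j, a j * σ i j = ∑ j, a j * load σ j := by
  rw [Finset.sum_comm]
  simp [load, Finset.mul_sum]

/-- The Taylor expansion of a quadratic form at `σ`, which is exact: `marg σ` is the gradient and
the second-order term is `pot` itself. All convexity arguments rest on this identity. -/
lemma pot_expand (σ τ : Fin n → Fin k → ℝ) :
    pot τ = pot σ + ∑ i, ∑ j, marg σ i j * (τ i j - σ i j) + pot (τ - σ) := by
  have h := sum_load_mul (load σ) (τ - σ)
  simp only [pot, marg, add_mul, Finset.sum_add_distrib, load_sub, Pi.sub_apply] at h ⊢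
  rw [h]
  have h1 : ∑ j, load τ j ^ 2 = ∑ j, load σ j ^ 2 + 2 * ∑ j, load σ j * (load τ j - load σ j) +
      ∑ j, (load τ j - load σ j) ^ 2 := by
    rw [Finset.mul_sum, ← Finset.sum_add_distrib, ← Finset.sum_add_distrib]
    exact Finset.sum_congr rfl fun j _ => by ring
  have h2 : ∑ i, ∑ j, τ i j ^ 2 = ∑ i, ∑ j, σ i j ^ 2 +
      2 * ∑ i, ∑ j, σ i j * (τ i j - σ i j) + ∑ i, ∑ j, (τ i j - σ i j) ^ 2 := by
    rw [Finset.mul_sum, ← Finset.sum_add_distrib, ← Finset.sum_add_distrib]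
    refine Finset.sum_congr rfl fun i _ => ?_
    rw [Finset.mul_sum, ← Finset.sum_add_distrib, ← Finset.sum_add_distrib]
    exact Finset.sum_congr rfl fun j _ => by ring
  rw [h1, h2]; ring

lemma sum_sq_le_pot (σ : Fin n → Fin k → ℝ) : ∑ i, ∑ j, σ i j ^ 2 ≤ 2 * pot σ := by
  have : 0 ≤ ∑ j, load σ j ^ 2 := Finset.sum_nonneg fun _ _ => sq_nonneg _
  unfold pot; linarith

lemma pot_nonneg (σ : Fin n → Fin k → ℝ) : 0 ≤ pot σ := by
  have : 0 ≤ ∑ i, ∑ j, σ i j ^ 2 :=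
    Finset.sum_nonneg fun _ _ => Finset.sum_nonneg fun _ _ => sq_nonneg _
  linarith [sum_sq_le_pot σ]

lemma pot_neg (σ : Fin n → Fin k → ℝ) : pot (-σ) = pot σ := by
  have : ∀ j, load (-σ) j = - load σ j := fun j => by simp [load]
  simp [pot, this]

lemma pot_smul (c : ℝ) (σ : Fin n → Fin k → ℝ) : pot (c • σ) = c ^ 2 * pot σ := by
  simp only [pot, load_smul, Pi.smul_apply, smul_eq_mul, mul_pow, ← Finset.mul_sum]
  ring

lemma eq_zero_of_pot_nonpos {σ : Fin n → Fin k → ℝ} (h : pot σ ≤ 0) (i : Fin n) (j : Fin k) :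
    σ i j = 0 := by
  have h1 : ∑ i, ∑ j, σ i j ^ 2 ≤ 0 := by linarith [sum_sq_le_pot σ]
  have h2 : σ i j ^ 2 ≤ ∑ j, σ i j ^ 2 :=
    Finset.single_le_sum (f := fun j => σ i j ^ 2) (fun _ _ => sq_nonneg _) (Finset.mem_univ j)
  have h3 : ∑ j, σ i j ^ 2 ≤ ∑ i, ∑ j, σ i j ^ 2 :=
    Finset.single_le_sum (f := fun i => ∑ j, σ i j ^ 2)
      (fun _ _ => Finset.sum_nonneg fun _ _ => sq_nonneg _) (Finset.mem_univ i)
  nlinarith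

/-- Euler's identity for a form of degree 2, from the expansion at `σ` evaluated at 0. -/
lemma sum_marg_mul_self (σ : Fin n → Fin k → ℝ) : ∑ i, ∑ j, marg σ i j * σ i j = 2 * pot σ := by
  have h := pot_expand σ 0
  have h0 : pot (0 : Fin n → Fin k → ℝ) = 0 := by simp [pot, load]
  rw [zero_sub, pot_neg, h0] at h
  simp only [Pi.zero_apply, zero_sub, mul_neg, Finset.sum_neg_distrib] at h
  linarith

/-- Feasible families of weight distributions, for the ranges `R` and the weights `W`. -/
structure Feas (R : Fin n → Fin k → Prop) (W : Fin n → ℝ) (σ : Fin n → Fin k → ℝ) : Prop where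
  nonneg : ∀ i j, 0 ≤ σ i j
  eq_zero : ∀ i j, ¬ R i j → σ i j = 0
  sum_eq : ∀ i j, R i j → ∑ j, σ i j = W i

/-- Solutions of the variational inequality of the potential. -/
structure Sol (R : Fin n → Fin k → Prop) (W : Fin n → ℝ) (σ : Fin n → Fin k → ℝ) : Prop
    extends Feas R W σ where
  vi : ∀ τ, Feas R W τ → 0 ≤ ∑ i, ∑ j, marg σ i j * (τ i j - σ i j)

variable {R : Fin n → Fin k → Prop} {W : Fin n → ℝ} {σ τ : Fin n → Fin k → ℝ}

lemma Feas.le (h : Feas R W σ) {i : Fin n} {j : Fin k} (hr : R i j) : σ i j ≤ W i := by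
  rw [← h.sum_eq i j hr]
  exact Finset.single_le_sum (f := σ i) (fun _ _ => h.nonneg i _) (Finset.mem_univ j)

lemma Feas.smul {c : ℝ} (hc : 0 ≤ c) (h : Feas R W σ) : Feas R (c • W) (c • σ) where
  nonneg i j := mul_nonneg hc (h.nonneg i j)
  eq_zero i j hr := by simp [h.eq_zero i j hr]
  sum_eq i j hr := by simp [← h.sum_eq i j hr, Finset.mul_sum]

lemma Feas.segment {ε : ℝ} (h0 : 0 ≤ ε) (h1 : ε ≤ 1) (h : Feas R W σ) (h' : Feas R W τ) :
    Feas R W (σ + ε • (τ - σ)) where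
  nonneg i j := by
    have := h.nonneg i j
    have := h'.nonneg i j
    simp only [Pi.add_apply, Pi.smul_apply, Pi.sub_apply, smul_eq_mul]
    nlinarith
  eq_zero i j hr := by simp [h.eq_zero i j hr, h'.eq_zero i j hr]
  sum_eq i j hr := by
    simp [Finset.sum_add_distrib, ← Finset.mul_sum, h.sum_eq i j hr, h'.sum_eq i j hr]

lemma Sol.smul {c : ℝ} (hc : 0 < c) (h : Sol R W σ) : Sol R (c • W) (c • σ) where
  toFeas := h.toFeas.smul hc.le
  vi τ hτ := by
    have h1 := h.vi (c⁻¹ • τ) (by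
      have := hτ.smul (c := c⁻¹) (by positivity)
      rwa [inv_smul_smul₀ hc.ne'] at this)
    have : ∑ i, ∑ j, marg (c • σ) i j * (τ i j - (c • σ) i j) =
        c ^ 2 * ∑ i, ∑ j, marg σ i j * ((c⁻¹ • τ) i j - σ i j) := by
      simp only [Finset.mul_sum]
      refine Finset.sum_congr rfl fun i _ => Finset.sum_congr rfl fun j _ => ?_
      simp only [marg_smul, Pi.smul_apply, smul_eq_mul]
      field_simp
    rw [this]; positivity

lemma Sol.pot_le (h : Sol R W σ) (hτ : Feas R W τ) : pot σ ≤ pot τ := by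
  have := pot_expand σ τ
  linarith [h.vi τ hτ, pot_nonneg (τ - σ)]

/-- Adding the two expansions and the two variational inequalities leaves `pot (σ - τ) ≤ 0`, and
`pot` is positive definite. -/
lemma Sol.unique (h : Sol R W σ) (h' : Sol R W τ) : σ = τ := by
  have h1 := h.vi τ h'.toFeas
  have h2 := h'.vi σ h.toFeas
  have h3 := pot_expand σ τ
  have h4 := pot_expand τ σ
  have h5 := pot_nonneg (τ - σ)
  have h6 : pot (σ - τ) ≤ 0 := by linarith
  funext i j
  exact sub_eq_zero.1 (eq_zero_of_pot_nonpos h6 i j)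

lemma nonneg_of_forall_quadratic {a b : ℝ}
    (h : ∀ ε : ℝ, 0 < ε → ε ≤ 1 → 0 ≤ ε * a + ε ^ 2 * b) : 0 ≤ a := by
  by_contra! ha
  have hb : 0 < |b| + 1 := by positivity
  -- For this `ε` the quadratic term is at most half the size of the linear one, so a negative `a`
  -- would make the sum negative.
  set ε := min 1 (-a / (2 * (|b| + 1))) with hε
  have h0 : 0 < ε := lt_min one_pos (by apply div_pos <;> linarith)
  have h1 := h ε h0 (min_le_left _ _)
  have h2 : ε * (2 * (|b| + 1)) ≤ -a := (le_div_iff₀ (by positivity)).1 (min_le_right _ _)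
  have h3 : 0 ≤ ε * (a + ε * b) := by linarith
  have h4 : 0 ≤ a + ε * b := nonneg_of_mul_nonneg_right h3 h0
  nlinarith [le_abs_self b]

/-- First-order optimality along one segment. Minimality is assumed only there, so that the lemma
serves both a global minimizer and a client who deviates alone. -/
lemma sum_marg_nonneg_of_min
    (h : ∀ ε : ℝ, 0 < ε → ε ≤ 1 → pot σ ≤ pot (σ + ε • (τ - σ))) :
    0 ≤ ∑ i, ∑ j, marg σ i j * (τ i j - σ i j) := by
  refine nonneg_of_forall_quadratic (b := pot (τ - σ)) fun ε h0 h1 => ?_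
  have h2 := pot_expand σ (σ + ε • (τ - σ))
  rw [add_sub_cancel_left, pot_smul] at h2
  have h3 : ∑ i, ∑ j, marg σ i j * ((σ + ε • (τ - σ)) i j - σ i j) =
      ε * ∑ i, ∑ j, marg σ i j * (τ i j - σ i j) := by
    simp only [Finset.mul_sum]
    refine Finset.sum_congr rfl fun i _ => Finset.sum_congr rfl fun j _ => ?_
    simp only [Pi.add_apply, Pi.smul_apply, Pi.sub_apply, smul_eq_mul]
    ring
  rw [h3] at h2
  linarith [h ε h0 h1]

lemma isCompact_feas (R : Fin n → Fin k → Prop) (W : Fin n → ℝ) :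
    IsCompact {σ : Fin n → Fin k → ℝ | Feas R W σ} := by
  have hK : IsCompact (Set.Icc (0 : Fin n → Fin k → ℝ) fun i _ => |W i|) := isCompact_Icc
  refine hK.of_isClosed_subset ?_ ?_
  · have : {σ : Fin n → Fin k → ℝ | Feas R W σ} =
        (⋂ i, ⋂ j, {σ | 0 ≤ σ i j}) ∩ (⋂ i, ⋂ j, ⋂ _ : ¬ R i j, {σ | σ i j = 0}) ∩
          (⋂ i, ⋂ j, ⋂ _ : R i j, {σ | ∑ j, σ i j = W i}) := by
      ext σ
      simp only [Set.mem_ofPred_eq, Set.mem_inter_iff, Set.mem_iInter]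
      exact ⟨fun h => ⟨⟨h.1, h.2⟩, h.3⟩, fun h => ⟨h.1.1, h.1.2, h.2⟩⟩
    rw [this]
    refine ((isClosed_iInter fun i => isClosed_iInter fun j => ?_).inter
      (isClosed_iInter fun i => isClosed_iInter fun j => isClosed_iInter fun _ => ?_)).inter
      (isClosed_iInter fun i => isClosed_iInter fun j => isClosed_iInter fun _ => ?_)
    · exact isClosed_le (by fun_prop) (by fun_prop)
    · exact isClosed_eq (by fun_prop) (by fun_prop)
    · exact isClosed_eq (by fun_prop) (by fun_prop)
  · intro σ h
    refine ⟨fun i j => h.nonneg i j, fun i j => ?_⟩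
    by_cases hr : R i j
    · exact (h.le hr).trans (le_abs_self _)
    · rw [h.eq_zero i j hr]; exact abs_nonneg _

lemma exists_feas (R : Fin n → Fin k → Prop) (hW : ∀ i, 0 ≤ W i) : ∃ σ, Feas R W σ := by
  classical
  refine ⟨fun i j => if h : ∃ j, R i j then (if j = h.choose then W i else 0) else 0, ?_, ?_, ?_⟩
  · intro i j
    split_ifs
    exacts [hW i, le_rfl, le_rfl]
  · intro i j hr
    split_ifs with h h'
    · exact absurd (h' ▸ h.choose_spec) hr
    · rfl
    · rfl
  · intro i j hr
    have h : ∃ j, R i j := ⟨j, hr⟩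
    simp [h]

lemma continuous_pot : Continuous (pot : (Fin n → Fin k → ℝ) → ℝ) := by
  unfold pot load; fun_prop

lemma exists_sol (R : Fin n → Fin k → Prop) (hW : ∀ i, 0 ≤ W i) : ∃ σ, Sol R W σ := by
  obtain ⟨σ, hσ, hmin⟩ := (isCompact_feas R W).exists_isMinOn (exists_feas R hW)
    continuous_pot.continuousOn
  exact ⟨σ, hσ, fun τ hτ => sum_marg_nonneg_of_min fun ε h0 h1 =>
    hmin (Feas.segment h0.le h1 hσ hτ)⟩

/-! ### Equilibria as solutions of the variational inequality -/

section equilibrium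

variable (H : HostGraph n) (s : Fin k → Fin n)

/-- Facility `j` is in the shopping range of client `i`. -/
def HostGraph.InRange (i : Fin n) (j : Fin k) : Prop := j ∈ H.facilitiesInRange s i

variable {H s}

lemma feas_iff : Feas (H.InRange s) (fun i => (H.w i : ℝ)) σ ↔ ∀ i, H.FeasibleFor s i (σ i) := by
  constructor
  · exact fun h i => ⟨h.nonneg i, h.eq_zero i, fun ⟨j, hj⟩ => h.sum_eq i j hj⟩
  · exact fun h => ⟨fun i => (h i).nonneg, fun i => (h i).eq_zero,
      fun i j hj => (h i).sum_eq ⟨j, hj⟩⟩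

lemma sum_marg_update (i : Fin n) (x : Fin k → ℝ) :
    ∑ a, ∑ j, marg σ a j * (Function.update σ i x a j - σ a j) =
      ∑ j, marg σ i j * (x j - σ i j) := by
  rw [Finset.sum_eq_single i]
  · simp
  · intro a _ ha; simp [ha]
  · simp

/-- The exact potential property. With `d = x - σ i`, both sides equal the sum of `marg σ i j * d j
+ d j ^ 2`: the deviation contributes `d j ^ 2` once through the load and once through the entry,
and `pot` halves the total. -/
lemma clientCost_update (i : Fin n) (x : Fin k → ℝ) :
    clientCost (Function.update σ i x) i - clientCost σ i =
      pot (Function.update σ i x) - pot σ := by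
  have hl (j : Fin k) : load (Function.update σ i x) j = load σ j + (x j - σ i j) := by
    have h := load_sub σ (Function.update σ i x) j
    have h2 : load (Function.update σ i x - σ) j = x j - σ i j := by
      unfold load
      rw [Finset.sum_eq_single i]
      · simp
      · intro a _ ha; simp [ha]
      · simp
    linarith
  have hp : pot (Function.update σ i x - σ) = ∑ j, (x j - σ i j) ^ 2 := by
    unfold pot
    rw [Finset.sum_eq_single i]
    · simp only [load_sub, hl, Pi.sub_apply, Function.update_self, add_sub_cancel_left]; ring
    · intro a _ ha; simp [ha]
    · simp
  rw [pot_expand σ (Function.update σ i x), sum_marg_update, hp]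
  unfold clientCost
  simp only [hl, Function.update_self, marg]
  rw [add_assoc, add_sub_cancel_left, ← Finset.sum_sub_distrib, ← Finset.sum_add_distrib]
  exact Finset.sum_congr rfl fun j _ => by ring

/-- Best response of each client gives the first-order inequality in her own coordinates; since the
feasible set is a product, these add up to the full variational inequality. Conversely a solution
minimizes `pot` over all feasible families, in particular over unilateral deviations. -/
lemma isClientEquilibrium_iff :
    H.IsClientEquilibrium s σ ↔ Sol (H.InRange s) (fun i => (H.w i : ℝ)) σ := by
  constructor
  · intro h
    refine ⟨feas_iff.2 h.feasible, fun τ hτ => Finset.sum_nonneg fun i _ => ?_⟩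
    rw [← sum_marg_update i (τ i)]
    refine sum_marg_nonneg_of_min fun ε h0 h1 => ?_
    have hx := feas_iff.1 (Feas.segment h0.le h1 (feas_iff.2 h.feasible) hτ) i
    have h2 := h.best_response i _ hx
    have h3 := clientCost_update (σ := σ) i ((σ + ε • (τ - σ)) i)
    have h4 : σ + ε • (Function.update σ i (τ i) - σ) =
        Function.update σ i ((σ + ε • (τ - σ)) i) := by
      funext a
      by_cases ha : a = i
      · subst ha; simp
      · simp [ha]
    rw [h4]; linarith
  · intro h
    refine ⟨feas_iff.1 h.toFeas, fun i x hx => ?_⟩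
    have h1 : Feas (H.InRange s) (fun i => (H.w i : ℝ)) (Function.update σ i x) := by
      refine feas_iff.2 fun a => ?_
      by_cases ha : a = i
      · subst ha; simpa using hx
      · simpa [ha] using feas_iff.1 h.toFeas a
    have h2 := h.pot_le h1
    have h3 := clientCost_update (σ := σ) i x
    linarith

end equilibrium

end TwoFLG

namespace TwoFLG

variable {n k : ℕ} {R : Fin n → Fin k → Prop} {W : Fin n → ℝ} {σ τ : Fin n → Fin k → ℝ}

/-! ### Optimality conditions and denominators -/

/-- The effect of moving one unit of client `i` from facility `j` to facility `j'`. -/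
def shift (i : Fin n) (j j' : Fin k) : Fin n → Fin k → ℝ :=
  fun a b => if a = i then (if b = j' then 1 else 0) - (if b = j then 1 else 0) else 0

lemma sum_mul_shift (f : Fin n → Fin k → ℝ) (i : Fin n) (j j' : Fin k) :
    ∑ a, ∑ b, f a b * shift i j j' a b = f i j' - f i j := by
  rw [Finset.sum_eq_single i]
  · simp [shift, mul_sub, Finset.sum_sub_distrib]
  · intro a _ ha; simp [shift, ha]
  · simp

lemma pot_shift (i : Fin n) {j j' : Fin k} (h : j ≠ j') : pot (shift i j j') = 2 := by
  have h1 := sum_marg_mul_self (shift i j j')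
  rw [sum_mul_shift] at h1
  have h2 : ∀ b, load (shift i j j') b = shift i j j' i b := by
    intro b
    unfold load
    rw [Finset.sum_eq_single i]
    · intro a _ ha; simp [shift, ha]
    · simp
  simp [marg, h2, shift, h, h.symm] at h1
  linarith

lemma Feas.add_shift {i : Fin n} {j j' : Fin k} {c : ℝ} (hc : 0 ≤ c) (h : Feas R W σ)
    (hj : c ≤ σ i j) (hr : R i j) (hr' : R i j') : Feas R W (σ + c • TwoFLG.shift i j j') where
  nonneg a b := by
    simp only [Pi.add_apply, Pi.smul_apply, smul_eq_mul, TwoFLG.shift]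
    have := h.nonneg a b
    split_ifs with h1 h2 h3 h3 <;> subst_vars <;> simp <;> linarith
  eq_zero a b hab := by
    simp only [Pi.add_apply, Pi.smul_apply, smul_eq_mul, TwoFLG.shift, h.eq_zero a b hab]
    split_ifs with h1 h2 h3 h3 <;> subst_vars <;> simp_all
  sum_eq a b hab := by
    simp only [Pi.add_apply, Pi.smul_apply, smul_eq_mul, TwoFLG.shift, Finset.sum_add_distrib,
      h.sum_eq a b hab, ← Finset.mul_sum]
    split_ifs <;> simp

/-- No client can save more than `c` in marginal cost by moving weight. -/
def Slack (R : Fin n → Fin k → Prop) (c : ℝ) (σ : Fin n → Fin k → ℝ) : Prop :=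
  ∀ i j j', R i j' → 0 < σ i j → marg σ i j ≤ marg σ i j' + c

/-- Test the variational inequality against the transfer of the whole amount `σ i j` to facility
`j'`. -/
lemma Sol.slack (h : Sol R W σ) : Slack R 0 σ := by
  intro i j j' hr hpos
  have hrj : R i j := by
    by_contra hn
    exact hpos.ne' (h.eq_zero i j hn)
  have h1 := h.vi _ (h.toFeas.add_shift hpos.le le_rfl hrj hr)
  simp only [Pi.add_apply, add_sub_cancel_left, Pi.smul_apply, smul_eq_mul] at h1
  have h2 := sum_mul_shift (fun a b => marg σ a b * σ i j) i j j'
  simp only [mul_assoc] at h2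
  rw [h2] at h1
  nlinarith

/-- An integral linear system that determines a solution from its support. -/
def kktMatrix (p : Fin n → Fin k → Prop) [∀ i j, Decidable (p i j)] (f : Fin n → Fin k) :
    Matrix (Fin n × Fin k) (Fin n × Fin k) ℤ :=
  fun x y =>
    if p x.1 x.2 then
      if x.2 = f x.1 then (if y.1 = x.1 then 1 else 0)
      else (if y.2 = x.2 then 1 else 0) + (if y.2 = x.2 ∧ y.1 = x.1 then 1 else 0)
        - ((if y.2 = f x.1 then 1 else 0) + (if y.2 = f x.1 ∧ y.1 = x.1 then 1 else 0))
    else (if y.2 = x.2 ∧ y.1 = x.1 then 1 else 0)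

variable (p : Fin n → Fin k → Prop) [∀ i j, Decidable (p i j)] (f : Fin n → Fin k)

lemma abs_kktMatrix_le (x y : Fin n × Fin k) : |kktMatrix p f x y| ≤ 2 := by
  unfold kktMatrix
  split_ifs with h1 h2 h3 h4 h5 h6 h7 h8 h9 <;> simp_all

lemma kktMatrix_mulVec (y : Fin n → Fin k → ℝ) (x : Fin n × Fin k) :
    ((kktMatrix p f).map (Int.cast : ℤ → ℝ)).mulVec (fun x => y x.1 x.2) x =
      if p x.1 x.2 then
        if x.2 = f x.1 then ∑ j, y x.1 j else marg y x.1 x.2 - marg y x.1 (f x.1)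
      else y x.1 x.2 := by
  have h1 (b : Fin k) : ∑ z : Fin n × Fin k, (if z.2 = b then 1 else 0) * y z.1 z.2 = load y b := by
    rw [Fintype.sum_prod_type]
    simp [load]
  have h2 (a : Fin n) (b : Fin k) :
      ∑ z : Fin n × Fin k, (if z.2 = b ∧ z.1 = a then 1 else 0) * y z.1 z.2 = y a b := by
    rw [Finset.sum_eq_single (a, b)]
    · simp
    · rintro ⟨c, d⟩ _ hz
      rw [if_neg, zero_mul]
      rintro ⟨rfl, rfl⟩
      exact hz rfl
    · simp
  have h3 (a : Fin n) :
      ∑ z : Fin n × Fin k, (if z.1 = a then 1 else 0) * y z.1 z.2 = ∑ j, y a j := by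
    rw [Fintype.sum_prod_type, Finset.sum_eq_single a]
    · simp
    · intro b _ hb; simp [hb]
    · simp
  simp only [Matrix.mulVec, dotProduct, Matrix.map_apply, kktMatrix]
  split_ifs with hp hf
  · simpa using h3 x.1
  · rw [marg, marg, ← h2 x.1 x.2, ← h2 x.1 (f x.1), ← h1 x.2, ← h1 (f x.1),
      ← Finset.sum_add_distrib, ← Finset.sum_add_distrib, ← Finset.sum_sub_distrib]
    refine Finset.sum_congr rfl fun z _ => ?_
    push_cast
    ring
  · simpa using h2 x.1 x.2

/-- A kernel vector `y` has zero row sums, vanishes off `p`, and has marginal costs that are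
constant along each row on `p`. So the sum of `marg y i j * y i j` is zero, which is `2 * pot y`,
and `y = 0` by definiteness. -/
lemma det_kktMatrix_ne_zero (hf : ∀ i j, p i j → p i (f i)) : (kktMatrix p f).det ≠ 0 := by
  intro h0
  have h1 : ((kktMatrix p f).map (Int.cast : ℤ → ℝ)).det = 0 := by
    have := (Int.castRingHom ℝ).map_det (kktMatrix p f)
    rw [h0, map_zero] at this
    exact this.symm
  obtain ⟨v, hv, hv0⟩ := Matrix.exists_mulVec_eq_zero_iff.2 h1
  set y : Fin n → Fin k → ℝ := fun i j => v (i, j) with hy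
  have hvy : v = fun x => y x.1 x.2 := rfl
  have key (i : Fin n) (j : Fin k) := congrFun hv0 (i, j)
  rw [hvy] at key
  simp only [kktMatrix_mulVec, Pi.zero_apply] at key
  have hsum (i : Fin n) : ∑ j, y i j = 0 := by
    by_cases h : ∃ j, p i j
    · obtain ⟨j, hj⟩ := h
      have := key i (f i)
      rwa [if_pos (hf i j hj), if_pos rfl] at this
    · push Not at h
      exact Finset.sum_eq_zero fun j _ => by simpa [h j] using key i j
  have hpt (i : Fin n) (j : Fin k) : marg y i j * y i j = marg y i (f i) * y i j := by
    have := key i j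
    split_ifs at this with hp hj
    · rw [hj]
    · rw [sub_eq_zero.1 this]
    · rw [this]; simp
  have hz : 2 * pot y = 0 := by
    rw [← sum_marg_mul_self]
    refine Finset.sum_eq_zero fun i _ => ?_
    simp only [hpt, ← Finset.mul_sum, hsum, mul_zero]
  refine hv (funext fun x => ?_)
  exact eq_zero_of_pot_nonpos (by linarith) x.1 x.2

/-- The solution for integral weights is rational, with a small common denominator. -/
lemma Sol.exists_denominator {w : Fin n → ℤ} (h : Sol R (fun i => (w i : ℝ)) σ) :
    ∃ v : ℕ, 0 < v ∧ v ≤ (n * k).factorial * 2 ^ (n * k) ∧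
      ∀ i j, ∃ u : ℤ, (v : ℝ) * σ i j = u := by
  classical
  rcases Nat.eq_zero_or_pos k with hk | hk
  · subst hk
    exact ⟨1, one_pos, by simp, fun i j => j.elim0⟩
  -- A reference facility in the support of each client. For a client who gives no weight the choice
  -- is immaterial, because all her equations read `σ i j = 0`.
  have : ∀ i, ∃ j', ∀ j, 0 < σ i j → 0 < σ i j' := by
    intro i
    by_cases h : ∃ j, 0 < σ i j
    · obtain ⟨j, hj⟩ := h; exact ⟨j, fun _ _ => hj⟩
    · push Not at h; exact ⟨⟨0, hk⟩, fun j hj => absurd hj (not_lt.2 (h j))⟩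
  choose f hf using this
  set A := kktMatrix (fun i j => 0 < σ i j) f with hA
  set b : Fin n × Fin k → ℤ := fun x => if 0 < σ x.1 x.2 ∧ x.2 = f x.1 then w x.1 else 0 with hb
  have hdet : A.det ≠ 0 := det_kktMatrix_ne_zero _ f hf
  have hr : ∀ i j, 0 < σ i j → R i j := fun i j hp => by
    by_contra hn
    exact hp.ne' (h.eq_zero i j hn)
  have hAb : (A.map (Int.cast : ℤ → ℝ)).mulVec (fun x => σ x.1 x.2) = fun x => (b x : ℝ) := by
    funext ⟨i, j⟩
    rw [hA, kktMatrix_mulVec]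
    simp only [hb]
    split_ifs with h1 h2 h3 h3 h3
    · exact h.sum_eq i j (hr i j h1)
    · exact absurd ⟨h1, h2⟩ h3
    · exact absurd h3.2 h2
    · have h4 := h.slack i j (f i) (hr _ _ (hf i j h1)) h1
      have h5 := h.slack i (f i) j (hr _ _ h1) (hf i j h1)
      push_cast; linarith
    · exact absurd h3.1 h1
    · push_cast
      exact le_antisymm (not_lt.1 h1) (h.nonneg i j)
  refine ⟨A.det.natAbs, Int.natAbs_pos.2 hdet, ?_, ?_⟩
  · have h1 := Matrix.det_le (A := A) (abv := AbsoluteValue.abs) (x := 2)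
      (fun x y => abs_kktMatrix_le _ f x y)
    simp only [Fintype.card_prod, Fintype.card_fin, nsmul_eq_mul, AbsoluteValue.abs_apply,
      Int.abs_eq_natAbs] at h1
    exact_mod_cast h1
  · intro i j
    -- Cramer's rule: multiply the system by the adjugate, which is integral. The determinant is
    -- thus a common denominator of all entries.
    have h1 : (A.det : ℝ) * σ i j = ((A.adjugate.mulVec b) (i, j) : ℤ) := by
      have h2 := congrArg (fun v => ((A.map (Int.cast : ℤ → ℝ)).adjugate.mulVec v) (i, j)) hAb
      simp only [Matrix.mulVec_mulVec, Matrix.adjugate_mul, Matrix.smul_mulVec,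
        Matrix.one_mulVec, Pi.smul_apply, smul_eq_mul] at h2
      have h3 : ((A.map (Int.cast : ℤ → ℝ)).det) = (A.det : ℝ) :=
        ((Int.castRingHom ℝ).map_det A).symm
      have h4 : (A.map (Int.cast : ℤ → ℝ)).adjugate = A.adjugate.map (Int.cast : ℤ → ℝ) :=
        ((Int.castRingHom ℝ).map_adjugate A).symm
      rw [h3, h4] at h2
      rw [h2]
      simp [Matrix.mulVec, dotProduct]
    rcases Int.natAbs_eq A.det with hd | hd
    · refine ⟨(A.adjugate.mulVec b) (i, j), ?_⟩
      rw [← h1]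
      nth_rw 2 [hd]
      simp
    · refine ⟨-(A.adjugate.mulVec b) (i, j), ?_⟩
      push_cast
      rw [← h1]
      nth_rw 2 [hd]
      simp

/-! ### Approximate solutions -/

/-- Within a row `σ` and `τ` have equal sums, so the minimal marginal cost in range can be
subtracted. The difference is then nonnegative in range, and at most `c` wherever `σ` is positive;
where `σ` vanishes the term is nonpositive. -/
lemma Slack.sum_le {c : ℝ} (hc : 0 ≤ c) (hs : Slack R c σ) (h : Feas R W σ) (hτ : Feas R W τ) :
    ∑ i, ∑ j, marg σ i j * (σ i j - τ i j) ≤ c * ∑ i, ∑ j, |σ i j - τ i j| := by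
  rw [Finset.mul_sum]
  refine Finset.sum_le_sum fun i _ => ?_
  by_cases hr : ∃ j, R i j
  · obtain ⟨m, hm, hmin⟩ := Set.exists_min_image {j | R i j} (marg σ i) (Set.toFinite _) hr
    obtain ⟨j, hj⟩ := hr
    have h1 : ∑ j, marg σ i j * (σ i j - τ i j) =
        ∑ j, (marg σ i j - marg σ i m) * (σ i j - τ i j) := by
      simp only [sub_mul (marg σ i _), Finset.sum_sub_distrib, ← Finset.mul_sum, mul_sub,
        h.sum_eq i j hj, hτ.sum_eq i j hj]
      ring
    rw [h1, Finset.mul_sum]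
    refine Finset.sum_le_sum fun j _ => ?_
    by_cases hrj : R i j
    · have h2 : marg σ i m ≤ marg σ i j := hmin j hrj
      rcases (h.nonneg i j).lt_or_eq with hpos | hz
      · have h3 := hs i j m hm hpos
        have h4 := le_abs_self (σ i j - τ i j)
        have h5 := abs_nonneg (σ i j - τ i j)
        nlinarith
      · have h3 := hτ.nonneg i j
        rw [← hz]
        have h5 := abs_nonneg (0 - τ i j)
        nlinarith
    · simp [h.eq_zero i j hrj, hτ.eq_zero i j hrj]
  · push Not at hr
    simp [h.eq_zero i _ (hr _), hτ.eq_zero i _ (hr _)]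

/-- Let `S` be the ℓ¹ distance. Strong convexity bounds the squared ℓ² distance by `c * S`, and
Cauchy–Schwarz bounds `S ^ 2` by `n k` times it; cancel `S`. -/
lemma Slack.dist_le {c : ℝ} (hc : 0 ≤ c) (hs : Slack R c σ) (h : Feas R W σ) (hτ : Sol R W τ) :
    ∑ i, ∑ j, |σ i j - τ i j| ≤ c * (n * k) := by
  set S := ∑ i, ∑ j, |σ i j - τ i j| with hS
  have hS0 : 0 ≤ S := Finset.sum_nonneg fun _ _ => Finset.sum_nonneg fun _ _ => abs_nonneg _
  have h1 := hs.sum_le hc h hτ.toFeas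
  have h2 := hτ.vi σ h
  have h3 := pot_expand σ τ
  have h4 := pot_expand τ σ
  have h5 := sum_sq_le_pot (σ - τ)
  have h6 : pot (τ - σ) = pot (σ - τ) := by rw [← pot_neg, neg_sub]
  have h7 : ∑ i, ∑ j, marg σ i j * (τ i j - σ i j) = -∑ i, ∑ j, marg σ i j * (σ i j - τ i j) := by
    simp only [← Finset.sum_neg_distrib]
    exact Finset.sum_congr rfl fun i _ => Finset.sum_congr rfl fun j _ => by ring
  have h8 : S ^ 2 ≤ (n * k) * ∑ i, ∑ j, (σ - τ) i j ^ 2 := by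
    have := sq_sum_le_card_mul_sum_sq (s := Finset.univ (α := Fin n × Fin k))
      (f := fun x => |σ x.1 x.2 - τ x.1 x.2|)
    rw [Fintype.sum_prod_type, Fintype.sum_prod_type] at this
    simpa using this
  have h9 : ∑ i, ∑ j, (σ - τ) i j ^ 2 ≤ c * S := by linarith
  have hnk : (0 : ℝ) ≤ n * k := by positivity
  by_contra! hlt
  have hSpos : 0 < S := lt_of_le_of_lt (by positivity) hlt
  nlinarith [mul_le_mul_of_nonneg_left h9 hnk]

/-- By convexity the excess potential is at most the first-order term at `σ`, which is at most `c`
times the distance. -/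
lemma Slack.pot_le {c : ℝ} (hc : 0 ≤ c) (hs : Slack R c σ) (h : Feas R W σ) (hτ : Sol R W τ) :
    pot σ ≤ pot τ + c ^ 2 * (n * k) := by
  have h1 := hs.sum_le hc h hτ.toFeas
  have h2 := hs.dist_le hc h hτ
  have h3 := pot_expand σ τ
  have h7 : ∑ i, ∑ j, marg σ i j * (τ i j - σ i j) = -∑ i, ∑ j, marg σ i j * (σ i j - τ i j) := by
    simp only [← Finset.sum_neg_distrib]
    exact Finset.sum_congr rfl fun i _ => Finset.sum_congr rfl fun j _ => by ring
  have h4 := pot_nonneg (τ - σ)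
  nlinarith [mul_le_mul_of_nonneg_left h2 hc]

lemma Slack.two_smul {c : ℝ} (hs : Slack R c σ) : Slack R (2 * c) ((2 : ℝ) • σ) := by
  intro i j j' hr hpos
  simp only [marg_smul]
  have := hs i j j' hr (by simpa using hpos)
  linarith

/-- One unit of client `i` at facility `j`. -/
def unit (i : Fin n) (j : Fin k) : Fin n → Fin k → ℝ :=
  fun a b => if a = i ∧ b = j then 1 else 0

lemma load_unit (i : Fin n) (j b : Fin k) : load (unit i j) b = if b = j then 1 else 0 := by
  simp [load, unit, ite_and]

/-- The new unit raises no marginal cost by more than 2 and lowers none. If it makes a facility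
newly used, that facility was cheapest in range before. -/
lemma Slack.add_unit {c : ℝ} (hc : 0 ≤ c) (hs : Slack R c σ) (h0 : ∀ i j, 0 ≤ σ i j) {i : Fin n}
    {m : Fin k} (hmin : ∀ j, R i j → marg σ i m ≤ marg σ i j) :
    Slack R (c + 2) (σ + unit i m) := by
  have hm (a : Fin n) (b : Fin k) : marg (σ + unit i m) a b =
      marg σ a b + (if a = i ∧ b = m then 1 else 0) + (if b = m then 1 else 0) := by
    unfold marg
    rw [load_add, load_unit]
    simp only [Pi.add_apply, unit]
    ring
  intro a j j' hr hpos
  have h1 : marg σ a j ≤ marg σ a j' + c := by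
    rcases (h0 a j).lt_or_eq with h | h
    · exact hs a j j' hr h
    · simp only [Pi.add_apply, ← h, unit, zero_add] at hpos
      split_ifs at hpos with h2
      · rw [h2.1, h2.2]
        have := hmin j' (h2.1 ▸ hr)
        linarith
      · simp at hpos
  rw [hm, hm]
  split_ifs <;> linarith

lemma Feas.add_unit (h : Feas R W σ) {i : Fin n} {m : Fin k} (hr : R i m) :
    Feas R (Function.update W i (W i + 1)) (σ + unit i m) where
  nonneg a b := by
    have := h.nonneg a b
    simp only [Pi.add_apply, unit]
    split_ifs <;> linarith
  eq_zero a b hab := by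
    simp only [Pi.add_apply, unit, h.eq_zero a b hab, zero_add, ite_eq_right_iff]
    rintro ⟨rfl, rfl⟩
    exact absurd hr hab
  sum_eq a b hab := by
    simp only [Pi.add_apply, Finset.sum_add_distrib, h.sum_eq a b hab]
    by_cases ha : a = i
    · subst ha; simp [unit]
    · simp [unit, ha]

lemma pot_add_shift (i : Fin n) {j j' : Fin k} (h : j ≠ j') :
    pot (σ + TwoFLG.shift i j j') = pot σ + (marg σ i j' - marg σ i j) + 2 := by
  rw [pot_expand σ]
  simp only [Pi.add_apply, add_sub_cancel_left, sum_mul_shift, pot_shift i h]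

end TwoFLG

namespace TwoFLG

variable {n k : ℕ} {R : Fin n → Fin k → Prop}

/-! ### Integral weight distributions -/

/-- An integral weight distribution as a real one. -/
def toReal (x : Fin n → Fin k → ℤ) : Fin n → Fin k → ℝ := fun i j => x i j

/-- The marginal costs of an integral weight distribution. -/
def intMarg (x : Fin n → Fin k → ℤ) (i : Fin n) (j : Fin k) : ℤ := x i j + ∑ a, x a j

lemma marg_toReal (x : Fin n → Fin k → ℤ) (i : Fin n) (j : Fin k) :
    marg (toReal x) i j = intMarg x i j := by
  simp [marg, load, toReal, intMarg]

lemma slack_toReal {x : Fin n → Fin k → ℤ} {c : ℤ} :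
    Slack R c (toReal x) ↔ ∀ i j j', R i j' → 0 < x i j → intMarg x i j ≤ intMarg x i j' + c := by
  unfold Slack
  have hpos : ∀ i j, 0 < toReal x i j ↔ 0 < x i j := fun _ _ => Int.cast_pos
  simp only [marg_toReal, hpos]
  refine forall₅_congr fun i j j' _ _ => ?_
  norm_cast

/-- `x` after the move of one unit of client `i` from facility `j` to facility `j'`. -/
def intShift (x : Fin n → Fin k → ℤ) (i : Fin n) (j j' : Fin k) : Fin n → Fin k → ℤ :=
  fun a b => x a b + if a = i then (if b = j' then 1 else 0) - (if b = j then 1 else 0) else 0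

lemma toReal_intShift (x : Fin n → Fin k → ℤ) (i : Fin n) (j j' : Fin k) :
    toReal (intShift x i j j') = toReal x + shift i j j' := by
  funext a b
  simp only [toReal, intShift, shift, Pi.add_apply]
  split_ifs <;> simp

lemma sum_intShift (x : Fin n → Fin k → ℤ) (i : Fin n) (j j' b : Fin k) :
    ∑ a, intShift x i j j' a b =
      ∑ a, x a b + ((if b = j' then 1 else 0) - (if b = j then 1 else 0)) := by
  simp [intShift, Finset.sum_add_distrib]

/-- `x` with an additional unit of client `i` at facility `j`. -/
def intAdd (x : Fin n → Fin k → ℤ) (i : Fin n) (j : Fin k) : Fin n → Fin k → ℤ :=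
  fun a b => x a b + if a = i ∧ b = j then 1 else 0

lemma toReal_intAdd (x : Fin n → Fin k → ℤ) (i : Fin n) (j : Fin k) :
    toReal (intAdd x i j) = toReal x + unit i j := by
  funext a b
  simp only [toReal, intAdd, unit, Pi.add_apply]
  split_ifs <;> simp

lemma sum_intAdd (x : Fin n → Fin k → ℤ) (i : Fin n) (j b : Fin k) :
    ∑ a, intAdd x i j a b = ∑ a, x a b + if b = j then 1 else 0 := by
  simp [intAdd, Finset.sum_add_distrib, ite_and]

section bounds

variable {W : Fin n → ℝ} {x : Fin n → Fin k → ℤ}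

lemma Feas.int_nonneg (h : Feas R W (toReal x)) (i : Fin n) (j : Fin k) : 0 ≤ x i j := by
  have : (0 : ℝ) ≤ x i j := h.nonneg i j
  exact_mod_cast this

lemma Feas.int_le (h : Feas R W (toReal x)) {B : ℕ} (hB : ∀ i, W i ≤ B) (i : Fin n) (j : Fin k) :
    x i j ≤ B := by
  by_cases hr : R i j
  · have : (x i j : ℝ) ≤ B := (h.le hr).trans (hB i)
    exact_mod_cast this
  · have : (x i j : ℝ) = 0 := h.eq_zero i j hr
    have h0 : x i j = 0 := by exact_mod_cast this
    rw [h0]; positivity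

lemma Feas.int_sum_nonneg (h : Feas R W (toReal x)) (j : Fin k) : 0 ≤ ∑ i, x i j :=
  Finset.sum_nonneg fun i _ => h.int_nonneg i j

lemma Feas.int_sum_le (h : Feas R W (toReal x)) {B : ℕ} (hB : ∀ i, W i ≤ B) (j : Fin k) :
    ∑ i, x i j ≤ n * B := by
  have := Finset.sum_le_card_nsmul Finset.univ (fun i => x i j) (B : ℤ)
    fun i _ => h.int_le hB i j
  simpa using this

end bounds

/-! ### Rational reconstruction -/

/-- The integer `u * v₁ - u₁ * v` is shown to have absolute value below 1. As `r₀ > θ`, the identity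
`hsum` forces `v₁ < 2 * D`. Multiplied by `Q`, the integer splits into the error of `u / v`, at most
`4 * N * D ^ 2 < Q / 2`, and the error of `u₁ / v₁`, at most `D * θ ≤ Q / 2`. -/
lemma cross_mul_eq_of_small_remainder {P Q N D θ r₀ r₁ u₁ v₀ v₁ u v : ℤ} (hN : 0 ≤ N)
    (hD : 0 < D) (hQ : 16 * (N + 1) * (D * D) ≤ Q) (hθ : θ = Q / (2 * D)) (hv₀ : 0 ≤ v₀)
    (hv₁ : 0 < v₁) (hr₀ : θ < r₀) (hr₁ : 0 ≤ r₁) (hr₁θ : r₁ ≤ θ) (hsum : r₀ * v₁ + r₁ * v₀ = Q)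
    (hdiff : |P * v₁ - Q * u₁| = r₁) (hv : 0 < v) (hvD : v ≤ D)
    (happ : |Q * u - P * v| ≤ 2 * N * v) : u * v₁ = u₁ * v := by
  have h1 : 2 * D * θ ≤ Q := by rw [hθ]; exact Int.mul_ediv_self_le (by positivity)
  have h2 : Q < 2 * D * (θ + 1) := by
    have := Int.lt_mul_ediv_self_add (x := Q) (k := 2 * D) (by positivity)
    rw [← hθ] at this; linarith
  have hθ0 : 0 ≤ θ := hr₁.trans hr₁θ
  have h3 : v₁ < 2 * D := by
    by_contra! hle
    have : 2 * D * (θ + 1) ≤ r₀ * v₁ := by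
      rw [mul_comm]; exact mul_le_mul hr₀ hle (by positivity) (by linarith)
    nlinarith [mul_nonneg hr₁ hv₀]
  have hQpos : 0 < Q := by nlinarith [mul_pos hD hD]
  have h4 : Q * (u * v₁ - u₁ * v) = v₁ * (Q * u - P * v) + v * (P * v₁ - Q * u₁) := by ring
  have h5 : Q * |u * v₁ - u₁ * v| ≤ v₁ * (2 * N * v) + v * r₁ := by
    calc Q * |u * v₁ - u₁ * v| = |Q * (u * v₁ - u₁ * v)| := by rw [abs_mul, abs_of_pos hQpos]
      _ = |v₁ * (Q * u - P * v) + v * (P * v₁ - Q * u₁)| := by rw [h4]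
      _ ≤ |v₁ * (Q * u - P * v)| + |v * (P * v₁ - Q * u₁)| := abs_add_le _ _
      _ = v₁ * |Q * u - P * v| + v * |P * v₁ - Q * u₁| := by
        rw [abs_mul, abs_mul, abs_of_pos hv, abs_of_pos hv₁]
      _ ≤ _ := by rw [hdiff]; gcongr
  have h6 : v₁ * (2 * N * v) ≤ 2 * D * (2 * N * D) := by gcongr
  have h7 : v * r₁ ≤ D * θ := by gcongr
  have h8 : Q * |u * v₁ - u₁ * v| < Q * 1 := by
    nlinarith [mul_pos hD hD, mul_nonneg hN (mul_pos hD hD).le]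
  have h9 : |u * v₁ - u₁ * v| < 1 := lt_of_mul_lt_mul_left h8 hQpos.le
  have := Int.abs_lt_one_iff.1 h9
  linarith

/-- A scaled integral approximation determines the solution by rational reconstruction. -/
lemma Sol.eq_div_of_small_remainder {w : Fin n → ℕ} {y : Fin n → Fin k → ℝ}
    (hy : Sol R (fun i => (w i : ℝ)) y) {x : Fin n → Fin k → ℤ} {Q : ℕ}
    (hx : Feas R (fun i => ((w i * Q : ℕ) : ℝ)) (toReal x)) (hs : Slack R 2 (toReal x)) {D : ℕ}
    (hD : D = (n * k).factorial * 2 ^ (n * k)) (hQ : 16 * (n * k + 1) * (D * D) ≤ Q)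
    {θ r₀ r₁ u₁ v₀ v₁ : ℤ} (i : Fin n) (j : Fin k) (hθ : θ = Q / (2 * D)) (hv₀ : 0 ≤ v₀)
    (hv₁ : 0 < v₁) (hr₀ : θ < r₀) (hr₁ : 0 ≤ r₁) (hr₁θ : r₁ ≤ θ) (hsum : r₀ * v₁ + r₁ * v₀ = Q)
    (hdiff : |x i j * v₁ - Q * u₁| = r₁) : y i j = u₁ / v₁ := by
  have hD0 : 0 < D := by rw [hD]; positivity
  have hQ0 : 0 < Q := lt_of_lt_of_le (by positivity) hQ
  obtain ⟨v, hv, hvD, hu⟩ := Sol.exists_denominator (w := fun i => (w i : ℤ)) (by simpa using hy)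
  obtain ⟨u, hu⟩ := hu i j
  rw [← hD] at hvD
  -- The problem is homogeneous, so `Q • y` solves the instance that `x` approximates, and slack 2
  -- places `x` within `2 * n * k` of it.
  have hQy : Sol R (fun i => ((w i * Q : ℕ) : ℝ)) ((Q : ℝ) • y) := by
    have := hy.smul (c := Q) (by exact_mod_cast hQ0)
    convert this using 2 with i
    simp [mul_comm]
  have hdist := hs.dist_le (by norm_num) hx hQy
  have h1 : |(x i j : ℝ) - Q * y i j| ≤ 2 * (n * k) := by
    refine le_trans ?_ hdist
    have ha := Finset.single_le_sum (f := fun j => |toReal x i j - ((Q : ℝ) • y) i j|)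
      (fun _ _ => abs_nonneg _) (Finset.mem_univ j)
    have hb := Finset.single_le_sum (f := fun i => ∑ j, |toReal x i j - ((Q : ℝ) • y) i j|)
      (fun _ _ => Finset.sum_nonneg fun _ _ => abs_nonneg _) (Finset.mem_univ i)
    exact ha.trans hb
  have hvpos : (0 : ℝ) < v := by exact_mod_cast hv
  have happ : |(Q : ℤ) * u - x i j * v| ≤ 2 * ((n * k : ℕ) : ℤ) * v := by
    have h2 : |(Q : ℝ) * u - x i j * v| ≤ 2 * (n * k) * v := by
      rw [← hu, abs_sub_comm]
      have : (x i j : ℝ) * v - Q * (v * y i j) = (x i j - Q * y i j) * v := by ring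
      rw [this, abs_mul, abs_of_pos hvpos]
      gcongr
    have h3 : ((|(Q : ℤ) * u - x i j * v| : ℤ) : ℝ) ≤ ((2 * ((n * k : ℕ) : ℤ) * v : ℤ) : ℝ) := by
      push_cast; exact h2
    exact_mod_cast h3
  have hcross := cross_mul_eq_of_small_remainder (N := ((n * k : ℕ) : ℤ)) (D := D)
    (by positivity) (by exact_mod_cast hD0) (by exact_mod_cast hQ) hθ hv₀ hv₁ hr₀ hr₁ hr₁θ
    hsum hdiff (by exact_mod_cast hv) (by exact_mod_cast hvD) happ
  have hv₁' : (0 : ℝ) < v₁ := by exact_mod_cast hv₁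
  rw [eq_div_iff hv₁'.ne']
  have h4 : (u : ℝ) * v₁ = u₁ * v := by exact_mod_cast hcross
  have : v * (y i j * v₁) = v * (u₁ : ℝ) := by rw [← mul_assoc, hu, h4]; ring
  exact mul_left_cancel₀ hvpos.ne' this

end TwoFLG

namespace TwoFLG

open RAM

/-! ### The main loop of the algorithm -/

section prog

open RAM.Expr RAM.Prog

/-- Sequential composition of programs. -/
infixr:60 " ⨾ " => RAM.Prog.seq

/-- A cell of the matrix in array `7`. -/
def cellE (r c : Expr) : Expr := get 7 (r * var 1 + c)

/-- The marginal cost of the client in variable `20`; row `n` of the matrix holds the loads. -/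
def margE (c : Expr) : Expr := cellE (var 20) c + cellE (var 0) c

/-- Whether the client in variable `20` has facility `c` in her range. -/
def rangeE (c : Expr) : Expr := get 1 (var 20 * var 0 + get 4 c)

/-- The integral weight of the client in variable `20`. -/
def weightE : Expr := get 2 (var 20) * var 2 / get 3 (var 20)

/-- Add `d` to a cell of the matrix in array `7`. -/
def bump (r c d : Expr) : Prog := store 7 (r * var 1 + c) (cellE r c + d)

/-- Double all weights and loads. -/
def doubleProg : Prog :=
  forLoop 20 ((var 0 + 1) * var 1) (store 7 (var 20) (2 * get 7 (var 20)))

/-- Set variable `23` to `m + 1`, where `m` is a facility of minimal marginal cost in the range of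
the client in variable `20`, or to `0` if there is none. -/
def argminProg : Prog :=
  assign 23 0 ⨾
  forLoop 21 (var 1)
    -- Before a candidate exists, variable `23` is 0 and the second factor is 1, whatever the
    -- meaningless cell at column -1 contains. Afterwards, by integrality, that factor is positive
    -- exactly if the new facility is no dearer than the candidate.
    (.cond (rangeE (var 21) * (1 + var 23 * (margE (var 23 - 1) - margE (var 21))))
      (assign 23 (var 21 + 1)) skip)

/-- Give each client the next binary digit of her weight, at a facility of minimal marginal cost. -/
def insertProg : Prog :=
  forLoop 20 (var 0)
    (argminProg ⨾
      -- The product is positive exactly if some facility is in range and the next binary digit of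
      -- the weight is 1.
      .cond (var 23 * (weightE * (2 * var 7) / var 4 - 2 * (weightE * var 7 / var 4)))
        (bump (var 20) (var 23 - 1) 1 ⨾ bump (var 0) (var 23 - 1) 1) skip)

/-- Decode variable `21` as a client and two facilities, and move one unit from the first to the
second facility if the marginal costs there differ by more than `2`. -/
def moveProg : Prog :=
  assign 20 (var 21 / (var 1 * var 1)) ⨾
  assign 23 (var 21 / var 1 - var 20 * var 1) ⨾
  assign 24 (var 21 - var 21 / var 1 * var 1) ⨾
  .cond (rangeE (var 24) * cellE (var 20) (var 23) * (margE (var 23) - margE (var 24) - 2))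
    (bump (var 20) (var 23) (0 - 1) ⨾ bump (var 0) (var 23) (0 - 1) ⨾
      bump (var 20) (var 24) 1 ⨾ bump (var 0) (var 24) 1) skip

/-- Local search by sweeps through all moves. -/
def searchProg : Prog :=
  forLoop 22 (var 8) (forLoop 21 (var 0 * var 1 * var 1) moveProg)

/-- One scaling phase; variable `7` holds the current power of two. -/
def phaseProg : Prog := doubleProg ⨾ insertProg ⨾ searchProg ⨾ assign 7 (2 * var 7)

end prog

/-- The integral data of an instance: common denominator, scale of the weights, bound on the
denominators of the solution, scale of the approximation, ranges, and integral weights. -/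
structure Inst (n k : ℕ) where
  den : ℕ
  scale : ℕ
  det : ℕ
  goal : ℕ
  R : Fin n → Fin k → Prop
  w : Fin n → ℕ

variable {n k : ℕ}

/-- The number of sweeps in each local search. -/
def sweeps (n k : ℕ) : ℕ := (2 * n + 4) * (2 * n + 4) * (n * k) + 1

open Classical in
/-- The state of the memory in the main loop, apart from the matrix. -/
structure Env (I : Inst n k) (pw : ℕ) (st : Store) : Prop where
  var0 : st.var 0 = n
  var1 : st.var 1 = k
  var2 : st.var 2 = I.den
  var4 : st.var 4 = I.scale
  var5 : st.var 5 = I.det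
  var6 : st.var 6 = I.goal
  var7 : st.var 7 = pw
  var8 : st.var 8 = sweeps n k
  range : ∀ (i : Fin n) (j : Fin k),
    st.arr 1 ((i : ℕ) * n + st.arr 4 (j : ℕ)) = if I.R i j then 1 else 0
  weight : ∀ i : Fin n, st.arr 2 (i : ℕ) * I.den / st.arr 3 (i : ℕ) = I.w i

lemma Env.congr {I : Inst n k} {pw : ℕ} {st st' : Store} (h : Env I pw st)
    (hv : ∀ x < 9, st'.var x = st.var x) (ha : ∀ a < 5, st'.arr a = st.arr a) :
    Env I pw st' := by
  obtain ⟨h0, h1, h2, h4, h5, h6, h7, h8, hr, hw⟩ := h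
  constructor <;> simp only [hv, ha, Nat.reduceLT]
  all_goals assumption

lemma Env.setVar {I : Inst n k} {pw x : ℕ} {v : ℤ} {st : Store} (h : Env I pw st) (hx : 9 ≤ x) :
    Env I pw (st.setVar x v) :=
  h.congr (fun y hy => by rw [Store.setVar_var, if_neg (by omega)]) fun _ _ => rfl

lemma Env.setArr {I : Inst n k} {pw a : ℕ} {p v : ℤ} {st : Store} (h : Env I pw st) (ha : 5 ≤ a) :
    Env I pw (st.setArr a p v) :=
  h.congr (fun _ _ => rfl) fun b hb => by
    funext q
    rw [Store.setArr_arr, if_neg (by omega)]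

/-- The matrix in array `7`, whose row `n` holds the loads. -/
def Cells (n k : ℕ) (X : ℕ → Fin k → ℤ) (st : Store) : Prop :=
  ∀ a ≤ n, ∀ j : Fin k, st.arr 7 ((a : ℤ) * k + (j : ℕ)) = X a j

/-- A matrix with the row of its column sums. -/
def withSums (x : Fin n → Fin k → ℤ) (a : ℕ) (j : Fin k) : ℤ :=
  if h : a < n then x ⟨a, h⟩ j else ∑ i, x i j

@[simp] lemma withSums_val (x : Fin n → Fin k → ℤ) (i : Fin n) (j : Fin k) :
    withSums x i j = x i j := by
  simp [withSums]

@[simp] lemma withSums_last (x : Fin n → Fin k → ℤ) (j : Fin k) :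
    withSums x n j = ∑ i, x i j := by
  simp [withSums]

/-- Array `7` holds the integral weight distribution `x`. -/
def Holds (x : Fin n → Fin k → ℤ) (st : Store) : Prop := Cells n k (withSums x) st

lemma cell_inj {a i : ℕ} {b j : Fin k} :
    (a : ℤ) * k + (b : ℕ) = (i : ℤ) * k + (j : ℕ) ↔ a = i ∧ b = j := by
  constructor
  · intro h
    have h' : a * k + b = i * k + j := by exact_mod_cast h
    have hk : 0 < k := b.pos
    have h1 : (a * k + b) / k = a := by
      rw [mul_comm, Nat.mul_add_div hk, Nat.div_eq_of_lt b.2, add_zero]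
    have h2 : (i * k + j) / k = i := by
      rw [mul_comm, Nat.mul_add_div hk, Nat.div_eq_of_lt j.2, add_zero]
    have h3 : a = i := by rw [← h1, ← h2, h']
    subst h3
    exact ⟨rfl, Fin.ext (by omega)⟩
  · rintro ⟨rfl, rfl⟩; rfl

lemma Cells.setArr {X : ℕ → Fin k → ℤ} {st : Store} (h : Cells n k X st) (a : ℕ) (j : Fin k)
    (v : ℤ) : Cells n k (fun b i => if b = a ∧ i = j then v else X b i)
      (st.setArr 7 ((a : ℤ) * k + (j : ℕ)) v) := by
  intro b hb i
  rw [Store.setArr_arr]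
  simp only [true_and, cell_inj, h b hb i]

section eval

variable {I : Inst n k} {pw : ℕ} {st : Store} {x : Fin n → Fin k → ℤ}

lemma Env.eval_cellE (hE : Env I pw st) {X : ℕ → Fin k → ℤ} (hX : Cells n k X st) {r c : Expr}
    {a : ℕ} {j : Fin k} (ha : a ≤ n) (hr : r.eval st = a) (hc : c.eval st = (j : ℕ)) :
    (cellE r c).eval st = X a j := by
  simp [cellE, hr, hc, hE.var1, hX a ha j]

lemma Env.eval_margE (hE : Env I pw st) (hx : Holds x st) {c : Expr} {i : Fin n} {j : Fin k}
    (hi : st.var 20 = (i : ℕ)) (hc : c.eval st = (j : ℕ)) :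
    (margE c).eval st = intMarg x i j := by
  rw [margE, Expr.eval_add, hE.eval_cellE (r := .var 20) hx i.2.le hi hc,
    hE.eval_cellE (r := .var 0) hx le_rfl hE.var0 hc, withSums_val, withSums_last, intMarg]

open Classical in
lemma Env.eval_rangeE (hE : Env I pw st) {c : Expr} {i : Fin n} {j : Fin k}
    (hi : st.var 20 = (i : ℕ)) (hc : c.eval st = (j : ℕ)) :
    (rangeE c).eval st = if I.R i j then 1 else 0 := by
  simp [rangeE, hi, hc, hE.var0, hE.range]

lemma Env.eval_weightE (hE : Env I pw st) {i : Fin n} (hi : st.var 20 = (i : ℕ)) :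
    weightE.eval st = I.w i := by
  simp [weightE, hi, hE.var2, hE.weight]

end eval

lemma wp_bump {B pw a : ℕ} {I : Inst n k} {st : Store} {X : ℕ → Fin k → ℤ} {r c d : Expr}
    {j : Fin k} {δ : ℤ} {post : Store → Prop} (hE : Env I pw st) (hX : Cells n k X st) (ha : a ≤ n)
    (hr : r.eval st = a) (hc : c.eval st = (j : ℕ)) (hd : d.eval st = δ)
    (hB : |X a j + δ| ≤ B)
    (h : ∀ st', st'.var = st.var → Env I pw st' →
      Cells n k (fun b i => X b i + if b = a ∧ i = j then δ else 0) st' → post st') :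
    WP B (bump r c d)
      ((r * .var 1 + c).weight ^ 2 + (cellE r c + d).weight ^ 2 + 1) post st :=
  WP.store ((a : ℤ) * k + (j : ℕ)) (X a j + δ) (by simp [hr, hc, hE.var1])
    (by rw [Expr.eval_add, hE.eval_cellE hX ha hr hc, hd]) hB
    (h _ rfl (hE.setArr (by norm_num)) fun b hb i => by
      rw [hX.setArr a j _ b hb i]
      by_cases hc : b = a ∧ i = j
      · rw [hc.1, hc.2]; simp
      · simp [hc])

/-- The number `B` bounds everything that the algorithm computes. -/
structure Fits (n k G B : ℕ) : Prop where
  sweeps : sweeps n k ≤ B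
  triples : n * k * k ≤ B
  cells : (n + 1) * k ≤ B
  clients : n + 1 ≤ B
  facilities : k + 1 ≤ B
  loads : (n + 1) * (2 * G) + 4 ≤ B
  outputs : 2 * G * G ≤ B

/-! ### Doubling and the search for a cheapest facility -/

section specs

variable {I : Inst n k} {pw B : ℕ} {st : Store} {x : Fin n → Fin k → ℤ}

lemma wp_double (hE : Env I pw st) (hx : Holds x st) (hB : (n + 1) * k ≤ B)
    (h1 : ∀ i j, |2 * x i j| ≤ B) (h2 : ∀ j, |2 * ∑ i, x i j| ≤ B) :
    WP B doubleProg (((n + 1) * k + 1) * 150)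
      (fun st' => Env I pw st' ∧ Holds (fun i j => 2 * x i j) st') st := by
  have hX : ∀ a ≤ n, ∀ j, |2 * withSums x a j| ≤ B := by
    intro a ha j
    unfold withSums
    split_ifs
    exacts [h1 _ _, h2 _]
  refine WP.forLoop (c := 40) (fun p st' => Env I pw st' ∧
    Cells n k (fun a j => if a * k + j < p then 2 * withSums x a j else withSums x a j) st')
    ((n + 1) * k) _ (by decide) hB ⟨hE.setVar (by norm_num), fun a ha j => by
      simpa using hx a ha j⟩ ?_ ?_ ?_
  · rintro p st ⟨hE, -⟩
    simp [hE.var0, hE.var1]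
  · rintro p st hp ⟨hE, hX'⟩ hv
    have hk : 0 < k := Nat.pos_of_ne_zero (by rintro rfl; simp at hp)
    set j : Fin k := ⟨p % k, Nat.mod_lt _ hk⟩ with hj
    have ha : p / k ≤ n := Nat.lt_succ_iff.1 ((Nat.div_lt_iff_lt_mul hk).2 hp)
    have hpk : p / k * k + j = p := Nat.div_add_mod' p k
    have hp' : (p : ℤ) = ((p / k : ℕ) : ℤ) * k + (j : ℕ) := by exact_mod_cast hpk.symm
    have hcell : st.arr 7 (((p / k : ℕ) : ℤ) * k + (j : ℕ)) =
        if p / k * k + j < p then _ else withSums x (p / k) j := hX' (p / k) ha j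
    rw [if_neg (by rw [hpk]; exact lt_irrefl p), ← hp'] at hcell
    refine WP.mono_cost (WP.store (p : ℤ) (2 * withSums x (p / k) j) (by simp [hv])
      (by simp [hv, hcell]) (hX _ ha j) ?_) (by decide)
    refine ⟨hv, (hE.setArr (by norm_num)).setVar (by norm_num), ?_⟩
    have := hX'.setArr (p / k) j (2 * withSums x (p / k) j)
    rw [← hp'] at this
    intro b hb i
    rw [Store.setVar_arr, this b hb i]
    by_cases hbi : b = p / k ∧ i = j
    · obtain ⟨rfl, rfl⟩ := hbi
      simp [hpk]
    · have hne : b * k + i ≠ p := by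
        intro h
        apply hbi
        rw [← cell_inj, ← hp', ← h]
        push_cast; rfl
      simp only [hbi, if_false]
      congr 1
      simp only [eq_iff_iff]
      omega
  · rintro st ⟨hE, hX'⟩
    refine ⟨hE, fun a ha j => ?_⟩
    have h3 : a * k + j < (n + 1) * k := by
      have : a * k ≤ n * k := Nat.mul_le_mul_right _ ha
      have := j.2
      nlinarith
    rw [hX' a ha j]
    simp only [if_pos h3]
    unfold withSums
    split_ifs
    · rfl
    · rw [Finset.mul_sum]

lemma wp_argmin {i : Fin n} (hE : Env I pw st) (hx : Holds x st) (hi : st.var 20 = (i : ℕ))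
    (hB : k + 1 ≤ B) :
    WP B argminProg ((k + 1) * 2300 + 10)
      (fun st' => Env I pw st' ∧ Holds x st' ∧ st'.var 20 = (i : ℕ) ∧
        ((st'.var 23 = 0 ∧ ∀ j, ¬ I.R i j) ∨
          ∃ m : Fin k, st'.var 23 = (m : ℕ) + 1 ∧ I.R i m ∧
            ∀ j, I.R i j → intMarg x i m ≤ intMarg x i j)) st := by
  refine WP.mono_cost (WP.seq (WP.assign 0 rfl (by simp) ?_)) (c := 2 + (k + 1) * 2300)
    (by omega)
  refine WP.forLoop (c := 2200) (fun p st' => Env I pw st' ∧ Holds x st' ∧ st'.var 20 = (i : ℕ) ∧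
        ((st'.var 23 = 0 ∧ ∀ j : Fin k, j < p → ¬ I.R i j) ∨
          ∃ m : Fin k, st'.var 23 = (m : ℕ) + 1 ∧ I.R i m ∧
            ∀ j : Fin k, j < p → I.R i j → intMarg x i m ≤ intMarg x i j))
    k _ (by decide) (by omega)
    ⟨(hE.setVar (by norm_num)).setVar (by norm_num), hx, by simp [hi], Or.inl (by simp)⟩ ?_ ?_ ?_
  · rintro p st ⟨hE, -⟩
    simp [hE.var1]
  · rintro p st hp ⟨hE, hx, hi, hm⟩ hv
    set j : Fin k := ⟨p, hp⟩ with hj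
    have hvj : (Expr.var 21).eval st = (j : ℕ) := hv
    have hlt : ∀ j' : Fin k, (j' : ℕ) < p + 1 → j' < p ∨ j' = j := by
      intro j' h
      rcases Nat.lt_succ_iff_lt_or_eq.1 h with h | h
      exacts [Or.inl h, Or.inr (Fin.ext h)]
    have hr := hE.eval_rangeE hi hvj
    have hmj := hE.eval_margE hx hi hvj
    refine WP.mono_cost (WP.cond (c₁ := 17) (c₂ := 1) (fun hpos => WP.mono_cost
      (WP.assign ((j : ℕ) + 1) (by simp [hv, hj]) ?_ ?_) (by decide))
      (fun hneg => WP.skip ?_)) (by decide)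
    · rw [abs_of_nonneg (by positivity)]
      have := j.2
      exact_mod_cast (by omega : (j : ℕ) + 1 ≤ B)
    · refine ⟨by simp [hv], (hE.setVar (by norm_num)).setVar (by norm_num), hx, by simp [hi],
        Or.inr ⟨j, by simp, ?_⟩⟩
      simp only [Expr.eval_mul, hr, Expr.eval_add, Expr.eval_one, Expr.eval_sub, hmj,
        Expr.eval_var] at hpos
      by_cases hR : I.R i j
      · refine ⟨hR, fun j' hj' hRj' => ?_⟩
        rcases hlt j' hj' with h | rfl
        · rcases hm with ⟨-, h0⟩ | ⟨m, h23, hRm, hmin⟩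
          · exact absurd hRj' (h0 j' h)
          · have hmm := hE.eval_margE hx hi (c := .var 23 - 1) (j := m) (by simp [h23])
            rw [hmm, h23, if_pos hR, one_mul] at hpos
            refine le_trans ?_ (hmin j' h hRj')
            by_contra! hlt
            have h5 : intMarg x i m - intMarg x i j ≤ -1 := by omega
            nlinarith [Int.natCast_nonneg (m : ℕ)]
        · exact le_rfl
      · rw [if_neg hR, zero_mul] at hpos
        exact absurd hpos (lt_irrefl _)
    · refine ⟨hv, hE.setVar (by norm_num), hx, by simp [hi], ?_⟩
      simp only [Expr.eval_mul, hr, Expr.eval_add, Expr.eval_one, Expr.eval_sub, hmj,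
        Expr.eval_var] at hneg
      rcases hm with ⟨h23, h0⟩ | ⟨m, h23, hRm, hmin⟩
      · refine Or.inl ⟨by simp [h23], fun j' hj' => ?_⟩
        rcases hlt j' hj' with h | rfl
        · exact h0 j' h
        · intro hR
          simp [hR, h23] at hneg
      · refine Or.inr ⟨m, by simp [h23], hRm, fun j' hj' hR => ?_⟩
        rcases hlt j' hj' with h | rfl
        · exact hmin j' h hR
        · have hmm := hE.eval_margE hx hi (c := .var 23 - 1) (j := m) (by simp [h23])
          rw [hmm, h23, if_pos hR, one_mul] at hneg
          by_contra! hlt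
          apply hneg
          have : 0 ≤ (m : ℤ) := Int.natCast_nonneg (m : ℕ)
          nlinarith
  · rintro st ⟨hE, hx, hi, hm⟩
    refine ⟨hE, hx, hi, ?_⟩
    rcases hm with ⟨h23, h0⟩ | ⟨m, h23, hRm, hmin⟩
    · exact Or.inl ⟨h23, fun j => h0 j j.2⟩
    · exact Or.inr ⟨m, h23, hRm, fun j => hmin j j.2⟩

end specs

end TwoFLG

/-! ### Insertion of binary digits and single moves -/

namespace TwoFLG

open RAM

variable {n k : ℕ}

/-- The weight of a client at the scale `pw / I.scale`, rounded down. -/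
def Inst.target (I : Inst n k) (pw : ℕ) (i : Fin n) : ℕ := I.w i * pw / I.scale

lemma Inst.target_two_mul (I : Inst n k) (pw : ℕ) (i : Fin n) :
    I.target (2 * pw) i = 2 * I.target pw i ∨ I.target (2 * pw) i = 2 * I.target pw i + 1 := by
  unfold Inst.target
  rcases Nat.eq_zero_or_pos I.scale with h | h
  · simp [h]
  · have h0 : I.w i * (2 * pw) = 2 * (I.w i * pw) := by ring
    rw [h0]
    set a := I.w i * pw
    have h1 : 2 * (a / I.scale) ≤ 2 * a / I.scale := Nat.mul_div_le_mul_div_assoc _ _ _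
    have h2 : 2 * a / I.scale < 2 * (a / I.scale) + 2 := by
      rw [Nat.div_lt_iff_lt_mul h]
      have := Nat.lt_mul_div_succ a h
      nlinarith
    omega

variable {I : Inst n k} {pw B : ℕ} {st : Store} {x : Fin n → Fin k → ℤ}

lemma withSums_nonneg {W : Fin n → ℝ} (h : Feas I.R W (toReal x)) (a : ℕ) (j : Fin k) :
    0 ≤ withSums x a j := by
  unfold withSums
  split_ifs
  exacts [h.int_nonneg _ _, h.int_sum_nonneg _]

lemma withSums_le {W : Fin n → ℝ} {T : ℕ} (h : Feas I.R W (toReal x)) (hT : ∀ i, W i ≤ T) (a : ℕ)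
    (j : Fin k) : withSums x a j ≤ ((n + 1) * T : ℕ) := by
  have hT0 : (0 : ℤ) ≤ T := Int.natCast_nonneg T
  have hn : (0 : ℤ) ≤ n * T := by positivity
  push_cast
  unfold withSums
  split_ifs
  · linarith [h.int_le hT ⟨a, by assumption⟩ j]
  · linarith [h.int_sum_le hT j]

/-- A client without facilities in range is subject to no sum condition, so her nominal target may
change although none of her weight is placed. -/
lemma Feas.congr_weight {W W' : Fin n → ℝ} {R : Fin n → Fin k → Prop} {σ : Fin n → Fin k → ℝ}
    (h : Feas R W σ) (hW : ∀ i j, R i j → W' i = W i) : Feas R W' σ :=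
  ⟨h.nonneg, h.eq_zero, fun i j hr => by rw [h.sum_eq i j hr, hW i j hr]⟩

lemma Slack.mono {R : Fin n → Fin k → Prop} {σ : Fin n → Fin k → ℝ} {c c' : ℝ} (h : Slack R c σ)
    (hc : c ≤ c') : Slack R c' σ :=
  fun i j j' hr hp => (h i j j' hr hp).trans (by linarith)

/-- After `c` clients the slack is at most `2 * c + 4`: the doubled distribution starts with 4, and
each inserted unit adds at most 2 by `Slack.add_unit`. -/
lemma wp_insert {T : ℕ} (hE : Env I pw st) (hx : Holds x st)
    (hf : Feas I.R (fun i => ((2 * I.target pw i : ℕ) : ℝ)) (toReal x))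
    (hs : Slack I.R 4 (toReal x)) (hT : ∀ i, I.target (2 * pw) i ≤ T) (hB : (n + 1) * T + 4 ≤ B)
    (hn : n + 1 ≤ B) (hk : k + 1 ≤ B) :
    WP B insertProg ((n + 1) * ((k + 1) * 4000))
      (fun st' => ∃ x', Env I pw st' ∧ Holds x' st' ∧
        Feas I.R (fun i => (I.target (2 * pw) i : ℝ)) (toReal x') ∧
          Slack I.R (2 * n + 4) (toReal x')) st := by
  refine WP.forLoop (c := (k + 1) * 2300 + 10 + 1600) (fun c st' => ∃ x', Env I pw st' ∧
    Holds x' st' ∧ Feas I.R (fun a => ((if (a : ℕ) < c then I.target (2 * pw) a else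
      2 * I.target pw a : ℕ) : ℝ)) (toReal x') ∧ Slack I.R (2 * c + 4) (toReal x')) n _
    (by simp only [Expr.weight]; omega) (by omega)
    ⟨x, hE.setVar (by norm_num), hx, by simpa using hf, by simpa using hs⟩ ?_ ?_ ?_
  · rintro p st ⟨_, hE, -⟩
    simp [hE.var0]
  · rintro p st hp ⟨x, hE, hx, hf, hs⟩ hv
    set i : Fin n := ⟨p, hp⟩ with hi
    refine WP.seq ((wp_argmin (i := i) hE hx hv hk).imp ?_)
    rintro st ⟨hE, hx, hv, hm⟩
    set W : Fin n → ℝ := fun a => ((if (a : ℕ) < p then I.target (2 * pw) a else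
      2 * I.target pw a : ℕ) : ℝ) with hW
    have hWT : ∀ a, W a ≤ T := by
      intro a
      simp only [hW]
      have h1 := hT a
      have h2 := I.target_two_mul pw a
      exact_mod_cast (by split_ifs <;> omega :
        (if (a : ℕ) < p then I.target (2 * pw) a else 2 * I.target pw a) ≤ T)
    have hWi : W i = (2 * I.target pw i : ℕ) := by simp [hW, hi]
    have hWne : ∀ a, a ≠ i → (((if (a : ℕ) < p + 1 then I.target (2 * pw) a else
      2 * I.target pw a : ℕ)) : ℝ) = W a := by
      intro a ha
      have : (a : ℕ) ≠ p := fun h => ha (Fin.ext h)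
      have h2 : (a : ℕ) < p + 1 ↔ (a : ℕ) < p := by omega
      simp only [hW, h2]
    have hWi' : (((if (i : ℕ) < p + 1 then I.target (2 * pw) i else
      2 * I.target pw i : ℕ)) : ℝ) = I.target (2 * pw) i := by simp [hi]
    have hbit : (weightE * (2 * .var 7) / .var 4 - 2 * (weightE * .var 7 / .var 4)).eval st =
        (I.target (2 * pw) i : ℤ) - 2 * I.target pw i := by
      simp [hE.eval_weightE hv, hE.var7, hE.var4, Inst.target]
    -- The distribution stays unchanged both for a digit 0 and for an empty range; the hypothesis is
    -- vacuous in the second case.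
    have hstay (hW0 : ∀ j, I.R i j → I.target (2 * pw) i = 2 * I.target pw i) :
        ∃ x', Env I pw (st.setVar 20 (p + 1 : ℕ)) ∧ Holds x' (st.setVar 20 (p + 1 : ℕ)) ∧
          Feas I.R (fun a => ((if (a : ℕ) < p + 1 then I.target (2 * pw) a else
            2 * I.target pw a : ℕ) : ℝ)) (toReal x') ∧
          Slack I.R (2 * (p + 1 : ℕ) + 4) (toReal x') := by
      refine ⟨x, hE.setVar (by norm_num), hx, hf.congr_weight fun a j hr => ?_,
        hs.mono (by push_cast; linarith)⟩
      by_cases ha : a = i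
      · subst ha
        rw [hWi', hW0 j hr, hWi]
      · exact hWne a ha
    refine WP.mono_cost (WP.cond (c₁ := 420) (c₂ := 1) (fun hpos => ?_) (fun hneg => ?_))
      (by decide)
    · rw [Expr.eval_mul, hbit, Expr.eval_var] at hpos
      rcases hm with ⟨h23, -⟩ | ⟨m, h23, hRm, hmin⟩
      · rw [h23, zero_mul] at hpos
        exact absurd hpos (lt_irrefl _)
      · have htgt : I.target (2 * pw) i = 2 * I.target pw i + 1 := by
          rcases I.target_two_mul pw i with h | h
          · rw [h] at hpos; simp at hpos
          · exact h
        have hle := withSums_le hf hWT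
        have hnn := withSums_nonneg hf
        have hB' : (((n + 1) * T : ℕ) : ℤ) + 4 ≤ B := by exact_mod_cast hB
        refine WP.mono_cost (c := 209 + 209) (WP.seq (WP.mono_cost (wp_bump (j := m) (δ := 1) hE hx
          i.2.le (by simp [hv]) (by simp [h23]) rfl ?_ ?_) (by decide))) (by norm_num)
        · rw [abs_of_nonneg (by linarith [hnn i m])]
          linarith [hle i m]
        intro st₁ hv₁ hE₁ hX₁
        refine WP.mono_cost (wp_bump (j := m) (δ := 1) hE₁ hX₁
          le_rfl (by simp [hE₁.var0]) (by simp [h23, hv₁]) rfl ?_ ?_) (by decide)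
        · have := hnn n m
          have := hle n m
          rw [abs_le]
          split_ifs <;> constructor <;> linarith
        intro st₂ hv₂ hE₂ hX₂
        refine ⟨by rw [hv₂, hv₁, hv], intAdd x i m, hE₂.setVar (by norm_num), ?_, ?_, ?_⟩
        · intro a ha l
          rw [Store.setVar_arr, hX₂ a ha l]
          rcases ha.lt_or_eq with ha | rfl
          · have hain : a = i ↔ (⟨a, ha⟩ : Fin n) = i := by rw [Fin.ext_iff]
            simp [withSums, ha, ha.ne, intAdd, hain]
          · simp [(show a ≠ p from hp.ne'), hi, sum_intAdd]
        · rw [toReal_intAdd]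
          refine (hf.add_unit hRm).congr_weight fun a j hr => ?_
          by_cases ha : a = i
          · subst ha
            rw [hWi', Function.update_self, hWi, htgt]
            push_cast; ring
          · rw [Function.update_of_ne ha]; exact hWne a ha
        · rw [toReal_intAdd]
          refine (hs.add_unit (by positivity) hf.nonneg fun j hr => ?_).mono
            (by push_cast; linarith)
          rw [marg_toReal, marg_toReal]
          exact_mod_cast hmin j hr
    · refine WP.skip ⟨hv, hstay fun j hr => ?_⟩
      rw [Expr.eval_mul, hbit, Expr.eval_var] at hneg
      rcases hm with ⟨-, h0⟩ | ⟨m, h23, -⟩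
      · exact absurd hr (h0 j)
      · rcases I.target_two_mul pw i with h | h
        · exact h
        · refine absurd ?_ hneg
          rw [h23, h]
          push_cast
          have : (0 : ℤ) ≤ (m : ℕ) := Int.natCast_nonneg _
          linarith
  · rintro st ⟨x', hE, hx, hf, hs⟩
    exact ⟨x', hE, hx, by simpa using hf, hs⟩

lemma wp_move {T e : ℕ} {W : Fin n → ℝ} (hE : Env I pw st) (hx : Holds x st)
    (hf : Feas I.R W (toReal x)) (hT : ∀ i, W i ≤ T) (hB : (n + 1) * T + 4 ≤ B)
    (hn : n + 1 ≤ B) (hk : k + 1 ≤ B) {r : ℕ} (hr : st.var 22 = r) (he : st.var 21 = e)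
    {i : Fin n} {j j' : Fin k} (hij : e = (i * k + j) * k + j') :
    WP B moveProg 3000
      (fun st' => st'.var 21 = e ∧ st'.var 22 = r ∧ Env I pw st' ∧
        ((Holds x st' ∧ (I.R i j' → 0 < x i j → intMarg x i j ≤ intMarg x i j' + 2)) ∨
        ((I.R i j' ∧ 0 < x i j ∧ intMarg x i j' + 2 < intMarg x i j) ∧
          Holds (intShift x i j j') st'))) st := by
  have hk0 : 0 < k := j.pos
  have hdk : (e : ℤ) / k = i * k + j := by
    have : e / k = i * k + j := by
      rw [hij, mul_comm, Nat.mul_add_div hk0, Nat.div_eq_of_lt j'.2, add_zero]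
    exact_mod_cast this
  have hdkk : (e : ℤ) / (k * k) = i := by
    rw [← Int.ediv_ediv_of_nonneg (by positivity), hdk]
    have : (i * k + j : ℕ) / k = (i : ℕ) := by
      rw [mul_comm, Nat.mul_add_div hk0, Nat.div_eq_of_lt j.2, add_zero]
    exact_mod_cast this
  have hsmall (l : Fin k) : |((l : ℕ) : ℤ)| ≤ B := by
    rw [Nat.abs_cast]; have := l.2; exact_mod_cast (by omega : (l : ℕ) ≤ B)
  have hsmall' (l : Fin n) : |((l : ℕ) : ℤ)| ≤ B := by
    rw [Nat.abs_cast]; have := l.2; exact_mod_cast (by omega : (l : ℕ) ≤ B)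
  refine WP.mono_cost (c := 26 + (50 + (50 + 2800))) (WP.seq (WP.mono_cost
    (WP.assign (i : ℕ) (by simp [he, hE.var1, hdkk]) (hsmall' i) ?_) (by decide))) (by norm_num)
  refine WP.seq (WP.mono_cost
    (WP.assign (j : ℕ) (by simp [he, hE.var1, hdk]) (hsmall j) ?_) (by decide))
  refine WP.seq (WP.mono_cost
    (WP.assign (j' : ℕ) (by simp [he, hE.var1, hdk]; rw [hij]; push_cast; ring)
      (hsmall j') ?_) (by decide))
  generalize hst : ((st.setVar 20 (i : ℕ)).setVar 23 (j : ℕ)).setVar 24 (j' : ℕ) = st₀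
  have hE₀ : Env I pw st₀ := by
    rw [← hst]
    exact ((hE.setVar (by norm_num)).setVar (by norm_num)).setVar (by norm_num)
  have hx₀ : Holds x st₀ := by rw [← hst]; exact hx
  have h20 : st₀.var 20 = (i : ℕ) := by rw [← hst]; simp
  have h23 : st₀.var 23 = (j : ℕ) := by rw [← hst]; simp
  have h24 : st₀.var 24 = (j' : ℕ) := by rw [← hst]; simp
  have h21 : st₀.var 21 = e := by rw [← hst]; simp [he]
  have h22 : st₀.var 22 = r := by rw [← hst]; simp [hr]
  clear hst hE hx hr he
  have hnn := withSums_nonneg hf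
  have hle := withSums_le hf hT
  have hB' : (((n + 1) * T : ℕ) : ℤ) + 4 ≤ B := by exact_mod_cast hB
  have htest : (rangeE (.var 24) * cellE (.var 20) (.var 23) *
      (margE (.var 23) - margE (.var 24) - 2)).eval st₀ =
      (rangeE (.var 24)).eval st₀ * x i j * (intMarg x i j - intMarg x i j' - 2) := by
    simp only [Expr.eval_mul, Expr.eval_sub, hE₀.eval_margE hx₀ h20 (c := .var 23) h23,
      hE₀.eval_margE hx₀ h20 (c := .var 24) h24,
      hE₀.eval_cellE hx₀ i.2.le (r := .var 20) h20 (c := .var 23) h23, withSums_val]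
    rfl
  rw [hE₀.eval_rangeE h20 (c := .var 24) h24] at htest
  refine WP.mono_cost (WP.cond (c₁ := 600) (c₂ := 1) (fun hpos => ?_) (fun hneg => ?_))
    (by decide)
  · rw [htest] at hpos
    have hxn : 0 ≤ x i j := hf.int_nonneg i j
    by_cases hR : I.R i j'
    · rw [if_pos hR, one_mul] at hpos
      have hxp : 0 < x i j := by
        rcases hxn.lt_or_eq with h | h
        · exact h
        · rw [← h, zero_mul] at hpos; exact absurd hpos (lt_irrefl _)
      have hgap : intMarg x i j' + 2 < intMarg x i j := by
        have := pos_of_mul_pos_right hpos hxn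
        linarith
      have hjj : j ≠ j' := by
        rintro rfl
        linarith
      have b1 := hnn i j
      have b2 := hle i j
      have b3 := hnn n j
      have b4 := hle n j
      have b5 := hnn i j'
      have b6 := hle i j'
      have b7 := hnn n j'
      have b8 := hle n j'
      refine WP.mono_cost (c := 150 + (150 + (150 + 150))) (WP.seq (WP.mono_cost
        (wp_bump (j := j) (δ := -1) hE₀ hx₀ i.2.le (by simp [h20]) (by simp [h23]) rfl ?_ ?_)
        (by decide))) (by norm_num)
      · rw [abs_le]; constructor <;> linarith
      intro st₁ hv₁ hE₁ hX₁
      refine WP.seq (WP.mono_cost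
        (wp_bump (j := j) (δ := -1) hE₁ hX₁ le_rfl (by simp [hE₁.var0]) (by simp [h23, hv₁]) rfl
          ?_ ?_) (by decide))
      · rw [abs_le]; split_ifs <;> constructor <;> linarith
      intro st₂ hv₂ hE₂ hX₂
      refine WP.seq (WP.mono_cost
        (wp_bump (j := j') (δ := 1) hE₂ hX₂ i.2.le (by simp [h20, hv₁, hv₂])
          (by simp [h24, hv₁, hv₂]) rfl ?_ ?_) (by decide))
      · rw [abs_le]; split_ifs <;> constructor <;> linarith
      intro st₃ hv₃ hE₃ hX₃
      refine WP.mono_cost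
        (wp_bump (j := j') (δ := 1) hE₃ hX₃ le_rfl (by simp [hE₃.var0])
          (by simp [h24, hv₁, hv₂, hv₃]) rfl ?_ ?_) (by decide)
      · rw [abs_le]; split_ifs <;> constructor <;> linarith
      intro st₄ hv₄ hE₄ hX₄
      have hv : st₄.var = st₀.var := by rw [hv₄, hv₃, hv₂, hv₁]
      refine ⟨by rw [hv, h21], by rw [hv, h22], hE₄, Or.inr ⟨⟨hR, hxp, hgap⟩, ?_⟩⟩
      intro a ha l
      rw [hX₄ a ha l]
      rcases ha.lt_or_eq with ha | rfl
      · have hain : a = i ↔ (⟨a, ha⟩ : Fin n) = i := by rw [Fin.ext_iff]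
        simp only [withSums, ha, ha.ne, dite_true, intShift, hain, false_and, if_false, add_zero]
        by_cases hai : (⟨a, ha⟩ : Fin n) = i
        · simp only [hai, true_and, if_true]
          split_ifs <;> simp
        · simp [hai]
      · have hne : a ≠ (i : ℕ) := i.2.ne'
        simp only [withSums_last, hne, sum_intShift, false_and, if_false, add_zero, true_and]
        split_ifs <;> simp
    · rw [if_neg hR, zero_mul, zero_mul] at hpos
      exact absurd hpos (lt_irrefl _)
  · rw [htest] at hneg
    refine WP.skip ⟨h21, h22, hE₀, Or.inl ⟨hx₀, fun hR hxp => ?_⟩⟩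
    rw [if_pos hR, one_mul] at hneg
    by_contra! hlt
    exact hneg (mul_pos hxp (by linarith))

end TwoFLG

/-! ### Local search, phases and the scaling loop -/

namespace TwoFLG

open RAM

variable {n k : ℕ} {I : Inst n k} {pw B : ℕ} {st : Store} {x : Fin n → Fin k → ℤ}

lemma Feas.int_shift {W : Fin n → ℝ} {R : Fin n → Fin k → Prop} (hf : Feas R W (toReal x))
    {i : Fin n} {j j' : Fin k} (hr : R i j') (hp : 0 < x i j) :
    Feas R W (toReal (intShift x i j j')) := by
  have hpr : (1 : ℝ) ≤ toReal x i j := by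
    change (1 : ℝ) ≤ (x i j : ℝ)
    exact_mod_cast hp
  rw [toReal_intShift, ← one_smul ℝ (shift i j j')]
  refine hf.add_shift zero_le_one hpr ?_ hr
  by_contra hn
  linarith [hf.eq_zero i j hn]

/-- A unit move changes the potential by the difference of the marginal costs plus 2. By integrality
a gap above 2 is at least 3. -/
lemma pot_intShift_le {i : Fin n} {j j' : Fin k} (h : intMarg x i j' + 2 < intMarg x i j) :
    pot (toReal (intShift x i j j')) + 1 ≤ pot (toReal x) := by
  have hjj : j ≠ j' := by rintro rfl; linarith
  rw [toReal_intShift, pot_add_shift i hjj, marg_toReal, marg_toReal]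
  have h1 : intMarg x i j' + 3 ≤ intMarg x i j := by omega
  have h2 : (intMarg x i j' : ℝ) + 3 ≤ intMarg x i j := by exact_mod_cast h1
  linarith

/-- Until the first move the sweep inspects `x` itself, so a sweep without moves certifies slack 2,
and a first move refutes it for `x`. Later moves only lower the potential further. -/
lemma wp_sweep {T r : ℕ} {W : Fin n → ℝ} (hE : Env I pw st) (hx : Holds x st)
    (hf : Feas I.R W (toReal x)) (hT : ∀ i, W i ≤ T) (hB : (n + 1) * T + 4 ≤ B)
    (hn : n + 1 ≤ B) (hk : k + 1 ≤ B) (hnkk : n * k * k ≤ B) (hr : st.var 22 = r) :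
    WP B (.forLoop 21 (.var 0 * .var 1 * .var 1) moveProg) ((n * k * k + 1) * 3100)
      (fun st' => st'.var 22 = r ∧ ∃ x', Env I pw st' ∧ Holds x' st' ∧ Feas I.R W (toReal x') ∧
        ((x' = x ∧ Slack I.R 2 (toReal x)) ∨
          (¬ Slack I.R 2 (toReal x) ∧ pot (toReal x') + 1 ≤ pot (toReal x)))) st := by
  have hslack : Slack I.R 2 (toReal x) ↔
      ∀ i j j', I.R i j' → 0 < x i j → intMarg x i j ≤ intMarg x i j' + 2 := by
    exact_mod_cast slack_toReal (R := I.R) (x := x) (c := 2)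
  refine WP.forLoop (c := 3000) (fun e st' => st'.var 22 = r ∧ ∃ x', Env I pw st' ∧ Holds x' st' ∧
    Feas I.R W (toReal x') ∧
    ((x' = x ∧ ∀ (i : Fin n) (j j' : Fin k), (i * k + j) * k + j' < e → I.R i j' → 0 < x i j →
      intMarg x i j ≤ intMarg x i j' + 2) ∨
      (¬ Slack I.R 2 (toReal x) ∧ pot (toReal x') + 1 ≤ pot (toReal x)))) (n * k * k) _
    (by decide) hnkk ⟨by simp [hr], x, hE.setVar (by norm_num), hx, hf, Or.inl ⟨rfl, by simp⟩⟩
    ?_ ?_ ?_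
  · rintro e st ⟨-, _, hE, -⟩
    simp [hE.var0, hE.var1]
  · rintro e st he ⟨hr, x', hE, hx', hf', hcase⟩ hv
    have hk0 : 0 < k := Nat.pos_of_ne_zero (by rintro rfl; simp at he)
    have hi : e / k / k < n :=
      (Nat.div_lt_iff_lt_mul hk0).2 ((Nat.div_lt_iff_lt_mul hk0).2 he)
    set i : Fin n := ⟨e / k / k, hi⟩ with hi_def
    set j : Fin k := ⟨e / k % k, Nat.mod_lt _ hk0⟩ with hj
    set j' : Fin k := ⟨e % k, Nat.mod_lt _ hk0⟩ with hj'
    have hij : e = (i * k + j) * k + j' := by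
      simp only [hi_def, hj, hj', Nat.div_add_mod']
    refine (wp_move hE hx' hf' hT hB hn hk hr hv hij).imp ?_
    rintro st ⟨hv, hr, hE, hmove⟩
    refine ⟨hv, by simp [hr], ?_⟩
    rcases hmove with ⟨hx', hok⟩ | ⟨⟨hR, hpos, hgap⟩, hx'⟩
    · refine ⟨x', hE.setVar (by norm_num), hx', hf', ?_⟩
      rcases hcase with ⟨rfl, hall⟩ | hdrop
      · refine Or.inl ⟨rfl, fun a b b' hlt => ?_⟩
        rcases Nat.lt_succ_iff_lt_or_eq.1 hlt with h | h
        · exact hall a b b' h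
        · have h1 : (((a * k + b : ℕ) : ℤ)) * k + (b' : ℕ) =
              ((i * k + j : ℕ) : ℤ) * k + (j' : ℕ) := by
            exact_mod_cast h.trans hij
          obtain ⟨h2, rfl⟩ := cell_inj.1 h1
          have h3 : (a : ℤ) * k + (b : ℕ) = (i : ℕ) * k + (j : ℕ) := by exact_mod_cast h2
          obtain ⟨h4, rfl⟩ := cell_inj.1 h3
          obtain rfl := Fin.ext h4
          exact hok
      · exact Or.inr hdrop
    · refine ⟨intShift x' i j j', hE.setVar (by norm_num), hx', hf'.int_shift hR hpos, Or.inr ?_⟩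
      have hle := pot_intShift_le hgap
      rcases hcase with ⟨rfl, -⟩ | ⟨hns, hdrop⟩
      · refine ⟨fun hs => ?_, hle⟩
        exact absurd (hslack.1 hs i j j' hR hpos) (not_le.2 hgap)
      · exact ⟨hns, by linarith⟩
  · rintro st ⟨hr, x', hE, hx', hf', hcase⟩
    refine ⟨hr, x', hE, hx', hf', ?_⟩
    rcases hcase with ⟨rfl, hall⟩ | hdrop
    · refine Or.inl ⟨rfl, hslack.2 fun i j j' => hall i j j' ?_⟩
      have h1 : (i * k + j : ℕ) < n * k := by
        have := i.2
        have := j.2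
        nlinarith [Nat.mul_le_mul_right k (Nat.succ_le_of_lt i.2)]
      have := j'.2
      nlinarith [Nat.mul_le_mul_right k (Nat.succ_le_of_lt h1)]
    · exact Or.inr hdrop

/-- Sweeps are harmless once slack 2 is reached, so their number can be fixed in advance. If slack 2
were never reached, the potential would drop by `(2 * n + 4) ^ 2 * n * k + 1`, below its minimum by
`Slack.pot_le`. -/
lemma wp_search {T : ℕ} {W : Fin n → ℝ} (hE : Env I pw st) (hx : Holds x st)
    (hf : Feas I.R W (toReal x)) (hs : Slack I.R (2 * n + 4) (toReal x)) (hT : ∀ i, W i ≤ T)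
    (hB : (n + 1) * T + 4 ≤ B) (hn : n + 1 ≤ B) (hk : k + 1 ≤ B) (hnkk : n * k * k ≤ B)
    (hsw : sweeps n k ≤ B) (hW : ∀ i, 0 ≤ W i) :
    WP B searchProg ((sweeps n k + 1) * ((n * k * k + 1) * 3200))
      (fun st' => ∃ x', Env I pw st' ∧ Holds x' st' ∧ Feas I.R W (toReal x') ∧
        Slack I.R 2 (toReal x')) st := by
  obtain ⟨y, hy⟩ := exists_sol I.R hW
  refine WP.forLoop (c := (n * k * k + 1) * 3100) (fun r st' => ∃ x', Env I pw st' ∧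
    Holds x' st' ∧ Feas I.R W (toReal x') ∧
    (Slack I.R 2 (toReal x') ∨ pot (toReal x') + r ≤ pot (toReal x))) (sweeps n k) _
    (by simp only [Expr.weight]; omega) hsw
    ⟨x, hE.setVar (by norm_num), hx, hf, Or.inr (by simp)⟩ ?_ ?_ ?_
  · rintro e st ⟨_, hE, -⟩
    exact hE.var8
  · rintro r st hr ⟨x', hE, hx', hf', hcase⟩ hv
    refine (wp_sweep hE hx' hf' hT hB hn hk hnkk hv).imp ?_
    rintro st ⟨hv, x'', hE, hx'', hf'', hcase'⟩
    refine ⟨hv, x'', hE.setVar (by norm_num), hx'', hf'', ?_⟩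
    rcases hcase' with ⟨rfl, h⟩ | ⟨hns, hdrop⟩
    · exact Or.inl h
    · refine Or.inr ?_
      have := hcase.resolve_left hns
      push_cast
      linarith
  · rintro st ⟨x', hE, hx', hf', hcase⟩
    refine ⟨x', hE, hx', hf', hcase.resolve_right fun h => ?_⟩
    have h1 := hs.pot_le (by positivity) hf hy
    have h2 := hy.pot_le hf'
    have h3 : (sweeps n k : ℝ) = (2 * n + 4) * (2 * n + 4) * (n * k) + 1 := by
      unfold sweeps; push_cast; ring
    rw [h3] at h
    nlinarith

/-- The state of the algorithm between two phases. -/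
def Approx (I : Inst n k) (pw : ℕ) (st : Store) : Prop :=
  ∃ x : Fin n → Fin k → ℤ, Env I pw st ∧ Holds x st ∧
    Feas I.R (fun i => (I.target pw i : ℝ)) (toReal x) ∧ Slack I.R 2 (toReal x)

/-- The cost of a phase. -/
def phaseCost (n k : ℕ) : ℕ :=
  ((n + 1) * k + 1) * 150 + ((n + 1) * ((k + 1) * 4000) +
    ((sweeps n k + 1) * ((n * k * k + 1) * 3200) + 26))

lemma wp_phase (hw : ∀ i, I.w i ≤ I.scale) (hpw : pw ≤ I.goal) (hB : Fits n k I.goal B)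
    (h : Approx I pw st) :
    WP B phaseProg (phaseCost n k) (Approx I (2 * pw)) st := by
  obtain ⟨x, hE, hx, hf, hs⟩ := h
  have hle (p : ℕ) (i : Fin n) : I.target p i ≤ p := by
    unfold Inst.target
    exact Nat.div_le_of_le_mul (Nat.mul_le_mul_right _ (hw i))
  have hl := hB.loads
  have hT : (n + 1) * (2 * pw) + 4 ≤ B :=
    (Nat.add_le_add_right (Nat.mul_le_mul_left _ (by omega)) 4).trans hl
  have hT' : (n + 1) * (2 * pw) = 2 * ((n + 1) * pw) := by ring
  have hle' (i : Fin n) : (I.target pw i : ℝ) ≤ pw := by exact_mod_cast hle pw i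
  have hws := withSums_le hf hle'
  have hws0 := withSums_nonneg hf
  have hBz : (2 * ((n + 1) * pw : ℕ) : ℤ) + 4 ≤ B := by rw [hT'] at hT; exact_mod_cast hT
  refine WP.seq ((wp_double hE hx hB.cells (fun i j => ?_) (fun j => ?_)).imp ?_)
  · have h1 := hws i j
    have h2 := hws0 i j
    rw [withSums_val] at h1 h2
    rw [abs_le]; constructor <;> linarith
  · have h1 := hws n j
    have h2 := hws0 n j
    rw [withSums_last] at h1 h2
    rw [abs_le]; constructor <;> linarith
  rintro st ⟨hE, hx⟩
  have hreal : toReal (fun i j => 2 * x i j) = (2 : ℝ) • toReal x := by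
    funext i j
    simp [toReal]
  refine WP.seq ((wp_insert (T := 2 * pw) hE hx ?_ ?_ (fun i => hle _ i) hT hB.clients
    hB.facilities).imp ?_)
  · rw [hreal]
    have := hf.smul (c := 2) (by norm_num)
    convert this using 2 with i
    simp
  · rw [hreal]
    have := hs.two_smul
    norm_num at this
    exact this
  rintro st ⟨x', hE, hx, hf, hs⟩
  refine WP.seq ((wp_search (T := 2 * pw) hE hx hf hs (fun i => by exact_mod_cast hle (2 * pw) i) hT
    hB.clients hB.facilities hB.triples hB.sweeps (fun i => by positivity)).imp ?_)
  rintro st ⟨x', hE, hx, hf, hs⟩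
  refine WP.mono_cost (WP.assign ((2 * pw : ℕ) : ℤ) (by simp [hE.var7]) ?_ ?_) (by decide)
  · rw [Nat.abs_cast]
    have : 2 * pw ≤ B := le_trans (by nlinarith) hT
    exact_mod_cast this
  · refine ⟨x', ⟨?_, ?_, ?_, ?_, ?_, ?_, ?_, ?_, hE.range, hE.weight⟩, hx, hf, hs⟩
    · simpa using hE.var0
    · simpa using hE.var1
    · simpa using hE.var2
    · simpa using hE.var4
    · simpa using hE.var5
    · simpa using hE.var6
    · simp
    · simpa using hE.var8

/-- The main loop. -/
def mainProg : Prog := .loop (.var 6 - .var 7) phaseProg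

lemma wp_main (hw : ∀ i, I.w i ≤ I.scale) (hB : Fits n k I.goal B) (h : Approx I 1 st)
    (hg : 0 < I.goal) :
    WP B mainProg ((I.goal.size + 1) * (phaseCost n k + 20))
      (fun st' => ∃ a : ℕ, I.goal ≤ 2 ^ a ∧ 2 ^ a ≤ 2 * I.goal ∧ Approx I (2 ^ a) st') st := by
  refine WP.loop (c := phaseCost n k)
    -- The remaining rounds are counted by the exponent: a further round needs `2 ^ a < I.goal`,
    -- hence `a < I.goal.size`.
    (fun m st' => ∃ a : ℕ, a + m = I.goal.size ∧ 2 ^ a ≤ 2 * I.goal ∧ Approx I (2 ^ a) st')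
    I.goal.size _ ?_ ⟨0, by simp, by omega, by simpa using h⟩ ?_ ?_
  · have : (Expr.var 6 - Expr.var 7).weight ^ 2 + 1 ≤ 20 := by decide
    omega
  · rintro m st ⟨a, ha, -, hA⟩ hpos
    obtain ⟨x, hE, -⟩ := id hA
    rw [Expr.eval_sub, Expr.eval_var, Expr.eval_var, hE.var6, hE.var7] at hpos
    have hlt : 2 ^ a < I.goal := by exact_mod_cast sub_pos.1 hpos
    have ham : a < I.goal.size := Nat.lt_size.2 hlt.le
    refine ⟨m - 1, by omega, (wp_phase hw hlt.le hB hA).imp fun st' h' => ⟨a + 1, by omega, ?_, ?_⟩⟩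
    · rw [pow_succ]; omega
    · rwa [pow_succ, mul_comm]
  · rintro m st ⟨a, -, ha, hA⟩ hneg
    obtain ⟨x, hE, -⟩ := id hA
    rw [Expr.eval_sub, Expr.eval_var, Expr.eval_var, hE.var6, hE.var7] at hneg
    refine ⟨a, ?_, ha, hA⟩
    have : (I.goal : ℤ) ≤ (2 ^ a : ℕ) := by linarith
    exact_mod_cast this

end TwoFLG

namespace TwoFLG

open RAM

/-! ### The output of the algorithm -/

section prog

open RAM.Expr RAM.Prog

/-- A division step. The variables `24`, `25` hold the remainders, `26`, `27` the numerators and `28`,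
`29` the denominators of the convergents. -/
def euclidStep : Prog :=
  assign 30 (var 24 / var 25) ⨾
  assign 31 (var 24 - var 30 * var 25) ⨾ assign 24 (var 25) ⨾ assign 25 (var 31) ⨾
  assign 31 (var 26 + var 30 * var 27) ⨾ assign 26 (var 27) ⨾ assign 27 (var 31) ⨾
  assign 31 (var 28 + var 30 * var 29) ⨾ assign 28 (var 29) ⨾ assign 29 (var 31)

/-- Start the Euclidean algorithm on the matrix cell in variable `20` and the scale in variable `9`. -/
def euclidInit : Prog :=
  assign 24 (var 9) ⨾ assign 27 (get 7 (var 20) / var 9) ⨾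
  assign 25 (get 7 (var 20) - var 9 * var 27) ⨾
  assign 26 1 ⨾ assign 28 0 ⨾ assign 29 1

/-- Write the entry in variable `20` of the solution as a fraction. -/
def reconstruct : Prog :=
  euclidInit ⨾ loop (var 25 - var 10) euclidStep ⨾
  store 5 (var 20) (var 27) ⨾ store 6 (var 20) (var 29 * var 2)

/-- Write all entries of the solution as fractions. -/
def outputProg : Prog :=
  assign 9 (var 7 / var 4) ⨾ assign 10 (var 9 / (2 * var 5)) ⨾
  forLoop 20 (var 0 * var 1) reconstruct

end prog

/-- The invariant of the extended Euclidean algorithm on `P` and `Q`, run until the remainder is at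
most `θ`. -/
structure EuclidInv (P Q θ r₀ r₁ u₀ u₁ v₀ v₁ : ℤ) : Prop where
  lt₀ : θ < r₀
  r₁_nonneg : 0 ≤ r₁
  r₁_lt : r₁ < r₀
  u₀_nonneg : 0 ≤ u₀
  u₁_nonneg : 0 ≤ u₁
  v₀_nonneg : 0 ≤ v₀
  v₀_le : v₀ ≤ v₁
  v₁_pos : 0 < v₁
  sum_eq : r₀ * v₁ + r₁ * v₀ = Q
  diff : (P * v₁ - Q * u₁ = r₁ ∧ P * v₀ - Q * u₀ = -r₀) ∨
    (P * v₁ - Q * u₁ = -r₁ ∧ P * v₀ - Q * u₀ = r₀)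

namespace EuclidInv

variable {P Q θ r₀ r₁ u₀ u₁ v₀ v₁ : ℤ}

lemma init (hP : 0 ≤ P) (hθ : 0 ≤ θ) (hQ : θ < Q) :
    EuclidInv P Q θ Q (P - Q * (P / Q)) 1 (P / Q) 0 1 := by
  have hQ0 : 0 < Q := by linarith
  have h1 : P - Q * (P / Q) = P % Q := by have := Int.emod_add_mul_ediv P Q; linarith
  refine ⟨hQ, ?_, ?_, by norm_num, Int.ediv_nonneg hP hQ0.le, le_rfl, by norm_num, by norm_num,
    by ring, Or.inl ⟨by ring, by ring⟩⟩
  · rw [h1]; exact Int.emod_nonneg _ hQ0.ne'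
  · rw [h1]; exact Int.emod_lt_of_pos _ hQ0

/-- A step preserves `r₀ * v₁ + r₁ * v₀` and alternates the sign of the errors `P * v - Q * u`. The
numbers `u` and `v` therefore stay nonnegative throughout. -/
lemma step (h : EuclidInv P Q θ r₀ r₁ u₀ u₁ v₀ v₁) (hθ : 0 ≤ θ) (hr : θ < r₁) :
    EuclidInv P Q θ r₁ (r₀ - r₀ / r₁ * r₁) u₁ (u₀ + r₀ / r₁ * u₁) v₁ (v₀ + r₀ / r₁ * v₁) := by
  have hr0 : 0 < r₁ := by linarith
  have h1 : r₀ - r₀ / r₁ * r₁ = r₀ % r₁ := by have := Int.emod_add_mul_ediv r₀ r₁; linarith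
  have hq : 1 ≤ r₀ / r₁ := by
    rw [Int.le_ediv_iff_mul_le hr0]; linarith [h.r₁_lt]
  obtain ⟨-, -, hlt, hu₀, hu₁, hv₀, hv, hv₁, hsum, hdiff⟩ := h
  refine ⟨hr, ?_, ?_, hu₁, by positivity, hv₁.le, by nlinarith, by nlinarith, ?_, ?_⟩
  · rw [h1]; exact Int.emod_nonneg _ hr0.ne'
  · rw [h1]; exact Int.emod_lt_of_pos _ hr0
  · rw [← hsum]; ring
  · rcases hdiff with ⟨h2, h3⟩ | ⟨h2, h3⟩
    · exact Or.inr ⟨by linear_combination h3 + r₀ / r₁ * h2, h2⟩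
    · exact Or.inl ⟨by linear_combination h3 + r₀ / r₁ * h2, h2⟩

lemma r₀_le (h : EuclidInv P Q θ r₀ r₁ u₀ u₁ v₀ v₁) : r₀ ≤ Q := by
  have := mul_nonneg h.r₁_nonneg h.v₀_nonneg
  have := h.sum_eq
  nlinarith [h.v₁_pos, h.r₁_nonneg, h.r₁_lt]

lemma v₁_le (h : EuclidInv P Q θ r₀ r₁ u₀ u₁ v₀ v₁) : v₁ ≤ Q := by
  have := mul_nonneg h.r₁_nonneg h.v₀_nonneg
  have := h.sum_eq
  nlinarith [h.v₁_pos, h.r₁_nonneg, h.r₁_lt]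

lemma u₁_le (h : EuclidInv P Q θ r₀ r₁ u₀ u₁ v₀ v₁) (hP : 0 ≤ P) : u₁ ≤ P + 1 := by
  have h1 := h.r₀_le
  have h2 := h.v₁_le
  have h3 := h.r₁_lt
  have h4 := h.r₁_nonneg
  have hQ : 0 < Q := by linarith
  have h5 : Q * u₁ ≤ Q * (P + 1) := by
    have : P * v₁ ≤ P * Q := by gcongr
    rcases h.diff with ⟨h6, -⟩ | ⟨h6, -⟩ <;> linarith
  exact le_of_mul_le_mul_left h5 hQ

lemma abs_diff (h : EuclidInv P Q θ r₀ r₁ u₀ u₁ v₀ v₁) : |P * v₁ - Q * u₁| = r₁ := by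
  rcases h.diff with ⟨h6, -⟩ | ⟨h6, -⟩
  · rw [h6, abs_of_nonneg h.r₁_nonneg]
  · rw [h6, abs_neg, abs_of_nonneg h.r₁_nonneg]

/-- A remainder is at most half of the dividend, so it loses a binary digit. The sum of the sizes of
two consecutive remainders thus falls in each step, which gives at most `2 * Q.toNat.size` steps. -/
lemma size_lt (h : EuclidInv P Q θ r₀ r₁ u₀ u₁ v₀ v₁) (hθ : 0 ≤ θ) (hr : θ < r₁) :
    (r₀ - r₀ / r₁ * r₁).toNat.size < r₀.toNat.size := by
  have h' := h.step hθ hr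
  have hr0 : 0 < r₁ := by linarith
  have hq : 1 ≤ r₀ / r₁ := by
    rw [Int.le_ediv_iff_mul_le hr0]; linarith [h.r₁_lt]
  have h1 : 2 * (r₀ - r₀ / r₁ * r₁) ≤ r₀ := by nlinarith [h'.r₁_lt]
  have h2 : 2 * (r₀ - r₀ / r₁ * r₁).toNat ≤ r₀.toNat := by omega
  have h3 : 0 < r₀.toNat := by have := h.r₁_lt; omega
  have h4 : 0 < r₀.toNat.size := Nat.size_pos.2 h3
  have h5 := Nat.lt_size_self r₀.toNat
  obtain ⟨s, hs⟩ := Nat.exists_eq_succ_of_ne_zero h4.ne'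
  rw [hs, pow_succ] at h5
  have h6 : (r₀ - r₀ / r₁ * r₁).toNat < 2 ^ s := by omega
  have := Nat.size_le.2 h6
  omega

end EuclidInv

/-- The variables of the Euclidean algorithm. -/
def EuclidState (P Q θ : ℤ) (st : Store) : Prop :=
  EuclidInv P Q θ (st.var 24) (st.var 25) (st.var 26) (st.var 27) (st.var 28) (st.var 29)

/-- `st` and `st'` agree outside of the scratch variables. -/
def Agree (st st' : Store) : Prop := st'.arr = st.arr ∧ ∀ x < 24, st'.var x = st.var x

lemma Agree.setVar {st st' : Store} (h : Agree st st') {x : ℕ} {v : ℤ} (hx : 24 ≤ x) :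
    Agree st (st'.setVar x v) :=
  ⟨h.1, fun y hy => by rw [Store.setVar_var, if_neg (by omega)]; exact h.2 y hy⟩

lemma wp_euclidStep {B : ℕ} {P Q θ : ℤ} {st₀ st : Store} (hP : 0 ≤ P) (hθ : 0 ≤ θ)
    (hPB : P + 1 ≤ B) (hQB : Q ≤ B) (h : EuclidState P Q θ st) (hr : θ < st.var 25)
    (ha : Agree st₀ st) :
    WP B euclidStep 110 (fun st' => EuclidState P Q θ st' ∧ Agree st₀ st' ∧
      (st'.var 24).toNat.size + (st'.var 25).toNat.size <
        (st.var 24).toNat.size + (st.var 25).toNat.size) st := by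
  unfold EuclidState at h
  have h' := h.step hθ hr
  have hs := h.size_lt hθ hr
  generalize hr₀ : st.var 24 = r₀ at *
  generalize hr₁ : st.var 25 = r₁ at *
  generalize hu₀ : st.var 26 = u₀ at *
  generalize hu₁ : st.var 27 = u₁ at *
  generalize hv₀ : st.var 28 = v₀ at *
  generalize hv₁ : st.var 29 = v₁ at *
  have hr1 : 0 < r₁ := by linarith
  have b0 := h.r₀_le
  have b1 := h.v₁_le
  have b2 := h.u₁_le hP
  have b3 := h'.r₀_le
  have b4 := h'.v₁_le
  have b5 := h'.u₁_le hP
  have b6 := h'.r₁_lt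
  have n0 := h.u₁_nonneg
  have n1 := h.v₁_pos
  have n2 := h'.r₁_nonneg
  have n3 := h'.u₁_nonneg
  have n4 := h'.v₁_pos
  have q0 : 0 ≤ r₀ / r₁ := Int.ediv_nonneg (by linarith [h.r₁_lt]) hr1.le
  have q1 : r₀ / r₁ ≤ r₀ := Int.ediv_le_self _ (by linarith [h.r₁_lt])
  generalize hq : r₀ / r₁ = q at *
  have ab {z : ℤ} (h0 : 0 ≤ z) (h1 : z ≤ B) : |z| ≤ B := by rwa [abs_of_nonneg h0]
  refine WP.mono_cost (c := 10 + (26 + (2 + (2 + (26 + (2 + (2 + (26 + (2 + 2)))))))))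
    (WP.seq (WP.mono_cost (WP.assign q (by simp [hr₀, hr₁, hq]) (ab q0 (by linarith)) ?_)
      (by decide))) (by norm_num)
  refine WP.seq (WP.mono_cost (WP.assign (r₀ - q * r₁) (by simp [hr₀, hr₁])
    (ab n2 (by linarith)) ?_) (by decide))
  refine WP.seq (WP.mono_cost (WP.assign r₁ (by simp [hr₁]) (ab hr1.le (by linarith)) ?_)
    (by decide))
  refine WP.seq (WP.mono_cost (WP.assign (r₀ - q * r₁) (by simp) (ab n2 (by linarith)) ?_)
    (by decide))
  refine WP.seq (WP.mono_cost (WP.assign (u₀ + q * u₁) (by simp [hu₀, hu₁])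
    (ab n3 (by linarith)) ?_) (by decide))
  refine WP.seq (WP.mono_cost (WP.assign u₁ (by simp [hu₁]) (ab n0 (by linarith)) ?_)
    (by decide))
  refine WP.seq (WP.mono_cost (WP.assign (u₀ + q * u₁) (by simp) (ab n3 (by linarith)) ?_)
    (by decide))
  refine WP.seq (WP.mono_cost (WP.assign (v₀ + q * v₁) (by simp [hv₀, hv₁])
    (ab n4.le (by linarith)) ?_) (by decide))
  refine WP.seq (WP.mono_cost (WP.assign v₁ (by simp [hv₁]) (ab n1.le (by linarith)) ?_)
    (by decide))
  refine WP.mono_cost (WP.assign (v₀ + q * v₁) (by simp) (ab n4.le (by linarith)) ?_)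
    (by decide)
  refine ⟨by simpa [EuclidState] using h', ?_, ?_⟩
  · iterate 10 refine Agree.setVar ?_ (by norm_num)
    exact ha
  · simp only [Store.setVar_var]
    norm_num
    omega

lemma wp_euclidInit {B : ℕ} {P Q θ : ℤ} {st : Store} {p : ℕ} (hP : 0 ≤ P) (hθ : 0 ≤ θ)
    (hQ : θ < Q) (hPB : P + 1 ≤ B) (hQB : Q ≤ B) (hp : st.var 20 = p) (hPv : st.arr 7 p = P)
    (hQv : st.var 9 = Q) :
    WP B euclidInit 100 (fun st' => EuclidState P Q θ st' ∧ Agree st st' ∧ st'.var 24 = Q) st := by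
  have h := EuclidInv.init hP hθ hQ
  have b1 := h.r₀_le
  have b2 := h.u₁_le hP
  have b3 := h.r₁_lt
  have ab {z : ℤ} (h0 : 0 ≤ z) (h1 : z ≤ B) : |z| ≤ B := by rwa [abs_of_nonneg h0]
  refine WP.mono_cost (c := 2 + (20 + (40 + (5 + (5 + 5)))))
    (WP.seq (WP.mono_cost (WP.assign Q (by simp [hQv]) (ab (by linarith) (by linarith)) ?_)
      (by decide))) (by norm_num)
  refine WP.seq (WP.mono_cost (WP.assign (P / Q) (by simp [hQv, hp, hPv])
    (ab h.u₁_nonneg (by linarith)) ?_) (by decide))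
  refine WP.seq (WP.mono_cost (WP.assign (P - Q * (P / Q)) (by simp [hQv, hp, hPv])
    (ab h.r₁_nonneg (by linarith)) ?_) (by decide))
  refine WP.seq (WP.mono_cost (WP.assign 1 (by simp) (ab (by norm_num) (by linarith)) ?_)
    (by decide))
  refine WP.seq (WP.mono_cost (WP.assign 0 (by simp) (ab (by norm_num) (by linarith)) ?_)
    (by decide))
  refine WP.mono_cost (WP.assign 1 (by simp) (ab (by norm_num) (by linarith)) ?_) (by decide)
  refine ⟨by simpa [EuclidState] using h, ?_, by simp⟩
  iterate 6 refine Agree.setVar ?_ (by norm_num)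
  exact ⟨rfl, fun _ _ => rfl⟩

/-- The factor `M` in the stored denominator undoes the passage to integral weights. The fraction
need not be reduced. -/
lemma wp_reconstruct {B : ℕ} {P Q θ M : ℤ} {st : Store} {p : ℕ} (hP : 0 ≤ P) (hθ : 0 ≤ θ)
    (hQ : θ < Q) (hM : 0 ≤ M) (hPB : P + 1 ≤ B) (hQB : Q ≤ B) (hQM : Q * M ≤ B)
    (hp : st.var 20 = p) (hPv : st.arr 7 p = P) (hQv : st.var 9 = Q) (hθv : st.var 10 = θ)
    (hMv : st.var 2 = M) :
    WP B reconstruct ((2 * Q.toNat.size + 1) * 120 + 120) (fun st' =>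
      ∃ r₀ r₁ u₀ u₁ v₀ v₁, EuclidInv P Q θ r₀ r₁ u₀ u₁ v₀ v₁ ∧ r₁ ≤ θ ∧
        (∀ x < 24, st'.var x = st.var x) ∧
        st'.arr = ((st.setArr 5 p u₁).setArr 6 p (v₁ * M)).arr) st := by
  refine WP.mono_cost (c := 100 + ((2 * Q.toNat.size + 1) * 120 + (3 + 14))) (WP.seq
    ((wp_euclidInit hP hθ hQ hPB hQB hp hPv hQv).imp ?_)) (by omega)
  rintro st₁ ⟨hI₁, ha₁, h24⟩
  refine WP.seq (WP.loop (c := 110) (fun m st' => EuclidState P Q θ st' ∧ Agree st st' ∧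
      (st'.var 24).toNat.size + (st'.var 25).toNat.size ≤ m) _ _ (by decide)
      ⟨hI₁, ha₁, ?_⟩ ?_ ?_)
  · have h1 : (st₁.var 25).toNat.size ≤ (st₁.var 24).toNat.size := by
      refine Nat.size_le_size ?_
      have := hI₁.r₁_lt
      omega
    rw [h24] at *
    omega
  · rintro m st' ⟨hI, ha, hm⟩ hpos
    have h10 : st'.var 10 = θ := by rw [ha.2 10 (by norm_num), hθv]
    rw [Expr.eval_sub, Expr.eval_var, Expr.eval_var, h10, sub_pos] at hpos
    refine ⟨(st'.var 24).toNat.size + (st'.var 25).toNat.size - 1, ?_,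
      (wp_euclidStep hP hθ hPB hQB hI hpos ha).imp ?_⟩
    · have : 0 < (st'.var 25).toNat.size := Nat.size_pos.2 (by omega)
      omega
    · rintro st'' ⟨h1, h2, h3⟩
      exact ⟨h1, h2, by omega⟩
  · rintro m st' ⟨hI, ha, -⟩ hneg
    have h10 : st'.var 10 = θ := by rw [ha.2 10 (by norm_num), hθv]
    have h2 : st'.var 2 = M := by rw [ha.2 2 (by norm_num), hMv]
    have h20 : st'.var 20 = p := by rw [ha.2 20 (by norm_num), hp]
    rw [Expr.eval_sub, Expr.eval_var, Expr.eval_var, h10, sub_pos, not_lt] at hneg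
    have hu := hI.u₁_le hP
    have hv := hI.v₁_le
    refine WP.seq (WP.mono_cost (WP.store (p : ℤ) (st'.var 27) (by simp [h20]) rfl ?_ ?_)
      (by decide))
    · rw [abs_of_nonneg hI.u₁_nonneg]; linarith
    refine WP.mono_cost (WP.store (p : ℤ) (st'.var 29 * M) (by simp [h20]) (by simp [h2]) ?_ ?_)
      (by decide)
    · rw [abs_of_nonneg (mul_nonneg hI.v₁_pos.le hM)]
      exact (mul_le_mul_of_nonneg_right hv hM).trans hQM
    · refine ⟨_, _, _, _, _, _, hI, hneg, ha.2, ?_⟩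
      funext a q
      simp only [Store.setArr_arr, ha.1]

end TwoFLG

namespace TwoFLG

open RAM

variable {n k : ℕ}

lemma wp_output {I : Inst n k} {B a b : ℕ} {st : Store} (hA : Approx I (2 ^ a) st)
    (hb : I.scale = 2 ^ b) (hD : I.det = (n * k).factorial * 2 ^ (n * k))
    (hG : I.goal = I.scale * 16 * (n * k + 1) * I.det * I.det) (hGa : I.goal ≤ 2 ^ a)
    (haG : 2 ^ a ≤ 2 * I.goal) (hM : 0 < I.den) (hMG : I.den ≤ I.goal)
    (hw : ∀ i, I.w i ≤ I.scale) (hB : Fits n k I.goal B) {y : Fin n → Fin k → ℝ}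
    (hy : Sol I.R (fun i => (I.w i : ℝ)) y) :
    WP B outputProg (100 + (n * k + 1) * ((2 * (2 * I.goal).size + 1) * 120 + 200))
      (fun st' => Outputs st' fun i j => y i j / I.den) st := by
  obtain ⟨x, hE, hx, hf, hs⟩ := hA
  set Q := 2 ^ a / I.scale with hQdef
  set D := I.det with hDdef
  have hD0 : 0 < D := by rw [hD]; positivity
  have hS0 : 0 < I.scale := by rw [hb]; positivity
  have hSG : I.scale ≤ I.goal := by
    rw [hG]
    have : 0 < 16 * (n * k + 1) * D * D := by positivity
    nlinarith
  -- The final power of two is a multiple of the scale, so rounding disappears and the targets are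
  -- exactly `I.w i * Q`.
  have hba : b ≤ a := (Nat.pow_le_pow_iff_right (a := 2) (by norm_num)).1
    (by rw [← hb]; exact hSG.trans hGa)
  have hpwQ : 2 ^ a = I.scale * Q :=
    (Nat.mul_div_cancel' (by rw [hb]; exact pow_dvd_pow 2 hba)).symm
  have hQbig : 16 * (n * k + 1) * (D * D) ≤ Q := by
    rw [hpwQ, hG] at hGa
    refine Nat.le_of_mul_le_mul_left (le_trans (le_of_eq ?_) hGa) hS0
    ring
  have hQ0 : 0 < Q := lt_of_lt_of_le (by positivity) hQbig
  have hQle : Q ≤ 2 * I.goal := (Nat.div_le_self _ _).trans haG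
  have htgt (i : Fin n) : I.target (2 ^ a) i = I.w i * Q := by
    unfold Inst.target
    rw [hpwQ, mul_left_comm, Nat.mul_div_cancel_left _ hS0]
  simp only [htgt] at hf
  have hT : ∀ i, ((I.w i * Q : ℕ) : ℝ) ≤ (2 * I.goal : ℕ) := by
    intro i
    have : I.w i * Q ≤ 2 * I.goal :=
      (Nat.mul_le_mul_right _ (hw i)).trans (by rw [← hpwQ]; exact haG)
    exact_mod_cast this
  have hloads : (((n + 1) * (2 * I.goal) : ℕ) : ℤ) + 4 ≤ B := by exact_mod_cast hB.loads
  have hQB : (Q : ℤ) ≤ B := by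
    have h1 := hB.loads
    have : Q ≤ B := by nlinarith
    exact_mod_cast this
  have hQM : (Q : ℤ) * I.den ≤ B := by
    have : Q * I.den ≤ B := (Nat.mul_le_mul hQle hMG).trans hB.outputs
    exact_mod_cast this
  have hθ0 : 0 ≤ (Q : ℤ) / (2 * D) := by positivity
  have hθQ : (Q : ℤ) / (2 * D) < Q := by
    have : Q / (2 * D) < Q := Nat.div_lt_self hQ0 (by omega)
    exact_mod_cast this
  have hab {z : ℤ} (h0 : 0 ≤ z) (h1 : z ≤ B) : |z| ≤ B := by rwa [abs_of_nonneg h0]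
  refine WP.mono_cost (c := 20 + (50 + (n * k + 1) * ((2 * (2 * I.goal).size + 1) * 120 + 200)))
    (WP.seq (WP.mono_cost (WP.assign (Q : ℤ) (by simp [hE.var7, hE.var4, hQdef])
      (hab (by positivity) hQB) ?_) (by decide))) (by omega)
  refine WP.seq (WP.mono_cost (WP.assign ((Q : ℤ) / (2 * D)) (by simp [hE.var5, hDdef])
    (hab hθ0 (by linarith)) ?_) (by decide))
  refine WP.forLoop (c := (2 * (2 * I.goal).size + 1) * 120 + 120) (fun p st' =>
    Env I (2 ^ a) st' ∧ st'.var 9 = Q ∧ st'.var 10 = (Q : ℤ) / (2 * D) ∧ Holds x st' ∧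
    ∀ (i : Fin n) (j : Fin k), (i : ℕ) * k + j < p → 0 < st'.arr 6 ((i : ℕ) * k + (j : ℕ)) ∧
      y i j / I.den = (st'.arr 5 ((i : ℕ) * k + (j : ℕ)) : ℝ) / st'.arr 6 ((i : ℕ) * k + (j : ℕ)))
    (n * k) _ ?_ ?_ ⟨?_, by simp, by simp, hx, by simp⟩ ?_ ?_ ?_
  · have : (Expr.var 0 * Expr.var 1).weight = 3 := rfl
    rw [this]; omega
  · have := hB.cells
    nlinarith
  · exact ((hE.setVar (by norm_num)).setVar (by norm_num)).setVar (by norm_num)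
  · rintro p st ⟨hE, -⟩
    simp [hE.var0, hE.var1]
  · rintro p st hp ⟨hE, h9, h10, hx, hout⟩ hv
    have hk : 0 < k := Nat.pos_of_ne_zero (by rintro rfl; simp at hp)
    set i : Fin n := ⟨p / k, (Nat.div_lt_iff_lt_mul hk).2 hp⟩ with hi
    set j : Fin k := ⟨p % k, Nat.mod_lt _ hk⟩ with hj
    have hpk : (i : ℕ) * k + j = p := Nat.div_add_mod' p k
    have hpz : (p : ℤ) = ((i : ℕ) : ℤ) * k + (j : ℕ) := by exact_mod_cast hpk.symm
    have hcell : st.arr 7 p = x i j := by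
      rw [hpz, hx i i.2.le j, withSums_val]
    have hP0 := hf.int_nonneg i j
    have hP := withSums_le hf hT i j
    rw [withSums_val] at hP
    refine WP.mono_cost ((wp_reconstruct hP0 hθ0 hθQ (Int.natCast_nonneg I.den) (by linarith)
      hQB hQM hv hcell h9 h10 hE.var2).imp ?_) ?_
    · rintro st' ⟨r₀, r₁, u₀, u₁, v₀, v₁, hinv, hr₁, hvar, harr⟩
      have hE' : Env I (2 ^ a) st' := hE.congr (fun x hx => hvar x (by omega)) fun b hb => by
        rw [harr]
        funext q
        simp [(show b ≠ 5 by omega), (show b ≠ 6 by omega)]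
      refine ⟨by rw [hvar 20 (by norm_num), hv], hE'.setVar (by norm_num), ?_, ?_, ?_, ?_⟩
      · simp [hvar 9 (by norm_num), h9]
      · simp [hvar 10 (by norm_num), h10]
      · intro b hb l
        rw [Store.setVar_arr, harr]
        simpa using hx b hb l
      · intro i' j' hlt
        simp only [Store.setVar_arr, harr, Store.setArr_arr]
        by_cases hij : i' = i ∧ j' = j
        · obtain ⟨rfl, rfl⟩ := hij
          have hyij := hy.eq_div_of_small_remainder hf hs hD hQbig i j (θ := (Q : ℤ) / (2 * D)) rfl
            hinv.v₀_nonneg hinv.v₁_pos hinv.lt₀ hinv.r₁_nonneg hr₁ hinv.sum_eq hinv.abs_diff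
          simp only [← hpz, true_and, if_true]
          have hMz : (0 : ℤ) < I.den := by exact_mod_cast hM
          refine ⟨mul_pos hinv.v₁_pos hMz, ?_⟩
          rw [hyij]
          push_cast
          simp [div_div]
        · have hne : ((i' : ℕ) : ℤ) * k + (j' : ℕ) ≠ p := by
            rw [hpz]
            intro h
            obtain ⟨h1, h2⟩ := cell_inj.1 h
            exact hij ⟨Fin.ext h1, h2⟩
          have hne' : (i' : ℕ) * k + j' ≠ p := fun h => hne (by exact_mod_cast h)
          simpa [hne] using hout i' j' (by omega)
    · have : ((Q : ℤ)).toNat.size ≤ (2 * I.goal).size := Nat.size_le_size (by simpa using hQle)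
      gcongr
  · rintro st ⟨-, -, -, -, hout⟩
    intro i j
    have h1 : (i : ℕ) * k + j < n * k := by
      have := j.2
      nlinarith [Nat.mul_le_mul_right k (Nat.succ_le_of_lt i.2)]
    exact hout i j h1

/-! ### Reading the input -/

section prog

open RAM.Expr RAM.Prog

/-- The least power of two above the bound on the weights in variable `3`. -/
def scaleProg : Prog :=
  assign 4 1 ⨾ loop (var 3 + 1 - var 4) (assign 4 (var 4 * 2))

/-- Put every vertex into her own range. -/
def loopsProg : Prog := forLoop 20 (var 0) (store 1 (var 20 * var 0 + var 20) 1)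

/-- Compute the constants of the algorithm from the input. The variables `0` to `8` hold `n`, `k`, the
common denominator, the bound on the weights, the power of two above it, the bound on the denominators
of the solution, the final scale, the current scale, and the number of sweeps. -/
def initProg : Prog :=
  assign 0 (get 0 0) ⨾ assign 1 (get 0 1) ⨾
  assign 2 1 ⨾ forLoop 20 (var 0) (assign 2 (var 2 * get 3 (var 20))) ⨾
  assign 3 1 ⨾ forLoop 20 (var 0) (assign 3 (var 3 + get 2 (var 20))) ⨾
  assign 3 (var 3 * var 2) ⨾ scaleProg ⨾
  assign 5 1 ⨾ forLoop 20 (var 0 * var 1) (assign 5 (var 5 * (2 * (var 20 + 1)))) ⨾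
  assign 6 (var 4 * 16 * (var 0 * var 1 + 1) * var 5 * var 5) ⨾
  assign 8 ((2 * var 0 + 4) * (2 * var 0 + 4) * (var 0 * var 1) + 1) ⨾
  loopsProg ⨾ assign 7 1

end prog

/-- A scheme for the sums and products over the input. `F` collects the facts that survive writes to
the accumulator and to the counter. -/
lemma wp_accumulate {B x m C : ℕ} {st : Store} {e e' : Expr} (F : Store → Prop) (f : ℕ → ℕ)
    (hx : x ≠ 20) (hF : ∀ st v, F st → F (st.setVar x v) ∧ F (st.setVar 20 v))
    (he : ∀ st, F st → e.eval st = m) (he' : ∀ st c, c < m → F st → st.var x = f c →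
      st.var 20 = c → e'.eval st = f (c + 1))
    (hC : (e.weight + 2) ^ 2 + (e'.weight ^ 2 + 1) + 18 ≤ C) (hm : m ≤ B)
    (hf : ∀ c ≤ m, f c ≤ B) (h : F st) (h0 : st.var x = f 0) :
    WP B (.forLoop 20 e (.assign x e')) ((m + 1) * C)
      (fun st' => F st' ∧ st'.var x = f m) st := by
  refine WP.forLoop (fun c st' => F st' ∧ st'.var x = f c) m C hC hm
    ⟨(hF st 0 h).2, by simp [hx, h0]⟩ (fun _ _ h => he _ h.1) ?_ (fun _ h => h)
  rintro c st hc ⟨hFs, hxs⟩ hv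
  refine WP.assign (f (c + 1) : ℤ) (he' st c hc hFs hxs hv) ?_ ⟨?_, ?_, ?_⟩
  · rw [Nat.abs_cast]; exact_mod_cast hf _ hc
  · simp [hx.symm, hv]
  · exact (hF _ _ (hF _ _ hFs).1).2
  · simp [hx]

lemma wp_scale {B S : ℕ} {st : Store} (F : Store → Prop) (hF : ∀ st v, F st → F (st.setVar 4 v))
    (hB : 2 ^ S.size ≤ B) (h : F st) (h3 : st.var 3 = S) :
    WP B scaleProg ((S.size + 1) * 70 + 5) (fun st' => F st' ∧ st'.var 3 = S ∧
      st'.var 4 = (2 ^ S.size : ℕ)) st := by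
  have h1B : (1 : ℤ) ≤ B := by exact_mod_cast (Nat.one_le_two_pow.trans hB)
  refine WP.mono_cost (c := 5 + (S.size + 1) * 70)
    (WP.seq (WP.mono_cost (WP.assign 1 rfl (by simpa using h1B) ?_) (by decide))) (by omega)
  refine WP.loop (c := 26) (fun m st' => F st' ∧ st'.var 3 = S ∧
    ∃ a : ℕ, a + m = S.size ∧ st'.var 4 = (2 ^ a : ℕ)) S.size _ (by decide)
    ⟨hF _ _ h, by simp [h3], 0, by simp⟩ ?_ ?_
  · rintro m st ⟨hFs, h3, a, ha, h4⟩ hpos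
    simp only [Expr.eval_sub, Expr.eval_add, Expr.eval_var, Expr.eval_one, h3, h4] at hpos
    have hle : 2 ^ a ≤ S := by
      have : ((2 ^ a : ℕ) : ℤ) < S + 1 := by linarith
      exact_mod_cast Int.lt_add_one_iff.1 this
    have hlt : a < S.size := Nat.lt_size.2 hle
    refine ⟨m - 1, by omega, WP.mono_cost (WP.assign ((2 ^ (a + 1) : ℕ) : ℤ)
      (by simp [h4, pow_succ]) ?_ ⟨hF _ _ hFs, by simp [h3], a + 1, by omega, by simp⟩)
      (by decide)⟩
    rw [Nat.abs_cast]
    exact_mod_cast (Nat.pow_le_pow_right (by norm_num) hlt).trans hB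
  · rintro m st ⟨hFs, h3, a, ha, h4⟩ hneg
    simp only [Expr.eval_sub, Expr.eval_add, Expr.eval_var, Expr.eval_one, h3, h4] at hneg
    have hle : S < 2 ^ a := by
      have : (S : ℤ) < ((2 ^ a : ℕ) : ℤ) := by linarith
      exact_mod_cast this
    have := Nat.size_le.2 hle
    obtain rfl : a = S.size := by omega
    exact ⟨hFs, h3, h4⟩

end TwoFLG

namespace TwoFLG

open RAM

variable {n k : ℕ}

/-! ### The encoded instance -/

/-- The numerator of the weight of client `i`. -/
def HostGraph.num (H : HostGraph n) (i : ℕ) : ℕ := if h : i < n then (H.w ⟨i, h⟩).num else 0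

/-- The denominator of the weight of client `i`. -/
def HostGraph.den (H : HostGraph n) (i : ℕ) : ℕ := if h : i < n then (H.w ⟨i, h⟩).den else 1

/-- A common denominator of the weights. -/
def HostGraph.commonDen (H : HostGraph n) : ℕ := ∏ i ∈ Finset.range n, H.den i

/-- An upper bound on the weights over the common denominator. -/
def HostGraph.weightBound (H : HostGraph n) : ℕ :=
  (1 + ∑ i ∈ Finset.range n, H.num i) * H.commonDen

/-- An upper bound on the denominators of solutions for integral weights. -/
def detBound (N : ℕ) : ℕ := N.factorial * 2 ^ N

/-- The integral data of the instance. -/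
def HostGraph.inst (H : HostGraph n) (s : Fin k → Fin n) : Inst n k where
  den := H.commonDen
  scale := 2 ^ H.weightBound.size
  det := detBound (n * k)
  goal := 2 ^ H.weightBound.size * 16 * (n * k + 1) * detBound (n * k) * detBound (n * k)
  R := H.InRange s
  w i := H.num i * H.commonDen / H.den i

section inst

variable (H : HostGraph n) (s : Fin k → Fin n)

lemma HostGraph.den_pos (i : ℕ) : 0 < H.den i := by
  unfold HostGraph.den
  split_ifs
  exacts [(H.w _).den_pos, one_pos]

lemma HostGraph.commonDen_pos : 0 < H.commonDen := Finset.prod_pos fun i _ => H.den_pos i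

lemma detBound_pos (N : ℕ) : 0 < detBound N := by unfold detBound; positivity

lemma detBound_mono {N N' : ℕ} (h : N ≤ N') : detBound N ≤ detBound N' :=
  Nat.mul_le_mul (Nat.factorial_le h) (Nat.pow_le_pow_right (by norm_num) h)

lemma HostGraph.prod_den_le {c : ℕ} (hc : c ≤ n) :
    ∏ i ∈ Finset.range c, H.den i ≤ H.commonDen :=
  Finset.prod_le_prod_of_subset_of_one_le' (Finset.range_mono hc) fun i _ _ => H.den_pos i

lemma HostGraph.den_le (i : Fin n) : H.den i ≤ H.commonDen :=
  Nat.le_of_dvd H.commonDen_pos (Finset.dvd_prod_of_mem _ (Finset.mem_range.2 i.2))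

lemma HostGraph.commonDen_le : H.commonDen ≤ H.weightBound :=
  Nat.le_mul_of_pos_left _ (by omega)

lemma HostGraph.sum_num_le {c : ℕ} (hc : c ≤ n) :
    1 + ∑ i ∈ Finset.range c, H.num i ≤ H.weightBound := by
  refine le_trans ?_ (Nat.le_mul_of_pos_right _ H.commonDen_pos)
  exact Nat.add_le_add_left (Finset.sum_le_sum_of_subset (Finset.range_mono hc)) 1

lemma HostGraph.num_mul_le (i : Fin n) : H.num i * H.commonDen ≤ H.weightBound := by
  refine Nat.mul_le_mul_right _ ?_
  have := Finset.single_le_sum (f := H.num) (fun _ _ => Nat.zero_le _) (Finset.mem_range.2 i.2)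
  omega

lemma HostGraph.num_le (i : Fin n) : H.num i ≤ H.weightBound :=
  (Nat.le_mul_of_pos_right _ H.commonDen_pos).trans (H.num_mul_le i)

lemma HostGraph.weightBound_lt_scale : H.weightBound < (H.inst s).scale :=
  Nat.lt_size_self _

lemma HostGraph.inst_w_le (i : Fin n) : (H.inst s).w i ≤ (H.inst s).scale :=
  ((Nat.div_le_self _ _).trans (H.num_mul_le i)).trans (H.weightBound_lt_scale s).le

/-- The integer division in `inst` is exact, since each denominator divides the common one. -/
lemma HostGraph.inst_w_eq (i : Fin n) : ((H.inst s).w i : ℝ) = H.commonDen * (H.w i : ℝ) := by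
  have hd : H.den i ∣ H.commonDen := Finset.dvd_prod_of_mem _ (Finset.mem_range.2 i.2)
  obtain ⟨q, hq⟩ := hd
  have h0 := H.den_pos i
  have h1 : (H.inst s).w i = H.num i * q := by
    change H.num i * H.commonDen / H.den i = _
    rw [hq, mul_left_comm, Nat.mul_div_cancel_left _ h0]
  have h2 : H.num i = (H.w i).num := by simp [HostGraph.num]
  have h3 : H.den i = (H.w i).den := by simp [HostGraph.den]
  rw [h1, hq]
  have h4 : (H.w i : ℝ) = (H.num i : ℝ) / H.den i := by
    rw [h2, h3]
    exact NNRat.cast_def _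
  have h5 : (H.den i : ℝ) ≠ 0 := by exact_mod_cast h0.ne'
  rw [h4]
  push_cast
  field_simp

lemma HostGraph.scale_le_goal : 16 * (n * k + 1) * (H.inst s).scale ≤ (H.inst s).goal := by
  have h1 := detBound_pos (n * k)
  change _ ≤ (H.inst s).scale * 16 * (n * k + 1) * detBound (n * k) * detBound (n * k)
  calc 16 * (n * k + 1) * (H.inst s).scale = (H.inst s).scale * 16 * (n * k + 1) * 1 * 1 := by ring
    _ ≤ _ := by gcongr <;> exact h1

lemma HostGraph.detBound_le_goal : detBound (n * k) ≤ (H.inst s).goal := by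
  have h1 := detBound_pos (n * k)
  have h2 : 0 < (H.inst s).scale := Nat.two_pow_pos _
  change _ ≤ (H.inst s).scale * 16 * (n * k + 1) * detBound (n * k) * detBound (n * k)
  exact Nat.le_mul_of_pos_left _ (by positivity)

end inst

/-! ### The initial state -/

section init

variable (H : HostGraph n) (s : Fin k → Fin n)

lemma init_arr_natCast (input : List (List ℤ)) (a p : ℕ) :
    (Store.init input).arr a p = (input.getD a []).getD p 0 := by
  simp [Store.init]

lemma getD_ofFn {m : ℕ} (f : Fin m → ℤ) (i : Fin m) : (List.ofFn f).getD i 0 = f i := by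
  simp [List.getD_eq_getElem?_getD]

lemma init_num (i : Fin n) : (Store.init (H.encode s)).arr 2 (i : ℕ) = H.num i := by
  rw [init_arr_natCast]
  refine (getD_ofFn _ i).trans ?_
  simp [HostGraph.num]

lemma init_den (i : Fin n) : (Store.init (H.encode s)).arr 3 (i : ℕ) = H.den i := by
  rw [init_arr_natCast]
  refine (getD_ofFn _ i).trans ?_
  simp [HostGraph.den]

lemma init_loc (j : Fin k) : (Store.init (H.encode s)).arr 4 (j : ℕ) = (s j : ℕ) := by
  rw [init_arr_natCast]
  exact getD_ofFn _ j

open Classical in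
lemma init_adj (i z : Fin n) : (Store.init (H.encode s)).arr 1 ((i : ℕ) * n + (z : ℕ)) =
    if H.graph.Adj i z then 1 else 0 := by
  have hlt : (i : ℕ) * n + z < n * n := by
    have := z.2
    nlinarith [Nat.mul_le_mul_right n (Nat.succ_le_of_lt i.2)]
  have h := init_arr_natCast (H.encode s) 1 (i * n + z)
  push_cast at h
  rw [h]
  refine (getD_ofFn _ (⟨i * n + z, hlt⟩ : Fin (n * n))).trans ?_
  have h1 : (⟨i * n + z, hlt⟩ : Fin (n * n)).divNat = i := by
    ext
    simp only [Fin.coe_divNat]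
    rw [mul_comm, Nat.mul_add_div z.pos, Nat.div_eq_of_lt z.2, add_zero]
  have h2 : (⟨i * n + z, hlt⟩ : Fin (n * n)).modNat = z := by
    ext
    simp only [Fin.coe_modNat]
    rw [mul_comm, Nat.mul_add_mod, Nat.mod_eq_of_lt z.2]
  rw [h1, h2]

lemma init_matrix (p : ℤ) : (Store.init (H.encode s)).arr 7 p = 0 := by
  simp [Store.init, HostGraph.encode]

lemma init_bdd {B : ℕ} (h2 : 2 ≤ B) (hn : n ≤ B) (hk : k ≤ B) (hS : H.weightBound ≤ B) :
    (Store.init (H.encode s)).Bdd B := by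
  refine ⟨h2, fun x => by simp [Store.init], fun a p => ?_⟩
  have key : ∀ l ∈ H.encode s, ∀ z ∈ l, |z| ≤ (B : ℤ) := by
    intro l hl z hz
    have hnat {m : ℕ} (hm : m ≤ B) : |(m : ℤ)| ≤ B := by rw [Nat.abs_cast]; exact_mod_cast hm
    simp only [HostGraph.encode, List.mem_cons, List.not_mem_nil, or_false] at hl
    rcases hl with rfl | rfl | rfl | rfl | rfl
    · simp only [List.mem_cons, List.not_mem_nil, or_false] at hz
      rcases hz with rfl | rfl
      exacts [hnat hn, hnat hk]
    · obtain ⟨i, rfl⟩ := (List.mem_ofFn' _ _).1 hz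
      dsimp only
      split_ifs
      · exact hnat (m := 1) (by omega)
      · exact hnat (m := 0) (by omega)
    · obtain ⟨i, rfl⟩ := (List.mem_ofFn' _ _).1 hz
      have := H.num_le i
      simp only [HostGraph.num, i.2, dite_true] at this
      exact hnat (this.trans hS)
    · obtain ⟨i, rfl⟩ := (List.mem_ofFn' _ _).1 hz
      have := (H.den_le i).trans H.commonDen_le
      simp only [HostGraph.den, i.2, dite_true] at this
      exact hnat (this.trans hS)
    · obtain ⟨i, rfl⟩ := (List.mem_ofFn' _ _).1 hz
      exact hnat ((s i).2.le.trans hn)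
  have h0 : |(0 : ℤ)| ≤ B := by simp
  have hnil : ∀ l : List ℤ, (∀ z ∈ l, |z| ≤ (B : ℤ)) → ∀ q, |l.getD q 0| ≤ (B : ℤ) := by
    intro l hl q
    rw [List.getD_eq_getElem?_getD]
    rcases h : l[q]? with _ | z
    · simp
    · simpa using hl z (List.mem_of_getElem? h)
  simp only [Store.init]
  split_ifs
  · exact h0
  · refine hnil _ ?_ _
    rw [List.getD_eq_getElem?_getD]
    rcases h : (H.encode s)[a]? with _ | l
    · simp
    · simpa using key l (List.mem_of_getElem? h)

open Classical in
lemma wp_loops {B : ℕ} {st : Store} (hB : n ≤ B) (hB1 : 1 ≤ B) (h0 : st.var 0 = n)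
    (hadj : ∀ i z : Fin n, st.arr 1 ((i : ℕ) * n + (z : ℕ)) = if H.graph.Adj i z then 1 else 0) :
    WP B loopsProg ((n + 1) * 70) (fun st' => (∀ x ≠ 20, st'.var x = st.var x) ∧
      (∀ a ≠ 1, st'.arr a = st.arr a) ∧ ∀ i z : Fin n, st'.arr 1 ((i : ℕ) * n + (z : ℕ)) =
        if H.graph.Adj i z ∨ i = z then 1 else 0) st := by
  refine WP.forLoop (c := 40) (fun c st' => (∀ x ≠ 20, st'.var x = st.var x) ∧
      (∀ a ≠ 1, st'.arr a = st.arr a) ∧ ∀ i z : Fin n, st'.arr 1 ((i : ℕ) * n + (z : ℕ)) =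
        if H.graph.Adj i z ∨ (i = z ∧ (i : ℕ) < c) then 1 else 0) n _ (by decide) hB
    ⟨fun x hx => by simp [hx], fun _ _ => rfl, by simpa using hadj⟩ ?_ ?_ ?_
  · rintro c st' ⟨hv, -⟩
    rw [Expr.eval_var, hv 0 (by norm_num), h0]
  · rintro c st' hc ⟨hv, ha, h1⟩ hx
    have hv0 : st'.var 0 = n := by rw [hv 0 (by norm_num), h0]
    refine WP.mono_cost (WP.store ((c : ℤ) * n + c) 1 (by simp [hx, hv0]) rfl
      (by simpa using hB1) ⟨hx, fun x hx => by simp [hx, hv x hx], fun a h => ?_, ?_⟩) (by decide)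
    · rw [Store.setVar_arr, ← ha a h]
      funext q
      simp [h]
    · intro i z
      have hci := cell_inj (a := i) (i := c) (b := z) (j := ⟨c, hc⟩)
      simp only [Store.setVar_arr, Store.setArr_arr, true_and, h1 i z]
      have hiff : ((i : ℕ) : ℤ) * n + (z : ℕ) = (c : ℤ) * n + c ↔ i = z ∧ (i : ℕ) = c := by
        refine hci.trans ?_
        constructor
        · rintro ⟨h2, rfl⟩; exact ⟨Fin.ext h2, h2⟩
        · rintro ⟨rfl, h2⟩; exact ⟨h2, Fin.ext h2⟩
      simp only [hiff, Nat.lt_succ_iff_lt_or_eq]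
      by_cases hiz : i = z <;> by_cases hic : (i : ℕ) = c <;> simp [hiz, hic] <;> simp_all
  · rintro st' ⟨hv, ha, h1⟩
    exact ⟨hv, ha, fun i z => by simp [h1 i z]⟩

/-- The cost of reading the input. -/
def initCost (n k S : ℕ) : ℕ :=
  100 + ((n + 1) * 100 + ((n + 1) * 100 + ((S + 1) * 100 + ((n * k + 1) * 200 + (2000 +
    ((n + 1) * 100))))))

/-- At scale 1 every target is 0, because the weights lie strictly below the scale. The zero matrix,
which array `7` holds from the start, is therefore feasible and has slack 2 vacuously. -/
lemma wp_init {B : ℕ} (hB : Fits n k (H.inst s).goal B) :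
    WP B initProg (initCost n k H.weightBound.size) (Approx (H.inst s) 1)
      (Store.init (H.encode s)) := by
  classical
  set A := (Store.init (H.encode s)).arr with hA
  have hnat {m : ℕ} (hm : m ≤ B) : |(m : ℤ)| ≤ B := by rw [Nat.abs_cast]; exact_mod_cast hm
  have hn : n + 1 ≤ B := hB.clients
  have hk : k + 1 ≤ B := hB.facilities
  have hgB : (H.inst s).goal ≤ B := by
    have := hB.loads
    nlinarith [Nat.zero_le ((H.inst s).goal * n)]
  have hscale := H.scale_le_goal s
  have hscB : (H.inst s).scale ≤ B := by nlinarith [Nat.zero_le (n * k * (H.inst s).scale)]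
  have hSB : H.weightBound ≤ B := (H.weightBound_lt_scale s).le.trans hscB
  have hDB : detBound (n * k) ≤ B := (H.detBound_le_goal s).trans hgB
  have hnkB : n * k ≤ B := by have := hB.cells; nlinarith
  have ha00 : A 0 0 = n := by simp [hA, Store.init, HostGraph.encode]
  have ha01 : A 0 1 = k := by simp [hA, Store.init, HostGraph.encode]
  refine WP.mono_cost (c := 5 + (10 + (5 + ((n + 1) * 100 + (5 + ((n + 1) * 100 + (12 +
    ((H.weightBound.size + 1) * 70 + 5 + (5 + ((n * k + 1) * 200 + (1000 + (1000 +
      ((n + 1) * 70 + 5)))))))))))))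
    ?_ (by unfold initCost; omega)
  refine WP.seq (WP.mono_cost (WP.assign (n : ℤ) ha00 (hnat (by omega)) ?_) (by decide))
  refine WP.seq (WP.mono_cost (WP.assign (k : ℤ) ha01 (hnat (by omega)) ?_) (by decide))
  refine WP.seq (WP.mono_cost (WP.assign 1 rfl (hnat (m := 1) (by omega)) ?_) (by decide))
  refine WP.seq ((wp_accumulate (m := n) (fun st => st.arr = A ∧ st.var 0 = n ∧ st.var 1 = k)
    (fun c => ∏ i ∈ Finset.range c, H.den i) (by norm_num)
    (fun st v h => by simpa using h) (fun st h => by simpa using h.2.1) ?_ (by decide) (by omega)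
    (fun c hc => (H.prod_den_le hc).trans (H.commonDen_le.trans hSB)) (by simp [hA]) rfl).imp ?_)
  · rintro st c hc ⟨harr, -⟩ hx h20
    simp [hx, h20, harr, hA, init_den H s ⟨c, hc⟩, Finset.prod_range_succ]
  rintro st ⟨⟨harr, h0, h1⟩, h2⟩
  change st.var 2 = H.commonDen at h2
  refine WP.seq (WP.mono_cost (WP.assign 1 rfl (hnat (m := 1) (by omega)) ?_) (by decide))
  refine WP.seq ((wp_accumulate (m := n) (fun st => st.arr = A ∧ st.var 0 = n ∧ st.var 1 = k ∧
      st.var 2 = H.commonDen)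
    (fun c => 1 + ∑ i ∈ Finset.range c, H.num i) (by norm_num)
    (fun st v h => by simpa using h) (fun st h => by simpa using h.2.1) ?_ (by decide) (by omega)
    (fun c hc => (H.sum_num_le hc).trans hSB) (by simp [harr, h0, h1, h2]) rfl).imp ?_)
  · rintro st c hc ⟨harr, -⟩ hx h20
    simp [hx, h20, harr, hA, init_num H s ⟨c, hc⟩, Finset.sum_range_succ, add_assoc]
  clear harr h0 h1 h2 st
  rintro st ⟨⟨harr, h0, h1, h2⟩, h3⟩
  refine WP.seq (WP.mono_cost (WP.assign (H.weightBound : ℤ)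
    (by simp [h2, h3, HostGraph.weightBound]) (hnat hSB) ?_) (by decide))
  refine WP.seq ((wp_scale (S := H.weightBound) (fun st => st.arr = A ∧ st.var 0 = n ∧
      st.var 1 = k ∧ st.var 2 = H.commonDen) (fun st v h => by simpa using h) hscB
      (by simp [harr, h0, h1, h2]) (by simp)).imp ?_)
  clear harr h0 h1 h2 h3 st
  rintro st ⟨⟨harr, h0, h1, h2⟩, h3, h4⟩
  refine WP.seq (WP.mono_cost (WP.assign 1 rfl (hnat (m := 1) (by omega)) ?_) (by decide))
  refine WP.seq ((wp_accumulate (m := n * k) (fun st => st.arr = A ∧ st.var 0 = n ∧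
      st.var 1 = k ∧ st.var 2 = H.commonDen ∧ st.var 4 = (2 ^ H.weightBound.size : ℕ))
    detBound (by norm_num) (fun st v h => by simpa using h)
    (fun st h => by simp [h.2.1, h.2.2.1]) ?_ (by decide) hnkB
    (fun c hc => (detBound_mono hc).trans hDB) (by simp [harr, h0, h1, h2, h4]) rfl).imp ?_)
  · rintro st c hc - hx h20
    simp only [Expr.eval_mul, Expr.eval_add, Expr.eval_var, Expr.eval_one, Expr.eval_ofNat, hx, h20,
      detBound, Nat.factorial_succ, pow_succ]
    push_cast
    ring
  clear harr h0 h1 h2 h3 h4 st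
  rintro st ⟨⟨harr, h0, h1, h2, h4⟩, h5⟩
  refine WP.seq (WP.mono_cost (WP.assign ((H.inst s).goal : ℤ) ?_ (hnat hgB) ?_) (by decide))
  · simp [h0, h1, h4, h5, HostGraph.inst]
  refine WP.seq (WP.mono_cost (WP.assign (sweeps n k : ℤ) ?_ (hnat hB.sweeps) ?_) (by decide))
  · simp [h0, h1, sweeps]
  refine WP.seq ((wp_loops H (by omega) (by omega) (by simp [h0]) ?_).imp ?_)
  · simpa [harr] using init_adj H s
  rintro st' ⟨hv, ha, hadj⟩
  refine WP.mono_cost (WP.assign 1 rfl (hnat (m := 1) (by omega)) ?_) (by decide)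
  have hA' (a : ℕ) (h : a ≠ 1) : st'.arr a = A a := by rw [ha a h]; simp [harr]
  refine ⟨0, ⟨?_, ?_, ?_, ?_, ?_, ?_, ?_, ?_, fun i j => ?_, fun i => ?_⟩, ?_, ?_, ?_⟩
  · simp [hv, h0]
  · simp [hv, h1]
  · simp [hv, h2, HostGraph.inst]
  · simp [hv, h4, HostGraph.inst]
  · simp [hv, h5, HostGraph.inst]
  · simp [hv]
  · simp
  · simp [hv]
  · have h4 : st'.arr 4 (j : ℕ) = (s j : ℕ) := by rw [hA' 4 (by norm_num), hA, init_loc]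
    rw [Store.setVar_arr, h4, hadj]
    -- The diagonal was set to 1, so the matrix now encodes closed neighborhoods.
    refine if_congr ?_ rfl rfl
    simp [HostGraph.inst, HostGraph.InRange, HostGraph.facilitiesInRange, HostGraph.shoppingRange,
      or_comm, eq_comm]
  · rw [Store.setVar_arr, hA' 2 (by norm_num), hA' 3 (by norm_num), hA, init_num, init_den]
    simp [HostGraph.inst]
  · intro a ha j
    rw [Store.setVar_arr, hA' 7 (by norm_num), hA, init_matrix]
    simp [withSums]
  · have h0 (i : Fin n) : (H.inst s).target 1 i = 0 := by
      unfold Inst.target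
      rw [mul_one, Nat.div_eq_of_lt]
      exact ((Nat.div_le_self _ _).trans (H.num_mul_le i)).trans_lt (H.weightBound_lt_scale s)
    refine ⟨fun i j => by simp [toReal], fun i j _ => by simp [toReal], fun i j _ => ?_⟩
    simp [toReal, h0]
  · intro i j j' _ h
    simp [toReal] at h

end init

end TwoFLG

namespace TwoFLG

open RAM

variable {n k : ℕ}

/-! ### Polynomial bounds -/

/-- A bound on all numbers that occur in a run. -/
def memBound (n k G : ℕ) : ℕ := 16 * (n + 1) ^ 3 * (k + 1) ^ 2 * G ^ 2

lemma fits_memBound {G : ℕ} (hG : 4 ≤ G) : Fits n k G (memBound n k G) := by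
  have hG1 : 1 ≤ G := by omega
  have h1 : 1 ≤ G ^ 2 := Nat.one_le_pow _ _ hG1
  have hk : 1 ≤ k + 1 := by omega
  have hn : 1 ≤ n + 1 := by omega
  have base (a b c m : ℕ) (hm : m ≤ 16) (ha : a ≤ 3) (hb : b ≤ 2) (hc : c ≤ 2) :
      m * (n + 1) ^ a * (k + 1) ^ b * G ^ c ≤ memBound n k G := by
    unfold memBound
    gcongr
  constructor
  · refine le_trans ?_ (base 3 1 0 16 le_rfl le_rfl (by norm_num) (by norm_num))
    have h2 : (2 * n + 4) * (2 * n + 4) ≤ (4 * (n + 1)) * (4 * (n + 1)) := by gcongr <;> omega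
    have h3 : n * k + 1 ≤ (n + 1) * (k + 1) := by nlinarith
    have h4 : 1 ≤ (4 * (n + 1)) * (4 * (n + 1)) := by nlinarith
    calc sweeps n k ≤ (4 * (n + 1)) * (4 * (n + 1)) * (n * k) + 1 := by unfold sweeps; gcongr
      _ ≤ (4 * (n + 1)) * (4 * (n + 1)) * (n * k + 1) := by nlinarith
      _ ≤ (4 * (n + 1)) * (4 * (n + 1)) * ((n + 1) * (k + 1)) := by gcongr
      _ = _ := by ring
  · refine le_trans ?_ (base 1 2 0 1 (by norm_num) (by norm_num) (by norm_num) (by norm_num))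
    have : n * k * k ≤ (n + 1) * (k + 1) * (k + 1) := by gcongr <;> omega
    linarith
  · refine le_trans ?_ (base 1 1 0 1 (by norm_num) (by norm_num) (by norm_num) (by norm_num))
    have : (n + 1) * k ≤ (n + 1) * (k + 1) := by gcongr; omega
    linarith
  · exact le_trans (by simp) (base 1 0 0 1 (by norm_num) (by norm_num) (by norm_num) (by norm_num))
  · exact le_trans (by simp) (base 0 1 0 1 (by norm_num) (by norm_num) (by norm_num) (by norm_num))
  · exact le_trans (by nlinarith)
      (base 1 0 1 16 (by norm_num) (by norm_num) (by norm_num) (by norm_num))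
  · exact le_trans (by nlinarith)
      (base 0 0 2 2 (by norm_num) (by norm_num) (by norm_num) (by norm_num))

lemma size_memBound_le (n k G : ℕ) : (memBound n k G).size ≤ 5 + 3 * n + 2 * k + 2 * G.size := by
  refine Nat.size_le.2 ?_
  have h1 : n + 1 ≤ 2 ^ n := Nat.lt_two_pow_self
  have h2 : k + 1 ≤ 2 ^ k := Nat.lt_two_pow_self
  have h3 : G ≤ 2 ^ G.size := (Nat.lt_size_self G).le
  calc memBound n k G ≤ 16 * (2 ^ n) ^ 3 * (2 ^ k) ^ 2 * (2 ^ G.size) ^ 2 := by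
        unfold memBound; gcongr
    _ < 32 * (2 ^ n) ^ 3 * (2 ^ k) ^ 2 * (2 ^ G.size) ^ 2 := by gcongr; norm_num
    _ = _ := by ring

/-- It puts the sum of the numerators below a product, so that its bit length is at most the total
of their bit costs. -/
lemma one_add_sum_le_prod {ι : Type*} (t : Finset ι) (f : ι → ℕ) :
    1 + ∑ i ∈ t, f i ≤ ∏ i ∈ t, (1 + f i) := by
  classical
  induction t using Finset.induction_on with
  | empty => simp
  | insert a t ha ih =>
    rw [Finset.sum_insert ha, Finset.prod_insert ha]
    have : 0 ≤ f a * ∑ i ∈ t, f i := Nat.zero_le _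
    nlinarith [Nat.mul_le_mul_left (1 + f a) ih]

/-! ### Bit lengths in terms of the input size -/

section size

variable (H : HostGraph n) (s : Fin k → Fin n)

lemma sum_bitCost_le : ∑ i : Fin n, ((H.num i).size + 1) + ∑ i : Fin n, ((H.den i).size + 1) + k ≤
    inputSize (H.encode s) := by
  simp only [inputSize, HostGraph.encode, List.map_cons, List.map_nil, List.map_ofFn, List.sum_ofFn,
    List.sum_cons, List.sum_nil, bitCost, Function.comp_apply, Int.natAbs_natCast]
  have hnum (i : Fin n) : (H.w i).num = H.num i := by simp [HostGraph.num]
  have hden (i : Fin n) : (H.w i).den = H.den i := by simp [HostGraph.den]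
  simp only [hnum, hden]
  have : k ≤ ∑ j : Fin k, ((s j : ℕ).size + 1) := by
    calc k = ∑ j : Fin k, 1 := by simp
      _ ≤ _ := Finset.sum_le_sum fun j _ => by omega
  omega

/-- The numbers `n` and `k` themselves, not just their logarithms, are bounded by the input size, as
every list entry costs at least 1. -/
lemma le_inputSize_left : n ≤ inputSize (H.encode s) := by
  have h := sum_bitCost_le H s
  have : n ≤ ∑ i : Fin n, ((H.num i).size + 1) := by
    calc n = ∑ i : Fin n, 1 := by simp
      _ ≤ _ := Finset.sum_le_sum fun j _ => by omega
  omega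

lemma le_inputSize_right : k ≤ inputSize (H.encode s) := by
  have h := sum_bitCost_le H s
  omega

lemma size_weightBound_le : H.weightBound.size ≤ inputSize (H.encode s) + 1 := by
  refine Nat.size_le.2 (lt_of_le_of_lt ?_ (Nat.pow_lt_pow_right (by norm_num) (Nat.lt_succ_self _)))
  have h1 : 1 + ∑ i ∈ Finset.range n, H.num i ≤ 2 ^ ∑ i : Fin n, ((H.num i).size + 1) := by
    rw [Finset.sum_range, Finset.prod_pow_eq_pow_sum Finset.univ _ 2 |>.symm]
    calc 1 + ∑ i : Fin n, H.num i ≤ ∏ i : Fin n, (1 + H.num i) :=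
          one_add_sum_le_prod _ _
      _ ≤ ∏ i : Fin n, 2 ^ ((H.num i).size + 1) := by
        refine Finset.prod_le_prod' fun i _ => ?_
        have := Nat.lt_size_self (H.num i)
        rw [pow_succ]; omega
  have h2 : H.commonDen ≤ 2 ^ ∑ i : Fin n, ((H.den i).size + 1) := by
    unfold HostGraph.commonDen
    rw [Finset.prod_range, Finset.prod_pow_eq_pow_sum Finset.univ _ 2 |>.symm]
    refine Finset.prod_le_prod' fun i _ => ?_
    have := Nat.lt_size_self (H.den i)
    rw [pow_succ]; omega
  calc H.weightBound ≤ 2 ^ (∑ i : Fin n, ((H.num i).size + 1)) *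
        2 ^ (∑ i : Fin n, ((H.den i).size + 1)) := Nat.mul_le_mul h1 h2
    _ = 2 ^ (∑ i : Fin n, ((H.num i).size + 1) + ∑ i : Fin n, ((H.den i).size + 1)) := by
      rw [pow_add]
    _ ≤ _ := Nat.pow_le_pow_right (by norm_num) (by have := sum_bitCost_le H s; omega)

lemma detBound_le (N : ℕ) : detBound N ≤ 2 ^ (N * N + N) := by
  unfold detBound
  rw [pow_add, pow_mul]
  gcongr
  exact (Nat.factorial_le_pow N).trans (Nat.pow_le_pow_left Nat.lt_two_pow_self.le N)

/-- The two factors `detBound (n * k)` dominate: each has at most about `(n * k) ^ 2` bits, so the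
number of phases is polynomial. -/
lemma size_goal_le : (H.inst s).goal.size ≤
    H.weightBound.size + 5 + 3 * (n * k) + 2 * (n * k) ^ 2 := by
  refine Nat.size_le.2 ?_
  have h1 := detBound_le (n * k)
  have h2 : n * k + 1 ≤ 2 ^ (n * k) := Nat.lt_two_pow_self
  calc (H.inst s).goal ≤ 2 ^ H.weightBound.size * 16 * 2 ^ (n * k) * 2 ^ (n * k * (n * k) + n * k) *
        2 ^ (n * k * (n * k) + n * k) := by
        change 2 ^ H.weightBound.size * 16 * (n * k + 1) * detBound (n * k) * detBound (n * k) ≤ _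
        gcongr
    _ < 2 ^ H.weightBound.size * 32 * 2 ^ (n * k) * 2 ^ (n * k * (n * k) + n * k) *
        2 ^ (n * k * (n * k) + n * k) := by gcongr; norm_num
    _ = _ := by ring

end size

/-- The cost of the whole algorithm, where `S` and `l` are the sizes of the bound on the weights and
of the final scale. -/
def totalCost (n k S l : ℕ) : ℕ :=
  initCost n k S + ((l + 1) * (phaseCost n k + 20) +
    (100 + (n * k + 1) * ((2 * (l + 1) + 1) * 120 + 200)))

lemma phaseCost_le {X : ℕ} (hn : n + 1 ≤ X) (hk : k + 1 ≤ X) : phaseCost n k ≤ 62000 * X ^ 7 := by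
  have hX : 1 ≤ X := by omega
  have hn' : n ≤ X := by omega
  have hk' : k ≤ X := by omega
  have hp {a b : ℕ} (h : a ≤ b) : X ^ a ≤ X ^ b := Nat.pow_le_pow_right hX h
  have h1 : sweeps n k + 1 ≤ 18 * X ^ 4 := by
    have : sweeps n k ≤ (4 * X) * (4 * X) * (X * X) + 1 := by
      unfold sweeps
      gcongr <;> omega
    have h0 := hp (show 0 ≤ 4 by norm_num)
    nlinarith
  have h2 : n * k * k + 1 ≤ X ^ 3 := by
    have h3 : (n + 1) * (k + 1) * (k + 1) ≤ X * X * X := by gcongr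
    nlinarith [Nat.zero_le (n * k), Nat.zero_le (n * k * k)]
  have h4 : (n + 1) * k + 1 ≤ 2 * X ^ 2 := by
    have : (n + 1) * k ≤ X * X := by gcongr
    nlinarith
  calc phaseCost n k ≤ 2 * X ^ 2 * 150 + (X * (X * 4000) + (18 * X ^ 4 * (X ^ 3 * 3200) + 26)) := by
        unfold phaseCost; gcongr
    _ = 4300 * X ^ 2 + 57600 * X ^ 7 + 26 * X ^ 0 := by ring
    _ ≤ 4300 * X ^ 7 + 57600 * X ^ 7 + 26 * X ^ 7 := by gcongr <;> first | exact hX | norm_num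
    _ ≤ _ := by omega

lemma totalCost_le {X S l : ℕ} (hn : n + 1 ≤ X) (hk : k + 1 ≤ X) (hS : S + 1 ≤ 13 * X ^ 4)
    (hl : l + 1 ≤ 13 * X ^ 4) : totalCost n k S l ≤ 900000 * X ^ 11 := by
  have hX : 1 ≤ X := by omega
  have hphase := phaseCost_le hn hk
  have h1 : n * k + 1 ≤ X ^ 2 := by nlinarith [Nat.mul_le_mul hn hk]
  have hX6 : 1 ≤ X ^ 4 := Nat.one_le_pow _ _ hX
  have hX7 : 1 ≤ X ^ 7 := Nat.one_le_pow _ _ hX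
  calc totalCost n k S l ≤ (100 + (X * 100 + (X * 100 + (13 * X ^ 4 * 100 + (X ^ 2 * 200 + (2000 +
        (X * 100))))))) + (13 * X ^ 4 * (62000 * X ^ 7 + 20 * X ^ 7) +
        (100 + X ^ 2 * ((2 * (13 * X ^ 4) + X ^ 4) * 120 + 200 * X ^ 4))) := by
        unfold totalCost initCost
        gcongr <;> omega
    _ = 2200 * X ^ 0 + 300 * X ^ 1 + 1300 * X ^ 4 + 200 * X ^ 2 + 806260 * X ^ 11 +
        3440 * X ^ 6 := by ring
    _ ≤ 2200 * X ^ 11 + 300 * X ^ 11 + 1300 * X ^ 11 + 200 * X ^ 11 + 806260 * X ^ 11 +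
        3440 * X ^ 11 := by gcongr <;> first | exact hX | norm_num
    _ ≤ _ := by omega

/-! ### The algorithm -/

/-- The program that computes the client equilibrium. -/
def equilibriumProg : Prog := .seq initProg (.seq mainProg outputProg)

lemma wp_equilibrium (H : HostGraph n) (s : Fin k → Fin n) {σ : Fin n → Fin k → ℝ}
    (hσ : Sol (H.InRange s) (fun i => (H.w i : ℝ)) σ) :
    WP (memBound n k (H.inst s).goal) equilibriumProg
      (totalCost n k H.weightBound.size (H.inst s).goal.size) (fun st => Outputs st σ)
      (Store.init (H.encode s)) := by
  have hscale : 0 < (H.inst s).scale := Nat.two_pow_pos _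
  have hsg := H.scale_le_goal s
  have hg : 16 ≤ (H.inst s).goal := by nlinarith [Nat.zero_le (n * k * (H.inst s).scale)]
  have hsg' : (H.inst s).scale ≤ (H.inst s).goal := by
    nlinarith [Nat.zero_le (n * k * (H.inst s).scale)]
  have hB := fits_memBound (n := n) (k := k) (by omega : 4 ≤ (H.inst s).goal)
  have hM := H.commonDen_pos
  have hMr : (0 : ℝ) < H.commonDen := by exact_mod_cast hM
  have hy : Sol (H.inst s).R (fun i => ((H.inst s).w i : ℝ)) ((H.commonDen : ℝ) • σ) := by
    have hW : (fun i => ((H.inst s).w i : ℝ)) = (H.commonDen : ℝ) • fun i => (H.w i : ℝ) :=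
      funext fun i => H.inst_w_eq s i
    rw [hW]
    exact hσ.smul hMr
  refine WP.seq ((wp_init H s hB).imp fun st hA => WP.seq ((wp_main (H.inst_w_le s) hB hA
    (by omega)).imp ?_))
  rintro st ⟨a, ha, ha', hA⟩
  refine WP.mono (wp_output hA rfl rfl rfl ha ha' hM
    ((H.commonDen_le.trans (H.weightBound_lt_scale s).le).trans hsg') (H.inst_w_le s) hB hy) ?_ ?_
  · have : (2 * (H.inst s).goal).size ≤ (H.inst s).goal.size + 1 := by
      refine Nat.size_le.2 ?_
      have := Nat.lt_size_self (H.inst s).goal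
      rw [pow_succ]; omega
    gcongr
  · intro st h
    have hs : (fun i j => ((H.commonDen : ℝ) • σ) i j / ((H.inst s).den : ℝ)) = σ := by
      funext i j
      change (H.commonDen : ℝ) * σ i j / H.commonDen = σ i j
      field_simp
    rwa [hs] at h

/-- With `X = inputSize + 1`, the run costs `O(X ^ 11)` units of `O(X ^ 4)` each: the scale has `O(X
^ 4)` bits, hence that many phases, and each phase takes `O(X ^ 7)` units. -/
lemma exec_equilibrium (H : HostGraph n) (s : Fin k → Fin n) {σ : Fin n → Fin k → ℝ}
    (hσ : Sol (H.InRange s) (fun i => (H.w i : ℝ)) σ) :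
    ∃ st t, Exec equilibriumProg (Store.init (H.encode s)) st t ∧
      t ≤ 40000000 * (inputSize (H.encode s) + 1) ^ 15 ∧ Outputs st σ := by
  set L := inputSize (H.encode s) with hL
  set G := (H.inst s).goal with hG
  have hn : n ≤ L := le_inputSize_left H s
  have hk : k ≤ L := le_inputSize_right H s
  have hS := size_weightBound_le H s
  have hl := size_goal_le H s
  rw [← hL] at hS
  rw [← hG] at hl
  have hnk : n * k ≤ L * L := Nat.mul_le_mul hn hk
  have hnk2 : (n * k) ^ 2 ≤ (L * L) ^ 2 := Nat.pow_le_pow_left hnk 2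
  have hX4 : L + L ^ 2 + L ^ 4 + 1 ≤ (L + 1) ^ 4 := by
    nlinarith [Nat.zero_le (L ^ 3), Nat.zero_le (L ^ 2), Nat.zero_le L]
  have hl' : G.size + 1 ≤ 13 * (L + 1) ^ 4 := by nlinarith
  have hS' : H.weightBound.size + 1 ≤ 13 * (L + 1) ^ 4 := by nlinarith
  have hm := size_memBound_le n k G
  have hm' : (memBound n k G).size + 2 ≤ 40 * (L + 1) ^ 4 := by nlinarith
  have hsg := H.scale_le_goal s
  have hscale : H.weightBound < (H.inst s).scale := H.weightBound_lt_scale s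
  have hsg' : (H.inst s).scale ≤ G := by nlinarith [Nat.zero_le (n * k * (H.inst s).scale)]
  have hg : 16 ≤ G := by nlinarith [Nat.zero_le (n * k * (H.inst s).scale)]
  have hB := fits_memBound (n := n) (k := k) (by omega : 4 ≤ G)
  have hGB : G ≤ memBound n k G := by
    have := hB.loads
    nlinarith [Nat.zero_le (G * n)]
  have h2B : 2 ≤ memBound n k G := by omega
  obtain ⟨st, t, h1, h2, -, h4⟩ := wp_equilibrium H s hσ (init_bdd H s h2B
    ((Nat.le_succ n).trans hB.clients) ((Nat.le_succ k).trans hB.facilities)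
    ((hscale.le.trans hsg').trans hGB))
  refine ⟨st, t, h1, h2.trans ?_, h4⟩
  calc _ ≤ 900000 * (L + 1) ^ 11 * (40 * (L + 1) ^ 4) :=
        Nat.mul_le_mul (totalCost_le (by omega) (by omega) hS' hl') hm'
    _ = 36000000 * (L + 1) ^ 15 := by ring
    _ ≤ _ := by gcongr; norm_num

end TwoFLG

theorem mainTheorem2 :
    ∃ (P : RAM.Prog) (p : Polynomial ℕ),
      ∀ (n k : ℕ) (H : TwoFLG.HostGraph n) (s : Fin k → Fin n),
        (∃! σ : Fin n → Fin k → ℝ, H.IsClientEquilibrium s σ) ∧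
        ∃ (st : RAM.Store) (t : ℕ) (σ : Fin n → Fin k → ℝ),
          RAM.Exec P (RAM.Store.init (H.encode s)) st t ∧
          t ≤ p.eval (RAM.inputSize (H.encode s)) ∧
          H.IsClientEquilibrium s σ ∧
          TwoFLG.Outputs st σ := by
  refine ⟨TwoFLG.equilibriumProg, .C 40000000 * (.X + .C 1) ^ 15, fun n k H s => ?_⟩
  obtain ⟨σ, hσ⟩ := TwoFLG.exists_sol (H.InRange s) (W := fun i => (H.w i : ℝ))
    fun i => NNRat.cast_nonneg _
  refine ⟨⟨σ, TwoFLG.isClientEquilibrium_iff.2 hσ, fun τ hτ =>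
    (TwoFLG.isClientEquilibrium_iff.1 hτ).unique hσ⟩, ?_⟩
  obtain ⟨st, t, h1, h2, h3⟩ := TwoFLG.exec_equilibrium H s hσ
  exact ⟨st, t, σ, h1, by simpa using h2, TwoFLG.isClientEquilibrium_iff.2 hσ, h3⟩
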